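/- Assume $\mathrm{W}[1]\neq\mathrm{FPT}$, in the following form: there is no computable function $T:\mathbb N\to\mathbb N$ and no algorithm that, given a graph $G$ on $n$ vertices and an integer $k$, decides in time $T(k)\cdot\mathrm{poly}(n)$ whether $G$ has a clique with $k$ vertices. Say that an algorithm approximates $k$-DomSet within a factor $\rho(n,k)$ in FPT time if, for some computable $T:\mathbb N\to\mathbb N$, it runs in time $T(k)\cdot\mathrm{poly}(n)$ on every input $(G,k)$ with $G$ a graph on $n$ vertices, and, whenever the minimum dominating set of $G$ has size at most $k$, it outputs a dominating set of $G$ of size at most $\rho(n,k)\cdot k$. (Algorithms are deterministic random access machines whose arithmetic consists of addition, subtraction and halving, at unit cost.) Then: 1. There is a polynomial $p$, with $p(k)>0$ for all $k\in\mathbb N$, such that no algorithm approximates $k$-DomSet within the factor $\max\{1,(\log_2 n)^{1/p(k)}\}$ in FPT time. 2. For every computable function $F:\mathbb N\to\mathbb N$, no algorithm approximates $k$-DomSet within the factor $F(k)$ in FPT time. -/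

import Mathlib

/-! ### Random access machines with a step count

A machine has registers `reg 0, reg 1, …`, which a program addresses directly (so each program uses
only finitely many of them), and a main memory `mem 0, mem 1, …`, which it addresses through
registers. Programs are deterministic; the cost measure is uniform. The arithmetic consists of
addition, truncated subtraction and halving only, so that one step lengthens the binary
representation of the largest stored number by at most one bit. -/

/-- A memory state: the contents of the registers and of the main memory. -/
@[ext]
structure RamState where
  reg : ℕ → ℕ
  mem : ℕ → ℕ

namespace RamState

/-- Write `x` into register `i`. -/
def setReg (s : RamState) (i x : ℕ) : RamState :=
  { s with reg := Function.update s.reg i x }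

/-- Write `x` into memory cell `a`. -/
def setMem (s : RamState) (a x : ℕ) : RamState :=
  { s with mem := Function.update s.mem a x }

end RamState

/-- Random access machine programs. -/
inductive RamProg : Type
  /-- do nothing -/
  | skip : RamProg
  /-- `reg i := c` -/
  | const (i c : ℕ) : RamProg
  /-- `reg i := reg j + reg l` -/
  | add (i j l : ℕ) : RamProg
  /-- `reg i := reg j - reg l`, truncated at `0` -/
  | sub (i j l : ℕ) : RamProg
  /-- `reg i := ⌊reg j / 2⌋` -/
  | half (i j : ℕ) : RamProg
  /-- `reg i := mem (reg j)` -/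
  | load (i j : ℕ) : RamProg
  /-- `mem (reg i) := reg j` -/
  | store (i j : ℕ) : RamProg
  /-- first `p`, then `q` -/
  | seq (p q : RamProg) : RamProg
  /-- if `reg i ≠ 0` then `p` else `q` -/
  | cond (i : ℕ) (p q : RamProg) : RamProg
  /-- while `reg i ≠ 0` do `p` -/
  | loop (i : ℕ) (p : RamProg) : RamProg

/-- `RamRuns p s t s'`: started in state `s`, the program `p` halts after exactly `t` steps, in
state `s'`. Every elementary instruction and every test costs one step. -/
inductive RamRuns : RamProg → RamState → ℕ → RamState → Prop
  | skip (s : RamState) : RamRuns .skip s 1 s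
  | const (s : RamState) (i c : ℕ) : RamRuns (.const i c) s 1 (s.setReg i c)
  | add (s : RamState) (i j l : ℕ) :
      RamRuns (.add i j l) s 1 (s.setReg i (s.reg j + s.reg l))
  | sub (s : RamState) (i j l : ℕ) :
      RamRuns (.sub i j l) s 1 (s.setReg i (s.reg j - s.reg l))
  | half (s : RamState) (i j : ℕ) : RamRuns (.half i j) s 1 (s.setReg i (s.reg j / 2))
  | load (s : RamState) (i j : ℕ) : RamRuns (.load i j) s 1 (s.setReg i (s.mem (s.reg j)))
  | store (s : RamState) (i j : ℕ) : RamRuns (.store i j) s 1 (s.setMem (s.reg i) (s.reg j))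
  | seq {p q : RamProg} {s s' s'' : RamState} {t t' : ℕ} :
      RamRuns p s t s' → RamRuns q s' t' s'' → RamRuns (.seq p q) s (t + t') s''
  | cond_true {p q : RamProg} {i : ℕ} {s s' : RamState} {t : ℕ} :
      s.reg i ≠ 0 → RamRuns p s t s' → RamRuns (.cond i p q) s (t + 1) s'
  | cond_false {p q : RamProg} {i : ℕ} {s s' : RamState} {t : ℕ} :
      s.reg i = 0 → RamRuns q s t s' → RamRuns (.cond i p q) s (t + 1) s'
  | loop_done {p : RamProg} {i : ℕ} {s : RamState} :
      s.reg i = 0 → RamRuns (.loop i p) s 1 s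
  | loop_step {p : RamProg} {i : ℕ} {s s' s'' : RamState} {t t' : ℕ} :
      s.reg i ≠ 0 → RamRuns p s t s' → RamRuns (.loop i p) s' t' s'' →
        RamRuns (.loop i p) s (t + t' + 1) s''

/-! ### Parameterized graph problems -/

open Classical in
/-- The initial state for the instance `(G, k)`, where `G` is a graph with vertices `0, …, n - 1`:
cell `0` holds `n`, cell `1` holds `k`, then follows the adjacency matrix of `G`, row by row.
All other cells and all registers are `0`. -/
noncomputable def graphInput (n k : ℕ) (G : SimpleGraph (Fin n)) : RamState where
  reg := fun _ => 0
  mem := fun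
    | 0 => n
    | 1 => k
    | a + 2 => if ∃ u v : Fin n, a = (u : ℕ) * n + v ∧ G.Adj u v then 1 else 0

/-- The program `P` runs in FPT time on the inputs `(G, k)` (with `G` a graph on `n` vertices and
parameter `k`), that is, in time `T k * poly n` with `T` computable, and its final state on `(G, k)`
satisfies `Q n k G`. -/
def RunsInFPTTime (P : RamProg) (Q : (n k : ℕ) → SimpleGraph (Fin n) → RamState → Prop) : Prop :=
  ∃ (T : ℕ → ℕ) (c : ℕ), Computable T ∧
    ∀ (n k : ℕ) (G : SimpleGraph (Fin n)), ∃ (t : ℕ) (s : RamState),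
      RamRuns P (graphInput n k G) t s ∧ t ≤ T k * (n + 1) ^ c ∧ Q n k G s

/-- `P` solves `k`-Clique in FPT time: cell `0` finally holds `1` if `G` has a clique with `k`
vertices, and another number if it has none. -/
def SolvesCliqueInFPTTime (P : RamProg) : Prop :=
  RunsInFPTTime P fun n k G s =>
    (s.mem 0 = 1 ↔ ∃ S : Finset (Fin n), G.IsClique (S : Set (Fin n)) ∧ S.card = k)

/-- The hypothesis `W[1] ≠ FPT`: the (`W[1]`-complete) problem `k`-Clique cannot be solved in FPT
time. -/
def W1NeFPT : Prop := ¬ ∃ P : RamProg, SolvesCliqueInFPTTime P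

/-- `S` is a dominating set of `G`: every vertex outside `S` has a neighbour in `S`. -/
def IsDominatingSet {V : Type*} (G : SimpleGraph V) (S : Finset V) : Prop :=
  ∀ v, v ∉ S → ∃ u ∈ S, G.Adj u v

/-- The set of vertices that a final state encodes by its characteristic vector in the cells
`0, …, n - 1`. -/
def outputSet (n : ℕ) (s : RamState) : Finset (Fin n) :=
  Finset.univ.filter fun v => s.mem v = 1

/-- `P` is an FPT time algorithm that approximates `k`-DomSet within the factor `ρ n k`: it runs in
FPT time, and on every input `(G, k)` such that the minimum dominating set of `G` has size at
most `k` it outputs a dominating set of size at most `ρ n k * k`. -/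
def ApproximatesDomSetInFPTTime (ρ : ℕ → ℕ → ℝ) (P : RamProg) : Prop :=
  RunsInFPTTime P fun n k G s =>
    (∃ S : Finset (Fin n), IsDominatingSet G S ∧ S.card ≤ k) →
      IsDominatingSet G (outputSet n s) ∧ ((outputSet n s).card : ℝ) ≤ ρ n k * k

/-! ### Running programs -/

namespace RamState

/-! An approximation algorithm for `k`-DomSet would decide `k`-Clique through a gap reduction. Put
`K = k * k`, `L = bits n` (about `log n`) and `g = gap n k`, so that `2 ^ g` is roughly the
`(4K+1)`-th root of `L`. For large `g` the new graph has a dominating set of size `K` if `G` has a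
`k`-clique (`Gap.exists_isDominatingSet`), and none of size at most `2 ^ g` otherwise
(`Gap.exists_clique`).

A clique is viewed as `K` vertex pairs, one per slot `(i, i')`, whose components agree wherever they
stand for the same clique vertex. A constraint compares one bit of one component of a slot with the
same bit of the first component of the canonical slot `(i, 0)`. It names a value: the slot meets it
by having that value, the canonical slot by not having it. In a consistent family one of the two
always does. The new graph has "set" vertices `(j, σ)`, a pair `σ` placed in a slot `j`, which are
pairwise adjacent, and pairwise nonadjacent "element" vertices. An element holds two moduli, a table
that assigns a constraint to every `K`-tuple of hash values, and padding that yields copies. The set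
`(j, σ)` contains the element if, for some tuple `a` whose `j`-th entry is the hash of `σ`, it meets
the constraint listed at `a`.

From a clique, take `a` to be the hash values of its own pairs: the listed constraint is met by one
of them. Conversely, let `S` be a dominating set of size at most `2 ^ g`. By `exists_injOn_mod` some
moduli make the hash injective on the pairs in `S`. If each tuple `a` left some constraint unmet by
the sets of `S` that hash to `a`, a table of these constraints would give an element contained in no
set of `S`; it has more than `2 ^ g` copies, so one lies outside `S` and is undominated. Hence for
some `a` all constraints are met with at most one pair per slot, and `Gap.exists_clique_of_meets`
reads off a clique. Hashing twice brings the hash length down to `4g` bits, and only therefore does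
the table fit into `L` bits.

The rest carries this out on the machine. `Computable.regComputable` provides thresholds depending
on `k`, and the `PolyTime` calculus compiles the reduction. The given algorithm runs relocated on
the new graph, and its answer is verified. Graphs that are too small for the reduction are searched
exhaustively. -/

@[simp] theorem reg_setReg (s : RamState) (i x j : ℕ) :
    (s.setReg i x).reg j = if j = i then x else s.reg j := by
  simp [setReg, Function.update_apply]

@[simp] theorem mem_setReg (s : RamState) (i x : ℕ) : (s.setReg i x).mem = s.mem := rfl

@[simp] theorem reg_setMem (s : RamState) (a x : ℕ) : (s.setMem a x).reg = s.reg := rfl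

@[simp] theorem mem_setMem (s : RamState) (a x b : ℕ) :
    (s.setMem a x).mem b = if b = a then x else s.mem b := by
  simp [setMem, Function.update_apply]

end RamState

/-- Started in `s`, the program `p` halts within `b` steps in a state that satisfies `Q`. -/
def RunsTo (p : RamProg) (s : RamState) (b : ℕ) (Q : RamState → Prop) : Prop :=
  ∃ t s', RamRuns p s t s' ∧ t ≤ b ∧ Q s'

namespace RunsTo

variable {p q : RamProg} {s : RamState} {b b' i j l : ℕ} {Q R : RamState → Prop}

theorem mono (h : RunsTo p s b Q) (hb : b ≤ b') (hQ : ∀ s', Q s' → R s') : RunsTo p s b' R := by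
  obtain ⟨t, s', h, ht, hs⟩ := h
  exact ⟨t, s', h, ht.trans hb, hQ _ hs⟩

theorem of_le (h : RunsTo p s b Q) (hb : b ≤ b') : RunsTo p s b' Q :=
  h.mono hb fun _ h => h

theorem seq (h : RunsTo p s b Q) (h' : ∀ s', Q s' → RunsTo q s' b' R) :
    RunsTo (.seq p q) s (b + b') R := by
  obtain ⟨t, s', h, ht, hs⟩ := h
  obtain ⟨t', s'', h', ht', hs'⟩ := h' s' hs
  exact ⟨_, _, .seq h h', by omega, hs'⟩

theorem skip (h : Q s) : RunsTo .skip s 1 Q := ⟨_, _, .skip s, le_rfl, h⟩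

theorem const {c : ℕ} (h : Q (s.setReg i c)) : RunsTo (.const i c) s 1 Q :=
  ⟨_, _, .const s i c, le_rfl, h⟩

theorem add (h : Q (s.setReg i (s.reg j + s.reg l))) : RunsTo (.add i j l) s 1 Q :=
  ⟨_, _, .add s i j l, le_rfl, h⟩

theorem sub (h : Q (s.setReg i (s.reg j - s.reg l))) : RunsTo (.sub i j l) s 1 Q :=
  ⟨_, _, .sub s i j l, le_rfl, h⟩

theorem half (h : Q (s.setReg i (s.reg j / 2))) : RunsTo (.half i j) s 1 Q :=
  ⟨_, _, .half s i j, le_rfl, h⟩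

theorem load (h : Q (s.setReg i (s.mem (s.reg j)))) : RunsTo (.load i j) s 1 Q :=
  ⟨_, _, .load s i j, le_rfl, h⟩

theorem store (h : Q (s.setMem (s.reg i) (s.reg j))) : RunsTo (.store i j) s 1 Q :=
  ⟨_, _, .store s i j, le_rfl, h⟩

theorem cond (h : s.reg i ≠ 0 → RunsTo p s b Q) (h' : s.reg i = 0 → RunsTo q s b Q) :
    RunsTo (.cond i p q) s (b + 1) Q := by
  by_cases hi : s.reg i = 0
  · obtain ⟨t, s', h, ht, hs⟩ := h' hi
    exact ⟨_, _, .cond_false hi h, by omega, hs⟩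
  · obtain ⟨t, s', h, ht, hs⟩ := h hi
    exact ⟨_, _, .cond_true hi h, by omega, hs⟩

/-- A loop with an invariant `I m`, where `m` is the number of remaining rounds. -/
theorem loop (I : ℕ → RamState → Prop) (T : ℕ → ℕ) (hz : ∀ s, I 0 s → s.reg i = 0)
    (hs : ∀ m s, I (m + 1) s → s.reg i ≠ 0)
    (step : ∀ m s, I (m + 1) s → RunsTo p s (T m) (I m)) (m : ℕ) (s : RamState) (h : I m s) :
    RunsTo (.loop i p) s (∑ x ∈ Finset.range m, (T x + 1) + 1) (I 0) := by
  induction m generalizing s with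
  | zero => exact ⟨1, s, .loop_done (hz s h), by simp, h⟩
  | succ m ih =>
    obtain ⟨t, s', h', ht, hI⟩ := step m s h
    obtain ⟨t', s'', h'', ht', hI'⟩ := ih s' hI
    refine ⟨_, _, .loop_step (hs m s h) h' h'', ?_, hI'⟩
    rw [Finset.sum_range_succ]
    omega

theorem loop_const (I : ℕ → RamState → Prop) (hz : ∀ s, I 0 s → s.reg i = 0)
    (hs : ∀ m s, I (m + 1) s → s.reg i ≠ 0)
    (step : ∀ m s, I (m + 1) s → RunsTo p s b (I m)) (m : ℕ) (s : RamState) (h : I m s) :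
    RunsTo (.loop i p) s (m * (b + 1) + 1) (I 0) :=
  (loop I (fun _ => b) hz hs step m s h).mono (by simp) fun _ h => h

end RunsTo

namespace RamProg

/-- `reg i := reg j` -/
def mov (i j : ℕ) : RamProg := .seq (.add i j j) (.half i i)

end RamProg

theorem RunsTo.mov {s : RamState} {i j : ℕ} {Q : RamState → Prop}
    (h : Q (s.setReg i (s.reg j))) : RunsTo (.mov i j) s 2 Q := by
  refine RunsTo.seq (b := 1) (b' := 1)
    (Q := fun s' => s' = s.setReg i (s.reg j + s.reg j)) (.add rfl) ?_
  rintro _ rfl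
  refine .half ?_
  convert h using 1
  ext x
  · simp only [RamState.reg_setReg, if_true]
    split_ifs
    · omega
    · rfl
  · rfl

/-! ### Registers that a program does not use, and relocation -/

namespace RamProg

/-- A bound on the registers that occur in a program. -/
def regBound : RamProg → ℕ
  | skip => 0
  | const i _ => i + 1
  | add i j l => i + j + l + 1
  | sub i j l => i + j + l + 1
  | half i j => i + j + 1
  | load i j => i + j + 1
  | store i j => i + j + 1
  | seq p q => p.regBound + q.regBound
  | cond i p q => i + 1 + p.regBound + q.regBound
  | loop i p => i + 1 + p.regBound

/-- The program that works with the registers `d + 1, d + 2, …` instead of `0, 1, …`, and with the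
memory cells `m, m + 1, …`, where `m` is the content of register `0`, instead of `0, 1, …`. -/
def relocate (d : ℕ) : RamProg → RamProg
  | skip => skip
  | const i c => const (d + 1 + i) c
  | add i j l => add (d + 1 + i) (d + 1 + j) (d + 1 + l)
  | sub i j l => sub (d + 1 + i) (d + 1 + j) (d + 1 + l)
  | half i j => half (d + 1 + i) (d + 1 + j)
  | load i j => seq (add d 0 (d + 1 + j)) (load (d + 1 + i) d)
  | store i j => seq (add d 0 (d + 1 + i)) (store d (d + 1 + j))
  | seq p q => seq (p.relocate d) (q.relocate d)
  | cond i p q => cond (d + 1 + i) (p.relocate d) (q.relocate d)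
  | loop i p => loop (d + 1 + i) (p.relocate d)

end RamProg

/-- Registers that earlier programs do not mention are still `0`, as a relocated program expects of
its own registers. -/
theorem RamRuns.reg_eq_of_regBound_le {p : RamProg} {s s' : RamState} {t : ℕ}
    (h : RamRuns p s t s') {i : ℕ} (hi : p.regBound ≤ i) : s'.reg i = s.reg i := by
  induction h with
  | seq _ _ ih₁ ih₂ | loop_step _ _ _ ih₁ ih₂ =>
    simp only [RamProg.regBound] at hi ih₁ ih₂
    rw [ih₂ (by omega), ih₁ (by omega)]
  | cond_true _ _ ih | cond_false _ _ ih =>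
    simp only [RamProg.regBound] at hi
    exact ih (by omega)
  | skip | loop_done _ | store => rfl
  | _ =>
    simp only [RamProg.regBound] at hi
    rw [RamState.reg_setReg, if_neg (by omega)]

/-- The state `s'` contains the state `s` in its registers `d + 1, d + 2, …` and in its memory cells
`N, N + 1, …`. -/
structure Contains (d N : ℕ) (s s' : RamState) : Prop where
  base : s'.reg 0 = N
  reg : ∀ i, s'.reg (d + 1 + i) = s.reg i
  mem : ∀ a, s'.mem (N + a) = s.mem a

/-- A state in which the relocated program has changed nothing outside of its own part. -/
structure SameOutside (d N : ℕ) (s s' : RamState) : Prop where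
  reg : ∀ i < d, s'.reg i = s.reg i
  mem : ∀ a < N, s'.mem a = s.mem a

/-- The simulation is step by step. Only `load` and `store` need a second instruction, which
computes the shifted address in the scratch register `d`; hence the factor `2`. Since `0 < d`, this
does not overwrite the base address in register `0`. -/
theorem RamRuns.relocate {d N : ℕ} (hd : 0 < d) {p : RamProg} {s s' : RamState} {t : ℕ}
    (h : RamRuns p s t s') : ∀ u, Contains d N s u →
      RunsTo (p.relocate d) u (2 * t) fun u' => Contains d N s' u' ∧ SameOutside d N u u' := by
  induction h with
  | skip s => exact fun u hu => RunsTo.of_le (.skip ⟨hu, fun _ _ => rfl, fun _ _ => rfl⟩) (by omega)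
  | const s i c =>
    exact fun u hu => RunsTo.of_le (.const ⟨⟨by simp [hu.base]; omega, by simp [hu.reg], by simp [hu.mem]⟩,
      fun _ _ => by simp; omega, fun _ _ => rfl⟩) (by omega)
  | add s i c =>
    exact fun u hu => RunsTo.of_le (.add ⟨⟨by simp [hu.base]; omega, by simp [hu.reg], by simp [hu.mem]⟩,
      fun _ _ => by simp; omega, fun _ _ => rfl⟩) (by omega)
  | sub s i c =>
    exact fun u hu => RunsTo.of_le (.sub ⟨⟨by simp [hu.base]; omega, by simp [hu.reg], by simp [hu.mem]⟩,
      fun _ _ => by simp; omega, fun _ _ => rfl⟩) (by omega)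
  | half s i c =>
    exact fun u hu => RunsTo.of_le (.half ⟨⟨by simp [hu.base]; omega, by simp [hu.reg], by simp [hu.mem]⟩,
      fun _ _ => by simp; omega, fun _ _ => rfl⟩) (by omega)
  | load s i j =>
    intro u hu
    refine RunsTo.seq (b := 1) (b' := 1) (Q := fun v => v = u.setReg d (N + s.reg j))
      (.add (by simp [hu.base, hu.reg])) ?_
    rintro _ rfl
    refine .load ⟨⟨?_, ?_, ?_⟩, ?_, ?_⟩
    · simp [hu.base, hd.ne]; omega
    · intro a
      have : ¬ d + 1 + a = d := by omega
      simp [hu.mem, hu.reg, this]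
    · simp [hu.mem]
    · intro a ha
      have h1 : ¬ a = d + 1 + i := by omega
      have h2 : ¬ a = d := by omega
      simp [h1, h2]
    · exact fun _ _ => rfl
  | store s i j =>
    intro u hu
    refine RunsTo.seq (b := 1) (b' := 1) (Q := fun v => v = u.setReg d (N + s.reg i))
      (.add (by simp [hu.base, hu.reg])) ?_
    rintro _ rfl
    refine .store ⟨⟨?_, ?_, ?_⟩, ?_, ?_⟩
    · simp [hu.base, hd.ne]
    · intro a
      have : ¬ d + 1 + a = d := by omega
      simp [hu.reg, this]
    · intro a
      have : ¬ d + 1 + j = d := by omega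
      simp [hu.mem, hu.reg, this]
    · intro a ha
      have h2 : ¬ a = d := by omega
      simp [h2]
    · intro a ha
      have h2 : ¬ a = N + s.reg i := by omega
      simp [h2]
  | seq _ _ ih₁ ih₂ =>
    intro u hu
    refine RunsTo.of_le (RunsTo.seq (ih₁ u hu) (R := fun u' => Contains d N _ u' ∧ SameOutside d N u u')
      fun v hv => (ih₂ v hv.1).mono le_rfl ?_) (by omega)
    exact fun w hw => ⟨hw.1, fun i hi => (hw.2.reg i hi).trans (hv.2.reg i hi),
      fun i hi => (hw.2.mem i hi).trans (hv.2.mem i hi)⟩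
  | cond_true h _ ih =>
    exact fun u hu => RunsTo.of_le (RunsTo.cond (fun _ => ih u hu)
      fun h' => absurd ((hu.reg _).symm.trans h') h) (by omega)
  | cond_false h _ ih =>
    exact fun u hu => RunsTo.of_le (RunsTo.cond (fun h' => absurd ((hu.reg _).trans h) h')
      fun _ => ih u hu) (by omega)
  | loop_done h =>
    exact fun u hu => ⟨_, u, .loop_done ((hu.reg _).trans h), by omega, hu,
      fun _ _ => rfl, fun _ _ => rfl⟩
  | loop_step h _ _ ih₁ ih₂ =>
    intro u hu
    obtain ⟨t₁, v, h₁, ht₁, hv⟩ := ih₁ u hu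
    obtain ⟨t₂, w, h₂, ht₂, hw⟩ := ih₂ v hv.1
    exact ⟨_, w, .loop_step (fun h' => h ((hu.reg _).symm.trans h')) h₁ h₂, by omega, hw.1,
      fun i hi => (hw.2.reg i hi).trans (hv.2.reg i hi),
      fun i hi => (hw.2.mem i hi).trans (hv.2.mem i hi)⟩

/-! ### Computable functions on random access machines -/

/-- `s'` differs from `s` at most in the registers `d, d + 1, …`. -/
structure SameBelow (d : ℕ) (s s' : RamState) : Prop where
  reg : ∀ i < d, s'.reg i = s.reg i
  mem : s'.mem = s.mem

theorem SameBelow.refl (d : ℕ) (s : RamState) : SameBelow d s s := ⟨fun _ _ => rfl, rfl⟩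

theorem SameBelow.trans {d : ℕ} {s s' s'' : RamState} (h : SameBelow d s s')
    (h' : SameBelow d s' s'') : SameBelow d s s'' :=
  ⟨fun i hi => (h'.reg i hi).trans (h.reg i hi), h'.mem.trans h.mem⟩

theorem SameBelow.mono {d d' : ℕ} {s s' : RamState} (h : SameBelow d s s') (hd : d' ≤ d) :
    SameBelow d' s s' := ⟨fun i hi => h.reg i (hi.trans_le hd), h.mem⟩

theorem SameBelow.setReg {d i x : ℕ} {s s' : RamState} (h : SameBelow d s s') (hi : d ≤ i) :
    SameBelow d s (s'.setReg i x) :=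
  ⟨fun j hj => by rw [RamState.reg_setReg, if_neg (by omega), h.reg j hj], h.mem⟩

/-- The pairing function on the registers `d` and `d + 1`, with result in register `d`. -/
def pairProg (d : ℕ) : RamProg :=
  .seq (.sub (d + 2) (d + 1) d) <|
  .seq (.cond (d + 2) .skip (.seq (.mov (d + 3) d)
    (.seq (.add d d (d + 1)) (.mov (d + 1) (d + 3))))) <|
  .seq (.mov (d + 3) (d + 1)) <|
  .seq (.const (d + 4) 1) <|
  .loop (d + 3) (.seq (.add d d (d + 1)) (.sub (d + 3) (d + 3) (d + 4)))

theorem runsTo_pairProg (d : ℕ) (s : RamState) :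
    RunsTo (pairProg d) s (4 * (s.reg d + s.reg (d + 1)) + 12) fun s' =>
      s'.reg d = Nat.pair (s.reg d) (s.reg (d + 1)) ∧ SameBelow d s s' := by
  set a := s.reg d with ha
  set b := s.reg (d + 1) with hb
  refine RunsTo.of_le (b := 1 + (6 + (2 + (1 + ((a + b) * 3 + 1))))) ?_ (by omega)
  refine RunsTo.seq (.sub (Q := fun s' => s'.reg d = a ∧ s'.reg (d + 1) = b ∧
    s'.reg (d + 2) = b - a ∧ SameBelow d s s') ?_) ?_
  · refine ⟨by simp [ha], by simp [hb], by simp [ha, hb], (SameBelow.refl d s).setReg (by omega)⟩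
  rintro s₁ ⟨h1, h2, h3, h4⟩
  refine RunsTo.seq (Q := fun s' => ∃ x, s'.reg d + x * x = Nat.pair a b ∧ x ≤ a + b ∧
    s'.reg (d + 1) = x ∧ SameBelow d s s') ?_ ?_
  · refine RunsTo.cond (b := 5) (fun h => ?_) (fun h => ?_)
    · refine (RunsTo.skip (Q := fun s' => s' = s₁) rfl).mono (by omega) ?_
      rintro _ rfl
      refine ⟨b, ?_, by omega, h2, h4⟩
      rw [h1, Nat.pair, if_pos (by omega), add_comm]
    · refine RunsTo.seq (b := 2) (b' := 3) (.mov (Q := fun s' => s' = s₁.setReg (d + 3) a)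
        (by rw [h1])) ?_
      rintro _ rfl
      refine RunsTo.seq (b := 1) (b' := 2) (.add (Q := fun s' => s'.reg d = a + b ∧
        s'.reg (d + 3) = a ∧ SameBelow d s s') ⟨by simp [h1, h2], by simp,
          (h4.setReg (by omega)).setReg (by omega)⟩) ?_
      rintro s₂ ⟨h5, h6, h7⟩
      refine .mov ⟨a, ?_, by omega, by simp [h6], h7.setReg (by omega)⟩
      rw [Nat.pair, if_neg (by omega)]
      simp [h5]
      ring
  rintro s₂ ⟨x, h5, h6, h7, h8⟩
  refine RunsTo.seq (.mov (Q := fun s' => s' = s₂.setReg (d + 3) x) (by rw [h7])) ?_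
  rintro _ rfl
  refine RunsTo.seq (.const (Q := fun s' => s' = (s₂.setReg (d + 3) x).setReg (d + 4) 1) rfl) ?_
  rintro _ rfl
  -- The square `x * x` is added as `x` summands `x`; with `m` rounds left, `m * x` is still
  -- missing.
  refine RunsTo.mono (RunsTo.loop_const (b := 2) (fun m s' => s'.reg d + m * x = Nat.pair a b ∧
    s'.reg (d + 1) = x ∧ s'.reg (d + 3) = m ∧ s'.reg (d + 4) = 1 ∧ SameBelow d s s')
    (fun s' h => h.2.2.1) (fun m s' h => by omega) ?_ x _ ?_) (by omega) ?_
  · rintro m s' ⟨h1, h2, h3, h4, h5⟩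
    refine RunsTo.seq (b := 1) (b' := 1) (.add (Q := fun s'' => s'' = s'.setReg d (s'.reg d + x))
      (by rw [h2])) ?_
    rintro _ rfl
    refine .sub ⟨?_, by simp [h2], by simp [h3, h4], by simp [h4],
      (h5.setReg le_rfl).setReg (by omega)⟩
    simp [← h1]
    ring
  · exact ⟨by simp [h5], by simp [h7], by simp, by simp,
      (h8.setReg (by omega)).setReg (by omega)⟩
  · rintro s' ⟨h1, -, -, -, h5⟩
    exact ⟨by simpa using h1, h5⟩

/-- The successor of a pair in the enumeration `Nat.unpair`. -/
def nextPair (x : ℕ × ℕ) : ℕ × ℕ :=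
  if x.1 < x.2 then (if x.1 + 1 < x.2 then (x.1 + 1, x.2) else (x.2, 0))
  else if x.2 < x.1 then (x.1, x.2 + 1) else (0, x.1 + 1)

/-- Counting up from `(0, 0)` with `nextPair` inverts the pairing without a square root. -/
theorem unpair_succ (z : ℕ) : Nat.unpair (z + 1) = nextPair (Nat.unpair z) := by
  have key : ∀ a b, Nat.pair (nextPair (a, b)).1 (nextPair (a, b)).2 = Nat.pair a b + 1 := by
    intro a b
    unfold nextPair Nat.pair
    simp only
    split_ifs <;> simp_all
    all_goals first
      | omega
      | (have : b = a := by omega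
         subst this; ring)
  have h := key (Nat.unpair z).1 (Nat.unpair z).2
  rw [Nat.pair_unpair] at h
  rw [← h, Nat.unpair_pair]

/-- The inverse of the pairing function: it unpairs register `d` into the registers `d` and
`d + 1`. -/
def unpairProg (d : ℕ) : RamProg :=
  .seq (.mov (d + 2) d) <|
  .seq (.const d 0) <|
  .seq (.const (d + 1) 0) <|
  .seq (.const (d + 3) 1) <|
  .loop (d + 2) <|
    .seq (.sub (d + 4) (d + 1) d) <|
    .seq (.cond (d + 4)
      (.seq (.add d d (d + 3)) (.seq (.sub (d + 4) (d + 1) d)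
        (.cond (d + 4) .skip (.const (d + 1) 0))))
      (.seq (.sub (d + 4) d (d + 1)) (.cond (d + 4) (.add (d + 1) (d + 1) (d + 3))
        (.seq (.add (d + 1) d (d + 3)) (.const d 0))))) <|
    .sub (d + 2) (d + 2) (d + 3)

theorem runsTo_unpairProg (d : ℕ) (s : RamState) :
    RunsTo (unpairProg d) s (8 * s.reg d + 6) fun s' =>
      s'.reg d = (Nat.unpair (s.reg d)).1 ∧ s'.reg (d + 1) = (Nat.unpair (s.reg d)).2 ∧
        SameBelow d s s' := by
  set n := s.reg d with hn
  refine RunsTo.of_le (b := 2 + (1 + (1 + (1 + (n * 8 + 1))))) ?_ (by omega)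
  refine RunsTo.seq (.mov (Q := fun s' => s' = s.setReg (d + 2) n) rfl) ?_
  rintro _ rfl
  refine RunsTo.seq (.const (Q := fun s' => s' = (s.setReg (d + 2) n).setReg d 0) rfl) ?_
  rintro _ rfl
  refine RunsTo.seq (.const (Q := fun s' =>
    s' = ((s.setReg (d + 2) n).setReg d 0).setReg (d + 1) 0) rfl) ?_
  rintro _ rfl
  refine RunsTo.seq (.const (Q := fun s' =>
    s' = (((s.setReg (d + 2) n).setReg d 0).setReg (d + 1) 0).setReg (d + 3) 1) rfl) ?_
  rintro _ rfl
  refine RunsTo.mono (RunsTo.loop_const (b := 7) (fun m s' => ∃ z, z + m = n ∧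
    (s'.reg d, s'.reg (d + 1)) = Nat.unpair z ∧ s'.reg (d + 2) = m ∧ s'.reg (d + 3) = 1 ∧
      SameBelow d s s')
    (fun s' ⟨_, h⟩ => h.2.2.1) (fun m s' ⟨_, h⟩ => by omega) ?_ n _ ?_) le_rfl ?_
  · rintro m s₀ ⟨z, h1, h2, h3, h4, h5⟩
    refine RunsTo.seq (b := 1) (b' := 6) (.sub (Q := fun s' => (s'.reg d, s'.reg (d + 1)) =
      Nat.unpair z ∧ s'.reg (d + 4) = s'.reg (d + 1) - s'.reg d ∧ s'.reg (d + 2) = m + 1 ∧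
        s'.reg (d + 3) = 1 ∧ SameBelow d s s')
      ⟨by simp [h2], by simp, by simp [h3], by simp [h4], h5.setReg (by omega)⟩) ?_
    clear h2 h3 h4 h5 s₀
    rintro s₁ ⟨h2, h3, h4, h5, h6⟩
    refine RunsTo.seq (b := 5) (b' := 1) (Q := fun s' => (s'.reg d, s'.reg (d + 1)) =
      Nat.unpair (z + 1) ∧ s'.reg (d + 2) = m + 1 ∧ s'.reg (d + 3) = 1 ∧ SameBelow d s s') ?_ ?_
    · rw [unpair_succ, ← h2]
      unfold nextPair
      simp only
      refine RunsTo.cond (b := 4) (fun h => ?_) (fun h => ?_)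
      · rw [if_pos (by omega)]
        refine RunsTo.seq (b := 1) (b' := 3) (.add (Q := fun s' => s' =
          s₁.setReg d (s₁.reg d + 1)) (by rw [h5])) ?_
        rintro _ rfl
        refine RunsTo.seq (b := 1) (b' := 2) (.sub (Q := fun s' => s' =
          (s₁.setReg d (s₁.reg d + 1)).setReg (d + 4) (s₁.reg (d + 1) - (s₁.reg d + 1)))
          (by simp)) ?_
        rintro _ rfl
        refine RunsTo.cond (b := 1) (fun h' => ?_) (fun h' => ?_)
        · simp at h'
          rw [if_pos (by omega)]
          exact .skip ⟨by simp, by simp [h4], by simp [h5],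
            (h6.setReg (by omega)).setReg (by omega)⟩
        · simp at h'
          rw [if_neg (by omega)]
          exact .const ⟨by simp; omega, by simp [h4], by simp [h5],
            ((h6.setReg (by omega)).setReg (by omega)).setReg (by omega)⟩
      · rw [if_neg (by omega)]
        refine RunsTo.seq (b := 1) (b' := 3) (.sub (Q := fun s' => s' =
          s₁.setReg (d + 4) (s₁.reg d - s₁.reg (d + 1))) rfl) ?_
        rintro _ rfl
        refine RunsTo.cond (b := 2) (fun h' => ?_) (fun h' => ?_)
        · simp at h'
          rw [if_pos (by omega)]
          exact RunsTo.of_le (.add ⟨by simp [h5], by simp [h4], by simp [h5],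
            (h6.setReg (by omega)).setReg (by omega)⟩) (b := 1) (by omega)
        · simp at h'
          rw [if_neg (by omega)]
          refine RunsTo.seq (b := 1) (b' := 1) (.add (Q := fun s' => s'.reg (d + 1) =
            s₁.reg d + 1 ∧ s'.reg (d + 2) = m + 1 ∧ s'.reg (d + 3) = 1 ∧ SameBelow d s s')
            ⟨by simp [h5], by simp [h4], by simp [h5],
              (h6.setReg (by omega)).setReg (by omega)⟩) ?_
          rintro s₂ ⟨h7, h8, h9, h10⟩
          exact .const ⟨by simp [h7], by simp [h8], by simp [h9], h10.setReg (by omega)⟩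
    · rintro s₂ ⟨h7, h8, h9, h10⟩
      exact .sub ⟨z + 1, by omega, by simp [h7], by simp [h8, h9], by simp [h9],
        h10.setReg (by omega)⟩
  · exact ⟨0, by simp, by simp, by simp, by simp, ((((SameBelow.refl d s).setReg (by omega)).setReg
      (by omega)).setReg (by omega)).setReg (by omega)⟩
  · rintro s' ⟨z, h1, h2, -, -, h5⟩
    obtain rfl : z = n := by simpa using h1
    rw [← h2]
    exact ⟨rfl, rfl, h5⟩

/-- Some program turns `x` in register `d` into `f x`, for every `d`, without using the registers
below `d` and the memory, in a number of steps bounded by a computable function of `x`. -/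
def RegComputable (f : ℕ → ℕ) : Prop :=
  ∃ (p : ℕ → RamProg) (b : ℕ → ℕ), Computable b ∧ ∀ d s,
    RunsTo (p d) s (b (s.reg d)) fun s' => s'.reg d = f (s.reg d) ∧ SameBelow d s s'

theorem Computable.nat_add {α : Type*} [Primcodable α] {f g : α → ℕ} (hf : Computable f)
    (hg : Computable g) : Computable fun x => f x + g x :=
  (Primrec.nat_add.to_comp : Computable₂ fun a b : ℕ => a + b).comp hf hg

theorem Computable.nat_mul {α : Type*} [Primcodable α] {f g : α → ℕ} (hf : Computable f)
    (hg : Computable g) : Computable fun x => f x * g x :=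
  (Primrec.nat_mul.to_comp : Computable₂ fun a b : ℕ => a * b).comp hf hg

theorem Computable.natPair {α : Type*} [Primcodable α] {f g : α → ℕ} (hf : Computable f)
    (hg : Computable g) : Computable fun x => Nat.pair (f x) (g x) :=
  (Primrec₂.natPair.to_comp : Computable₂ fun a b : ℕ => Nat.pair a b).comp hf hg

theorem Computable.unpair_fst : Computable fun x : ℕ => x.unpair.1 :=
  Computable.fst.comp Computable.unpair

theorem Computable.unpair_snd : Computable fun x : ℕ => x.unpair.2 :=
  Computable.snd.comp Computable.unpair

theorem Computable.nat_sum {α : Type*} [Primcodable α] {n : α → ℕ} {f : α → ℕ → ℕ}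
    (hn : Computable n) (hf : Computable₂ f) :
    Computable fun x => ∑ i ∈ Finset.range (n x), f x i := by
  refine (Computable.nat_rec hn (Computable.const 0) (h := fun x p => p.2 + f x p.1) ?_).of_eq ?_
  · exact (Computable.snd.comp Computable.snd).nat_add
      (hf.comp Computable.fst (Computable.fst.comp Computable.snd))
  · intro x
    induction n x with
    | zero => rfl
    | succ m ih => rw [Finset.sum_range_succ, ← ih]

theorem RegComputable.pair {f g : ℕ → ℕ} (hf' : Computable f) (hg' : Computable g)
    (hf : RegComputable f) (hg : RegComputable g) :
    RegComputable fun x => Nat.pair (f x) (g x) := by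
  obtain ⟨p, b, hb, hp⟩ := hf
  obtain ⟨q, c, hc, hq⟩ := hg
  refine ⟨fun d => .seq (.mov (d + 1) d) <| .seq (q (d + 1)) <| .seq (.mov (d + 2) d) <|
      .seq (p (d + 2)) <| .seq (.mov d (d + 2)) (pairProg d),
    fun x => 2 + (c x + (2 + (b x + (2 + (4 * (f x + g x) + 12))))), ?_, fun d s => ?_⟩
  · exact (Computable.const 2).nat_add (hc.nat_add ((Computable.const 2).nat_add (hb.nat_add
      ((Computable.const 2).nat_add
      (((Computable.const 4).nat_mul (hf'.nat_add hg')).nat_add (Computable.const 12))))))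
  refine RunsTo.seq (.mov (Q := fun s' => s' = s.setReg (d + 1) (s.reg d)) rfl) ?_
  rintro _ rfl
  refine RunsTo.seq (Q := fun s' => s'.reg (d + 1) = g (s.reg d) ∧ s'.reg d = s.reg d ∧
    SameBelow d s s') ((hq _ _).mono (by simp) ?_) ?_
  · rintro s₁ ⟨h1, h2⟩
    refine ⟨by simpa using h1, ?_, ?_⟩
    · rw [h2.reg d (by omega)]; simp
    · exact ((SameBelow.refl d s).setReg (by omega)).trans (h2.mono (by omega))
  rintro s₁ ⟨h1, h2, h3⟩
  refine RunsTo.seq (.mov (Q := fun s' => s' = s₁.setReg (d + 2) (s.reg d)) (by rw [h2])) ?_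
  rintro _ rfl
  refine RunsTo.seq (Q := fun s' => s'.reg (d + 2) = f (s.reg d) ∧
    s'.reg (d + 1) = g (s.reg d) ∧ SameBelow d s s') ((hp _ _).mono (by simp) ?_) ?_
  · rintro s₂ ⟨h4, h5⟩
    refine ⟨by simpa using h4, ?_, (h3.setReg (by omega)).trans (h5.mono (by omega))⟩
    rw [h5.reg _ (by omega)]; simp [h1]
  rintro s₂ ⟨h4, h5, h6⟩
  refine RunsTo.seq (.mov (Q := fun s' => s' = s₂.setReg d (f (s.reg d))) (by rw [h4])) ?_
  rintro _ rfl
  refine (runsTo_pairProg d _).mono (by simp [h5]) ?_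
  rintro s₃ ⟨h7, h8⟩
  exact ⟨by simpa [h5] using h7, (h6.setReg le_rfl).trans h8⟩

theorem RegComputable.comp {f g : ℕ → ℕ} (hg' : Computable g)
    (hf : RegComputable f) (hg : RegComputable g) : RegComputable fun x => f (g x) := by
  obtain ⟨p, b, hb, hp⟩ := hf
  obtain ⟨q, c, hc, hq⟩ := hg
  refine ⟨fun d => .seq (q d) (p d), fun x => c x + b (g x), hc.nat_add (hb.comp hg'),
    fun d s => (hq d s).seq fun s₁ h => ?_⟩
  have := hp d s₁
  rw [h.1] at this
  exact this.mono le_rfl fun s₂ h' => ⟨h'.1, h.2.trans h'.2⟩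

/-- The cost of a round depends on the value reached so far, so the total time is computable because
the recursively defined function itself is. This is why `Computable` is assumed next to
`RegComputable`. -/
theorem RegComputable.prec {f g : ℕ → ℕ} (hf' : Computable f) (hg' : Computable g)
    (hf : RegComputable f) (hg : RegComputable g) :
    RegComputable (Nat.unpaired fun z n =>
      n.rec (f z) fun y IH => g (Nat.pair z (Nat.pair y IH))) := by
  obtain ⟨p, b, hb, hp⟩ := hf
  obtain ⟨q, c, hc, hq⟩ := hg
  let r : ℕ → ℕ → ℕ := fun z n => n.rec (f z) fun y IH => g (Nat.pair z (Nat.pair y IH))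
  have hr : Computable₂ r := by
    refine Computable.nat_rec Computable.snd (hf'.comp Computable.fst)
      (h := fun x p => g (Nat.pair x.1 (Nat.pair p.1 p.2))) ?_
    exact hg'.comp ((Computable.fst.comp Computable.fst).natPair
      ((Computable.fst.comp Computable.snd).natPair (Computable.snd.comp Computable.snd)))
  have hr1 : ∀ z n, r z (n + 1) = g (Nat.pair z (Nat.pair n (r z n))) := fun _ _ => rfl
  let B : ℕ → ℕ → ℕ := fun z y => 4 * (y + r z y) + 4 * (z + Nat.pair y (r z y)) +
    c (Nat.pair z (Nat.pair y (r z y))) + 40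
  have hB : Computable₂ B := by
    refine Computable.nat_add (Computable.nat_add (Computable.nat_add (Computable.nat_mul
      (Computable.const 4) (Computable.snd.nat_add hr)) (Computable.nat_mul
      (Computable.const 4) (Computable.fst.nat_add (Computable.snd.natPair hr))))
      (hc.comp (Computable.fst.natPair (Computable.snd.natPair hr)))) (Computable.const 40)
  let S : ℕ → ℕ → ℕ := fun z n => ∑ y ∈ Finset.range n, B z y
  -- In the loop, register `d` holds `z`, `d + 1` the number of rounds left, `d + 2` the index `y`
  -- and `d + 3` the value `r z y`.
  refine ⟨fun d => .seq (unpairProg d) <| .seq (.const (d + 2) 0) <| .seq (.mov (d + 3) d) <|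
    .seq (p (d + 3)) <|
    .seq (.loop (d + 1) <|
      .seq (.mov (d + 4) d) <| .seq (.mov (d + 5) (d + 2)) <| .seq (.mov (d + 6) (d + 3)) <|
      .seq (pairProg (d + 5)) <| .seq (pairProg (d + 4)) <| .seq (q (d + 4)) <|
      .seq (.mov (d + 3) (d + 4)) <| .seq (.const (d + 4) 1) <|
      .seq (.add (d + 2) (d + 2) (d + 4)) (.sub (d + 1) (d + 1) (d + 4))) <|
    .mov d (d + 3),
    fun x => 8 * x + 20 + b x.unpair.1 + S x.unpair.1 x.unpair.2, ?_, fun d s => ?_⟩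
  · refine Computable.nat_add (Computable.nat_add (Computable.nat_add (Computable.nat_mul
      (Computable.const 8) Computable.id) (Computable.const 20))
      (hb.comp Computable.unpair_fst)) ?_
    exact Computable.nat_sum Computable.unpair_snd
      (hB.comp (Computable.unpair_fst.comp Computable.fst) Computable.snd)
  set z := (s.reg d).unpair.1 with hz
  set n := (s.reg d).unpair.2 with hn
  have hz' : z ≤ s.reg d := Nat.unpair_left_le _
  have hn' : n ≤ s.reg d := Nat.unpair_right_le _
  refine RunsTo.of_le (b := (8 * s.reg d + 6) + (1 + (2 + (b z + ((S z n + 1) + 2))))) ?_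
    (by simp only [← hz, ← hn]; omega)
  refine RunsTo.seq (runsTo_unpairProg d s) ?_
  rintro s₁ ⟨h1, h2, h3⟩
  refine RunsTo.seq (.const (Q := fun s' => s' = s₁.setReg (d + 2) 0) rfl) ?_
  rintro _ rfl
  refine RunsTo.seq (.mov (Q := fun s' => s' = (s₁.setReg (d + 2) 0).setReg (d + 3) z)
    (by simp [h1, hz])) ?_
  rintro _ rfl
  refine RunsTo.seq (Q := fun s' => s'.reg d = z ∧ s'.reg (d + 1) = n ∧ s'.reg (d + 2) = 0 ∧
    s'.reg (d + 3) = f z ∧ SameBelow d s s') ((hp _ _).mono (by simp) ?_) ?_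
  · rintro s₂ ⟨h4, h5⟩
    refine ⟨?_, ?_, ?_, by simpa using h4,
      ((h3.setReg (by omega)).setReg (by omega)).trans (h5.mono (by omega))⟩
    · rw [h5.reg _ (by omega)]; simp [h1, hz]
    · rw [h5.reg _ (by omega)]; simp [h2, hn]
    · rw [h5.reg _ (by omega)]; simp
  clear h1 h2 h3 s₁
  rintro s₁ ⟨h1, h2, h3, h4, h5⟩
  refine RunsTo.seq (Q := fun s' => s'.reg (d + 3) = r z n ∧ SameBelow d s s') ?_ ?_
  -- The index is reversed because `m` counts the remaining rounds; the `- 1` is offset by the step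
  -- that `loop` charges for each test.
  · refine (RunsTo.loop (fun m s' => ∃ y, y + m = n ∧ s'.reg d = z ∧ s'.reg (d + 1) = m ∧
      s'.reg (d + 2) = y ∧ s'.reg (d + 3) = r z y ∧ SameBelow d s s') (fun m => B z (n - 1 - m) - 1)
      (fun s' ⟨_, h⟩ => h.2.2.1) (fun m s' ⟨_, h⟩ => by omega) ?_ n s₁
      ⟨0, by omega, h1, h2, h3, h4, h5⟩).mono ?_ ?_
    · clear h1 h2 h3 h4 h5 s₁
      rintro m s₁ ⟨y, h0, h1, h2, h3, h4, h5⟩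
      obtain rfl : y = n - 1 - m := by omega
      set y := n - 1 - m with hy
      refine RunsTo.of_le (b := 2 + (2 + (2 + ((4 * (y + r z y) + 12) +
        ((4 * (z + Nat.pair y (r z y)) + 12) + (c (Nat.pair z (Nat.pair y (r z y))) +
        (2 + (1 + (1 + 1))))))))) ?_ (by simp only [B]; omega)
      refine RunsTo.seq (.mov (Q := fun s' => s' = s₁.setReg (d + 4) z) (by rw [h1])) ?_
      rintro _ rfl
      refine RunsTo.seq (.mov (Q := fun s' => s' = (s₁.setReg (d + 4) z).setReg (d + 5) y)
        (by simp [h3])) ?_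
      rintro _ rfl
      refine RunsTo.seq (.mov (Q := fun s' => s' = ((s₁.setReg (d + 4) z).setReg
        (d + 5) y).setReg (d + 6) (r z y)) (by simp [h4])) ?_
      rintro _ rfl
      refine RunsTo.seq (Q := fun s' => s'.reg (d + 5) = Nat.pair y (r z y) ∧ s'.reg (d + 4) = z ∧
        SameBelow (d + 4) s₁ s') ((runsTo_pairProg (d + 5) _).mono (by simp) ?_) ?_
      · rintro s₂ ⟨h6, h7⟩
        refine ⟨by simpa using h6, ?_, (((((SameBelow.refl (d + 4) s₁).setReg (by omega)).setReg
          (by omega)).setReg (by omega)).trans (h7.mono (by omega)))⟩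
        rw [h7.reg _ (by omega)]; simp
      rintro s₂ ⟨h6, h7, h8⟩
      refine RunsTo.seq (Q := fun s' => s'.reg (d + 4) = Nat.pair z (Nat.pair y (r z y)) ∧
        SameBelow (d + 4) s₁ s') ((runsTo_pairProg (d + 4) _).mono (by simp [h6, h7]) ?_) ?_
      · rintro s₃ ⟨h9, h10⟩
        exact ⟨by simpa [h6, h7] using h9, h8.trans h10⟩
      clear h6 h7 h8 s₂
      rintro s₂ ⟨h6, h7⟩
      refine RunsTo.seq (Q := fun s' => s'.reg (d + 4) = r z (y + 1) ∧
        SameBelow (d + 4) s₁ s') ((hq (d + 4) _).mono (by simp [h6]) ?_) ?_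
      · rintro s₃ ⟨h9, h10⟩
        exact ⟨by rw [h9, hr1, h6], h7.trans h10⟩
      clear h6 h7 s₂
      rintro s₂ ⟨h6, h7⟩
      refine RunsTo.seq (.mov (Q := fun s' => s' = s₂.setReg (d + 3) (r z (y + 1)))
        (by rw [h6])) ?_
      rintro _ rfl
      refine RunsTo.seq (.const (Q := fun s' => s' = (s₂.setReg (d + 3) (r z (y + 1))).setReg
        (d + 4) 1) rfl) ?_
      rintro _ rfl
      refine RunsTo.seq (.add (Q := fun s' => s' = ((s₂.setReg (d + 3) (r z (y + 1))).setReg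
        (d + 4) 1).setReg (d + 2) (y + 1)) (by simp [h7.reg (d + 2) (by omega), h3])) ?_
      rintro _ rfl
      refine .sub ⟨y + 1, by omega, ?_, ?_, by simp, by simp, ?_⟩
      · simp [h7.reg d (by omega), h1]
      · simp [h7.reg (d + 1) (by omega), h2]
      · exact ((((h5.trans (h7.mono (by omega))).setReg (by omega)).setReg (by omega)).setReg
          (by omega)).setReg (by omega)
    · simp only [S]
      rw [← Finset.sum_range_reflect (B z) n]
      refine Nat.add_le_add_right (Finset.sum_le_sum fun i _ => ?_) 1
      simp only [B]
      omega
    · rintro s' ⟨y, h6, -, -, -, h7, h8⟩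
      obtain rfl : y = n := by omega
      exact ⟨h7, h8⟩
  · rintro s' ⟨h6, h7⟩
    exact .mov ⟨by simp [h6, r, Nat.unpaired, hz, hn], h7.setReg le_rfl⟩

/-- Primitive recursion suffices as a first stage: a general computable function needs only one
unbounded search on top of it. -/
theorem Nat.Primrec.regComputable {f : ℕ → ℕ} (hf : Nat.Primrec f) : RegComputable f := by
  have key : ∀ {f : ℕ → ℕ}, Nat.Primrec f → Computable f := fun h =>
    (Primrec.nat_iff.2 h).to_comp
  induction hf with
  | zero => exact ⟨fun d => .const d 0, fun _ => 1, Computable.const 1, fun d s =>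
      .const ⟨by simp, (SameBelow.refl d s).setReg le_rfl⟩⟩
  | succ =>
    refine ⟨fun d => .seq (.const (d + 1) 1) (.add d d (d + 1)), fun _ => 1 + 1,
      Computable.const _, fun d s => ?_⟩
    refine RunsTo.seq (.const (Q := fun s' => s' = s.setReg (d + 1) 1) rfl) ?_
    rintro _ rfl
    exact .add ⟨by simp, ((SameBelow.refl d s).setReg (by omega)).setReg (by omega)⟩
  | left =>
    refine ⟨unpairProg, fun x => 8 * x + 6, Computable.nat_add (Computable.nat_mul
      (Computable.const 8) Computable.id) (Computable.const 6), fun d s => ?_⟩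
    exact (runsTo_unpairProg d s).mono le_rfl fun s' h => ⟨h.1, h.2.2⟩
  | right =>
    refine ⟨fun d => .seq (unpairProg d) (.mov d (d + 1)), fun x => 8 * x + 6 + 2,
      Computable.nat_add (Computable.nat_add (Computable.nat_mul
      (Computable.const 8) Computable.id) (Computable.const 6)) (Computable.const 2), fun d s => ?_⟩
    exact (runsTo_unpairProg d s).seq fun s' h => .mov ⟨by simp [h.2.1], h.2.2.setReg le_rfl⟩
  | pair hf hg ihf ihg => exact ihf.pair (key hf) (key hg) ihg
  | comp hf hg ihf ihg => exact ihf.comp (key hg) ihg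
  | prec hf hg ihf ihg => exact ihf.prec (key hf) (key hg) ihg

open Nat.Partrec (Code) in
/-- Every computable function can be computed on a random access machine in computable time. -/
theorem Computable.regComputable {f : ℕ → ℕ} (hf : Computable f) : RegComputable f := by
  obtain ⟨c, hc⟩ : ∃ c : Code, c.eval = fun n => (f n : Part ℕ) :=
    Code.exists_code.1 (Partrec.nat_iff.1 hf)
  -- Evaluation with limited resources: `0` encodes "no value yet", and `f x + 1` encodes the value
  -- `f x`.
  let g : ℕ → ℕ := fun x => Encodable.encode (Code.evaln x.unpair.1 c x.unpair.2)
  have hg : Primrec g := Primrec.encode.comp (Code.primrec_evaln.comp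
    (Primrec.pair (Primrec.pair (Primrec.fst.comp Primrec.unpair) (Primrec.const c))
      (Primrec.snd.comp Primrec.unpair)))
  have hgf : ∀ s x, g (Nat.pair s x) ≠ 0 → g (Nat.pair s x) = f x + 1 := by
    intro s x h
    simp only [g, Nat.unpair_pair] at h ⊢
    cases hv : Code.evaln s c x with
    | none => simp [hv] at h
    | some v =>
      have := Code.evaln_sound (Option.mem_def.2 hv)
      rw [hc] at this
      simp at this
      simp [this]
  have hex : ∀ x, ∃ s, g (Nat.pair s x) ≠ 0 := by
    intro x
    have : f x ∈ c.eval x := by rw [hc]; simp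
    obtain ⟨s, hs⟩ := Code.evaln_complete.1 this
    exact ⟨s, by simp only [g, Nat.unpair_pair, Option.mem_def.1 hs]; simp⟩
  -- The first successful stage. It is itself computable, by unbounded search, which makes the
  -- running time computable.
  let m : ℕ → ℕ := fun x => Nat.find (hex x)
  have hm : Computable m := by
    have h : Computable₂ fun x s => !decide (g (Nat.pair s x) = 0) :=
      (Primrec.not.comp ((Primrec.eq (α := ℕ)).decide.comp (hg.comp (Primrec₂.natPair.comp
        Primrec.snd Primrec.fst)) (Primrec.const 0))).to_comp
    refine (Partrec.rfind h.partrec₂).of_eq fun x => ?_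
    refine Part.eq_some_iff.2 (Nat.mem_rfind.2 ⟨?_, fun {s} hs => ?_⟩)
    · simpa using Nat.find_spec (hex x)
    · simpa using Nat.find_min (hex x) hs
  obtain ⟨p, b, hb, hp⟩ := (Primrec.nat_iff.1 hg).regComputable
  let B : ℕ → ℕ → ℕ := fun x s => 4 * (s + x) + b (Nat.pair s x) + 40
  refine ⟨fun d => .seq (.const (d + 1) 0) <| .seq (.const (d + 2) 1) <|
    .seq (.loop (d + 2) <|
      .seq (.mov (d + 3) (d + 1)) <| .seq (.mov (d + 4) d) <| .seq (pairProg (d + 3)) <|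
      .seq (p (d + 3)) <| .seq (.const (d + 4) 1) <| .cond (d + 3) (.const (d + 2) 0)
        (.add (d + 1) (d + 1) (d + 4))) <|
    .sub d (d + 3) (d + 4),
    fun x => ∑ s ∈ Finset.range (m x + 1), B x s + 4, ?_, fun d s => ?_⟩
  · refine Computable.nat_add (Computable.nat_sum (hm.nat_add (Computable.const 1)) ?_)
      (Computable.const 4)
    exact Computable.nat_add (Computable.nat_add (Computable.nat_mul (Computable.const 4)
      (Computable.snd.nat_add Computable.fst)) (hb.comp (Computable.snd.natPair Computable.fst)))
      (Computable.const 40)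
  set x := s.reg d with hx
  refine RunsTo.of_le (b := 1 + (1 + (∑ s ∈ Finset.range (m x + 1), B x s + 1 + 1))) ?_
    (by simp only; omega)
  refine RunsTo.seq (.const (Q := fun s' => s' = s.setReg (d + 1) 0) rfl) ?_
  rintro _ rfl
  refine RunsTo.seq (.const (Q := fun s' => s' = (s.setReg (d + 1) 0).setReg (d + 2) 1) rfl) ?_
  rintro _ rfl
  refine RunsTo.seq (Q := fun s' => s'.reg (d + 3) = f x + 1 ∧ s'.reg (d + 4) = 1 ∧
    SameBelow d s s') ?_ ?_
  -- The flag in register `d + 2` stays `1` through the stages before `m x`, and the last of the `m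
  -- x + 1` rounds clears it.
  · refine (RunsTo.loop (fun r s' => s'.reg d = x ∧ SameBelow d s s' ∧
      (r = 0 → s'.reg (d + 2) = 0 ∧ s'.reg (d + 3) = f x + 1 ∧ s'.reg (d + 4) = 1) ∧
      (0 < r → s'.reg (d + 2) = 1 ∧ s'.reg (d + 1) + r = m x + 1))
      (fun r => B x (m x + 1 - 1 - r) - 1) (fun s' h => (h.2.2.1 rfl).1)
      (fun r s' h => by have := h.2.2.2 (by omega); omega) ?_ (m x + 1) _ ?_).mono ?_ ?_
    · rintro r s₁ ⟨h1, h2, -, h3⟩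
      obtain ⟨h3, h4⟩ := h3 (by omega)
      obtain ⟨y, hy⟩ : ∃ y, y = s₁.reg (d + 1) := ⟨_, rfl⟩
      rw [show m x + 1 - 1 - r = y by omega]
      refine RunsTo.of_le (b := 2 + (2 + ((4 * (y + x) + 12) + (b (Nat.pair y x) + (1 + (1 + 1))))))
        ?_ (by simp only [B]; omega)
      refine RunsTo.seq (.mov (Q := fun s' => s' = s₁.setReg (d + 3) y) (by rw [hy])) ?_
      rintro _ rfl
      refine RunsTo.seq (.mov (Q := fun s' => s' = (s₁.setReg (d + 3) y).setReg (d + 4) x)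
        (by simp [h1])) ?_
      rintro _ rfl
      refine RunsTo.seq (Q := fun s' => s'.reg (d + 3) = Nat.pair y x ∧ SameBelow (d + 3) s₁ s')
        ((runsTo_pairProg (d + 3) _).mono (by simp) ?_) ?_
      · rintro s₂ ⟨h6, h7⟩
        exact ⟨by simpa using h6, (((SameBelow.refl (d + 3) s₁).setReg (by omega)).setReg
          (by omega)).trans h7⟩
      rintro s₂ ⟨h6, h7⟩
      refine RunsTo.seq (Q := fun s' => s'.reg (d + 3) = g (Nat.pair y x) ∧
        SameBelow (d + 3) s₁ s') ((hp (d + 3) _).mono (by simp [h6]) ?_) ?_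
      · rintro s₃ ⟨h9, h10⟩
        exact ⟨by rw [h9, h6], h7.trans h10⟩
      clear h6 h7 s₂
      rintro s₂ ⟨h6, h7⟩
      refine RunsTo.seq (.const (Q := fun s' => s' = s₂.setReg (d + 4) 1) rfl) ?_
      rintro _ rfl
      have h8 : SameBelow d s s₂ := h2.trans (h7.mono (by omega))
      refine RunsTo.cond (fun h => ?_) (fun h => ?_)
      · simp [h6] at h
        have hr : r = 0 := by
          by_contra hr
          exact h (by simpa using Nat.find_min (hex x) (m := y) (show y < m x by omega))
        refine .const ⟨?_, (h8.setReg (by omega)).setReg (by omega), fun _ => ⟨?_, ?_, ?_⟩, ?_⟩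
        · simp [h7.reg d (by omega), h1]
        · simp
        · simp [h6, hgf _ _ h]
        · simp
        · omega
      · simp [h6] at h
        have hr : 0 < r := by
          by_contra hr
          obtain rfl : y = m x := by omega
          exact Nat.find_spec (hex x) h
        refine .add ⟨?_, (h8.setReg (by omega)).setReg (by omega), ?_, fun _ => ⟨?_, ?_⟩⟩
        · simp [h7.reg d (by omega), h1]
        · omega
        · simp [h7.reg (d + 2) (by omega), h3]
        · simp [h7.reg (d + 1) (by omega)]
          omega
    · exact ⟨by simp [hx], ((SameBelow.refl d s).setReg (by omega)).setReg (by omega), by simp,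
        by simp⟩
    · rw [← Finset.sum_range_reflect (B x) (m x + 1)]
      refine Nat.add_le_add_right (Finset.sum_le_sum fun i _ => ?_) 1
      simp only [B]
      omega
    · rintro s' ⟨h1, h2, h3, -⟩
      exact ⟨(h3 rfl).2.1, (h3 rfl).2.2, h2⟩
  · rintro s' ⟨h1, h2, h3⟩
    exact .sub ⟨by simp [h1, h2], h3.setReg le_rfl⟩

/-! ### Functions that are computable in polynomial time from the instance -/

/-- What a program can use: a bound `N`, the instance `(G, k)` on `n` vertices, a number `H`, and the
memory. -/
structure World where
  N : ℕ
  n : ℕ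
  k : ℕ
  H : ℕ
  mem : ℕ → ℕ
  G : SimpleGraph (Fin n)

/-- A context consists of a world and finitely many number variables. -/
class Ctx (Γ : Type) where
  wd : Γ → World
  size : ℕ
  val : Γ → ℕ → ℕ

open Ctx (wd)

instance : Ctx World := ⟨id, 0, fun _ _ => 0⟩

instance {Γ : Type} [Ctx Γ] : Ctx (Γ × ℕ) :=
  ⟨fun p => wd p.1, Ctx.size Γ + 1, fun p i => Nat.casesOn i p.2 fun j => Ctx.val p.1 j⟩

/-- The functions that are bounded by a polynomial. -/
def PolyBdd (B : ℕ → ℕ) : Prop := ∃ C, ∀ N, B N ≤ (N + 2) ^ C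

namespace PolyBdd

theorem const (c : ℕ) : PolyBdd fun _ => c :=
  ⟨c, fun N => Nat.lt_two_pow_self.le.trans (Nat.pow_le_pow_left (by omega) c)⟩

theorem id : PolyBdd fun N => N := ⟨1, fun N => by rw [pow_one]; exact Nat.le_add_right N 2⟩

theorem mul {B B' : ℕ → ℕ} (h : PolyBdd B) (h' : PolyBdd B') : PolyBdd fun N => B N * B' N := by
  obtain ⟨C, h⟩ := h
  obtain ⟨C', h'⟩ := h'
  exact ⟨C + C', fun N => by rw [pow_add]; exact Nat.mul_le_mul (h N) (h' N)⟩

theorem add {B B' : ℕ → ℕ} (h : PolyBdd B) (h' : PolyBdd B') : PolyBdd fun N => B N + B' N := by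
  obtain ⟨C, h⟩ := h
  obtain ⟨C', h'⟩ := h'
  refine ⟨C + C' + 1, fun N => ?_⟩
  have h1 : (N + 2) ^ C ≤ (N + 2) ^ (C + C') := Nat.pow_le_pow_right (by omega) (by omega)
  have h2 : (N + 2) ^ C' ≤ (N + 2) ^ (C + C') := Nat.pow_le_pow_right (by omega) (by omega)
  have h3 := h N
  have h4 := h' N
  rw [pow_succ]
  nlinarith

end PolyBdd

/-- Add a variable, kept in register `e`. -/
def pushVar (e : ℕ) (r : ℕ → ℕ) : ℕ → ℕ := fun i => Nat.casesOn i e r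

/-- The state `s` holds the context `γ`, with the `i`-th variable in register `r i`, in its
registers below `d` and its memory. -/
structure Represents {Γ : Type} [Ctx Γ] (r : ℕ → ℕ) (d : ℕ) (γ : Γ) (s : RamState) : Prop where
  le : 4 ≤ d
  N : s.reg 0 = (wd γ).N
  n : s.reg 1 = (wd γ).n
  k : s.reg 2 = (wd γ).k
  H : s.reg 3 = (wd γ).H
  mem : s.mem = (wd γ).mem
  lt : ∀ i < Ctx.size Γ, r i < d
  val : ∀ i < Ctx.size Γ, s.reg (r i) = Ctx.val γ i

namespace Represents

variable {Γ : Type} [Ctx Γ] {r : ℕ → ℕ} {d d' e x : ℕ} {γ : Γ} {s s' : RamState}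

theorem of_sameBelow (h : Represents r d γ s) (h' : SameBelow d s s') : Represents r d γ s' := by
  have := h.le
  exact ⟨h.le, (h'.reg _ (by omega)).trans h.N, (h'.reg _ (by omega)).trans h.n,
    (h'.reg _ (by omega)).trans h.k, (h'.reg _ (by omega)).trans h.H, h'.mem.trans h.mem, h.lt,
    fun i hi => (h'.reg _ (h.lt i hi)).trans (h.val i hi)⟩

theorem mono (h : Represents r d γ s) (hd : d ≤ d') : Represents r d' γ s :=
  ⟨h.le.trans hd, h.N, h.n, h.k, h.H, h.mem, fun i hi => (h.lt i hi).trans_le hd, h.val⟩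

theorem push (h : Represents r d γ s) (hx : s.reg e = x) (hd : d ≤ d') (he : e < d') :
    Represents (pushVar e r) d' (γ, x) s := by
  have h' := h.mono hd
  refine ⟨h'.le, h'.N, h'.n, h'.k, h'.H, h'.mem, ?_, ?_⟩
  · rintro (_ | i) hi
    · exact he
    · exact h'.lt i (Nat.lt_of_succ_lt_succ hi)
  · rintro (_ | i) hi
    · exact hx
    · exact h'.val i (Nat.lt_of_succ_lt_succ hi)

theorem fst {γ : Γ × ℕ} (h : Represents r d γ s) : Represents (fun i => r (i + 1)) d γ.1 s :=
  ⟨h.le, h.N, h.n, h.k, h.H, h.mem, fun i hi => h.lt (i + 1) (Nat.succ_lt_succ hi),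
    fun i hi => h.val (i + 1) (Nat.succ_lt_succ hi)⟩

theorem snd {γ : Γ × ℕ} (h : Represents r d γ s) : s.reg (r 0) = γ.2 :=
  h.val 0 (Nat.succ_pos _)

end Represents

/-- On the worlds that satisfy `A`, the function `f` is computed by a program in time polynomial in
`N`. The program leaves the memory and the registers below `d` unchanged and puts the result into
register `d`. -/
def PolyTime {Γ : Type} [Ctx Γ] (A : World → Prop) (f : Γ → ℕ) : Prop :=
  ∃ B, PolyBdd B ∧ ∃ p : (ℕ → ℕ) → ℕ → RamProg, ∀ r d γ s, A (wd γ) → Represents r d γ s →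
    RunsTo (p r d) s (B (wd γ).N) fun s' => s'.reg d = f γ ∧ SameBelow d s s'

/-! ### Closure of polynomial time under instructions, branching and loops of length `N` -/

namespace PolyTime

variable {Γ : Type} [Ctx Γ] {A : World → Prop} {f g : Γ → ℕ}

theorem congr (hf : PolyTime A f) (h : ∀ γ, A (wd γ) → f γ = g γ) : PolyTime A g := by
  obtain ⟨B, hB, p, hp⟩ := hf
  refine ⟨B, hB, p, fun r d γ s hA hs => ?_⟩
  rw [← h γ hA]
  exact hp r d γ s hA hs

theorem const (c : ℕ) : PolyTime A fun _ : Γ => c :=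
  ⟨_, .const 1, fun _ d => .const d c, fun _ d _ s _ _ =>
    .const ⟨by simp, (SameBelow.refl d s).setReg le_rfl⟩⟩

theorem of_reg (i : (ℕ → ℕ) → ℕ) (h : ∀ r d γ s, Represents r d γ s → s.reg (i r) = f γ) :
    PolyTime A f :=
  ⟨_, .const 2, fun r d => .mov d (i r), fun r d γ s _ hs =>
    .mov ⟨by simp [h r d γ s hs], (SameBelow.refl d s).setReg le_rfl⟩⟩

theorem worldN : PolyTime A fun γ : Γ => (wd γ).N := of_reg (fun _ => 0) fun _ _ _ _ h => h.N

theorem worldn : PolyTime A fun γ : Γ => (wd γ).n := of_reg (fun _ => 1) fun _ _ _ _ h => h.n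

theorem worldk : PolyTime A fun γ : Γ => (wd γ).k := of_reg (fun _ => 2) fun _ _ _ _ h => h.k

theorem worldH : PolyTime A fun γ : Γ => (wd γ).H := of_reg (fun _ => 3) fun _ _ _ _ h => h.H

theorem snd : PolyTime A fun γ : Γ × ℕ => γ.2 := of_reg (fun r => r 0) fun _ _ _ _ h => h.snd

theorem weaken (hf : PolyTime A f) : PolyTime A fun γ : Γ × ℕ => f γ.1 := by
  obtain ⟨B, hB, p, hp⟩ := hf
  exact ⟨B, hB, fun r d => p (fun i => r (i + 1)) d, fun r d γ s hA hs =>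
    hp _ d γ.1 s hA hs.fst⟩

/-- Evaluating the second argument with `d + 1` as first free register keeps the first result in
register `d` intact. -/
theorem of_instr (ins : ℕ → RamProg) (op : ℕ → ℕ → ℕ)
    (h : ∀ d (s : RamState) (Q : RamState → Prop),
      Q (s.setReg d (op (s.reg d) (s.reg (d + 1)))) → RunsTo (ins d) s 1 Q)
    (hf : PolyTime A f) (hg : PolyTime A g) : PolyTime A fun γ => op (f γ) (g γ) := by
  obtain ⟨B, hB, p, hp⟩ := hf
  obtain ⟨B', hB', q, hq⟩ := hg
  refine ⟨_, hB.add (hB'.add (.const 1)), fun r d => .seq (p r d) <|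
    .seq (q r (d + 1)) (ins d), fun r d γ s hA hs => ?_⟩
  refine (hp r d γ s hA hs).seq fun s₁ h₁ => ?_
  refine (hq _ _ γ s₁ hA ((hs.of_sameBelow h₁.2).mono (by omega))).seq fun s₂ h₂ => h _ _ _ ?_
  have := h₂.2.reg d (by omega)
  exact ⟨by simp [h₂.1, this, h₁.1], (h₁.2.trans (h₂.2.mono (by omega))).setReg le_rfl⟩

theorem add (hf : PolyTime A f) (hg : PolyTime A g) : PolyTime A fun γ => f γ + g γ :=
  of_instr (fun d => .add d d (d + 1)) (· + ·) (fun _ _ _ h => .add h) hf hg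

theorem sub (hf : PolyTime A f) (hg : PolyTime A g) : PolyTime A fun γ => f γ - g γ :=
  of_instr (fun d => .sub d d (d + 1)) (· - ·) (fun _ _ _ h => .sub h) hf hg

theorem half (hf : PolyTime A f) : PolyTime A fun γ => f γ / 2 :=
  of_instr (fun d => .half d d) (fun a _ => a / 2) (fun _ _ _ h => .half h) hf hf

theorem load (hf : PolyTime A f) : PolyTime A fun γ => (wd γ).mem (f γ) := by
  obtain ⟨B, hB, p, hp⟩ := hf
  refine ⟨_, hB.add (.const 1), fun r d => .seq (p r d) (.load d d), fun r d γ s hA hs => ?_⟩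
  refine (hp r d γ s hA hs).seq fun s₁ h₁ => .load ⟨?_, h₁.2.setReg le_rfl⟩
  simp [h₁.1, (hs.of_sameBelow h₁.2).mem]

theorem ite_ne_zero {c : Γ → ℕ} (hc : PolyTime A c) (hf : PolyTime A f) (hg : PolyTime A g) :
    PolyTime A fun γ => if c γ ≠ 0 then f γ else g γ := by
  obtain ⟨B₀, hB₀, p₀, hp₀⟩ := hc
  obtain ⟨B, hB, p, hp⟩ := hf
  obtain ⟨B', hB', q, hq⟩ := hg
  refine ⟨_, hB₀.add ((hB.add hB').add (.const 1)), fun r d => .seq (p₀ r d)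
    (.cond d (p r d) (q r d)), fun r d γ s hA hs => ?_⟩
  refine (hp₀ r d γ s hA hs).seq fun s₁ h₁ => .cond (fun h => ?_) (fun h => ?_)
  · refine (hp r d γ s₁ hA (hs.of_sameBelow h₁.2)).mono (by omega) fun s₂ h₂ => ⟨?_, h₁.2.trans h₂.2⟩
    simp only [h₂.1, ← h₁.1, if_pos h]
  · refine (hq r d γ s₁ hA (hs.of_sameBelow h₁.2)).mono (by omega) fun s₂ h₂ => ⟨?_, h₁.2.trans h₂.2⟩
    simp only [h₂.1, ← h₁.1, h, ne_eq, not_true_eq_false, if_false]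

/-- The accumulator may become huge, but at unit cost the bound on one round depends on `N` alone,
so `N` rounds remain polynomial. -/
theorem foldN {step : (Γ × ℕ) × ℕ → ℕ} (hf : PolyTime A f) (hs : PolyTime A step) :
    PolyTime A fun γ => Nat.rec (f γ) (fun i acc => step ((γ, i), acc)) (wd γ).N := by
  obtain ⟨B, hB, p, hp⟩ := hf
  obtain ⟨B', hB', q, hq⟩ := hs
  refine ⟨fun N => B N + (1 + (2 + (N * ((B' N + (2 + (1 + (1 + 1)))) + 1) + 1))),
    hB.add ((PolyBdd.const 1).add ((PolyBdd.const 2).add ((PolyBdd.id.mul ((hB'.add (.const _)).add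
      (.const 1))).add (.const 1)))), fun r d => .seq (p r d) <|
    .seq (.const (d + 1) 0) <| .seq (.mov (d + 2) 0) <| .loop (d + 2) <|
    .seq (q (pushVar d (pushVar (d + 1) r)) (d + 3)) <| .seq (.mov d (d + 3)) <|
    .seq (.const (d + 3) 1) <| .seq (.add (d + 1) (d + 1) (d + 3)) (.sub (d + 2) (d + 2) (d + 3)),
    fun r d γ s hA hs => ?_⟩
  set N := (wd γ).N with hN
  let acc : ℕ → ℕ := fun N => Nat.rec (f γ) (fun i acc => step ((γ, i), acc)) N
  refine (hp r d γ s hA hs).seq fun s₁ h₁ => ?_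
  refine RunsTo.seq (.const (Q := fun s' => s' = s₁.setReg (d + 1) 0) rfl) ?_
  rintro _ rfl
  refine RunsTo.seq (.mov (Q := fun s' => s' = (s₁.setReg (d + 1) 0).setReg (d + 2) N) ?_) ?_
  · have := (hs.of_sameBelow h₁.2).N
    simp [this, hN]
  rintro _ rfl
  refine (RunsTo.loop_const (fun m s' => ∃ y, y + m = N ∧ s'.reg d = acc y ∧
    s'.reg (d + 1) = y ∧ s'.reg (d + 2) = m ∧ SameBelow d s s') (fun s' ⟨_, h⟩ => h.2.2.2.1)
    (fun m s' ⟨_, h⟩ => by omega) ?_ N _ ?_).mono le_rfl ?_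
  · rintro m s₂ ⟨y, h1, h2, h3, h4, h5⟩
    have hs₂ := ((hs.of_sameBelow h5).push h3 (d' := d + 2) (by omega) (by omega)).push h2
      (d' := d + 3) (by omega) (by omega)
    refine (hq _ _ _ s₂ hA hs₂).seq fun s₃ h₃ => ?_
    refine RunsTo.seq (b := 2) (b' := 1 + (1 + 1)) (.mov (Q := fun s' => s' = s₃.setReg d (acc (y + 1))) (by rw [h₃.1])) ?_
    rintro _ rfl
    refine RunsTo.seq (.const (Q := fun s' => s' = (s₃.setReg d (acc (y + 1))).setReg (d + 3) 1)
      rfl) ?_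
    rintro _ rfl
    refine RunsTo.seq (.add (Q := fun s' => s' = ((s₃.setReg d (acc (y + 1))).setReg
      (d + 3) 1).setReg (d + 1) (y + 1)) (by simp [h₃.2.reg (d + 1) (by omega), h3])) ?_
    rintro _ rfl
    refine .sub ⟨y + 1, by omega, by simp, by simp, ?_, ?_⟩
    · simp [h₃.2.reg (d + 2) (by omega), h4]
    · exact ((((h5.trans (h₃.2.mono (by omega))).setReg (by omega)).setReg (by omega)).setReg
        (by omega)).setReg (by omega)
  · exact ⟨0, by omega, by simp [h₁.1, acc], by simp, by simp,
      (h₁.2.setReg (by omega)).setReg (by omega)⟩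
  · rintro s' ⟨y, h1, h2, -, -, h5⟩
    obtain rfl : y = N := by omega
    exact ⟨h2, h5⟩

end PolyTime

/-- The predicates that can be decided in polynomial time. -/
def PolyTimePred {Γ : Type} [Ctx Γ] (A : World → Prop) (P : Γ → Prop) : Prop :=
  ∃ c, PolyTime A c ∧ ∀ γ, A (wd γ) → (c γ ≠ 0 ↔ P γ)

/-! ### Boolean combinations and comparisons -/

namespace PolyTimePred

variable {Γ : Type} [Ctx Γ] {A : World → Prop} {f g : Γ → ℕ} {P Q : Γ → Prop}

theorem congr (hP : PolyTimePred A P) (h : ∀ γ, A (wd γ) → (P γ ↔ Q γ)) : PolyTimePred A Q := by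
  obtain ⟨c, hc, hP⟩ := hP
  exact ⟨c, hc, fun γ hA => (hP γ hA).trans (h γ hA)⟩

theorem lt (hf : PolyTime A f) (hg : PolyTime A g) : PolyTimePred A fun γ => f γ < g γ :=
  ⟨_, hg.sub hf, fun γ _ => by omega⟩

theorem le (hf : PolyTime A f) (hg : PolyTime A g) : PolyTimePred A fun γ => f γ ≤ g γ :=
  ⟨_, (hg.add (.const 1)).sub hf, fun γ _ => by omega⟩

theorem not (hP : PolyTimePred A P) : PolyTimePred A fun γ => ¬ P γ := by
  obtain ⟨c, hc, hP⟩ := hP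
  exact ⟨_, (PolyTime.const 1).sub hc, fun γ hA => by have := hP γ hA; simp only [← this]; omega⟩

theorem or (hP : PolyTimePred A P) (hQ : PolyTimePred A Q) : PolyTimePred A fun γ => P γ ∨ Q γ := by
  obtain ⟨c, hc, hP⟩ := hP
  obtain ⟨c', hc', hQ⟩ := hQ
  exact ⟨_, hc.add hc', fun γ hA => by simp only [← hP γ hA, ← hQ γ hA]; omega⟩

theorem and (hP : PolyTimePred A P) (hQ : PolyTimePred A Q) :
    PolyTimePred A fun γ => P γ ∧ Q γ :=
  (hP.not.or hQ.not).not.congr fun γ _ => by tauto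

theorem imply (hP : PolyTimePred A P) (hQ : PolyTimePred A Q) :
    PolyTimePred A fun γ => P γ → Q γ :=
  (hP.not.or hQ).congr fun γ _ => by tauto

theorem eq (hf : PolyTime A f) (hg : PolyTime A g) : PolyTimePred A fun γ => f γ = g γ :=
  ((le hf hg).and (le hg hf)).congr fun γ _ => by omega

theorem ite [∀ γ, Decidable (P γ)] (hP : PolyTimePred A P) (hf : PolyTime A f)
    (hg : PolyTime A g) : PolyTime A fun γ => if P γ then f γ else g γ := by
  obtain ⟨c, hc, hP⟩ := hP
  refine (hc.ite_ne_zero hf hg).congr fun γ hA => ?_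
  simp only [hP γ hA]

end PolyTimePred

/-! ### Bounded iteration and derived arithmetic -/

namespace PolyTime

variable {Γ : Type} [Ctx Γ] {A : World → Prop} {f g : Γ → ℕ}

/-- The loop always makes `N` rounds; those with index at least `g γ` leave the accumulator
unchanged. -/
theorem fold {step : (Γ × ℕ) × ℕ → ℕ} (hf : PolyTime A f) (hs : PolyTime A step)
    (hg : PolyTime A g) (hb : ∀ γ, A (wd γ) → g γ ≤ (wd γ).N) :
    PolyTime A fun γ => Nat.rec (f γ) (fun i acc => step ((γ, i), acc)) (g γ) := by
  have key : ∀ (a b : ℕ) (F : ℕ → ℕ → ℕ) (m : ℕ),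
      (Nat.rec a (fun i acc => if i < b then F i acc else acc) m : ℕ) = Nat.rec a F (min m b) := by
    intro a b F m
    induction m with
    | zero => simp
    | succ m ih =>
      simp only [ih]
      by_cases h : m < b
      · rw [if_pos h, min_eq_left h.le, min_eq_left (show m + 1 ≤ b from h)]
      · rw [if_neg h, min_eq_right (by omega), min_eq_right (by omega)]
  refine (hf.foldN (step := fun p => if p.1.2 < g p.1.1 then step p else p.2)
    ((PolyTimePred.lt snd.weaken hg.weaken.weaken).ite hs snd)).congr fun γ hA => ?_
  have := key (f γ) (g γ) (fun i acc => step ((γ, i), acc)) (wd γ).N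
  rw [min_eq_right (hb γ hA)] at this
  exact this

theorem sum_range {F : Γ × ℕ → ℕ} (hg : PolyTime A g) (hF : PolyTime A F)
    (hb : ∀ γ, A (wd γ) → g γ ≤ (wd γ).N) :
    PolyTime A fun γ => ∑ i ∈ Finset.range (g γ), F (γ, i) := by
  refine (fold (.const 0) (step := fun p => p.2 + F p.1) (snd.add hF.weaken) hg hb).congr
    fun γ _ => ?_
  induction g γ with
  | zero => rfl
  | succ m ih => rw [Finset.sum_range_succ, ← ih]

/-- Repeated addition takes as many summands as the second factor, so only that factor has to be
bounded by `N`. -/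
theorem mul (hf : PolyTime A f) (hg : PolyTime A g) (hb : ∀ γ, A (wd γ) → g γ ≤ (wd γ).N) :
    PolyTime A fun γ => f γ * g γ :=
  (sum_range hg (F := fun p => f p.1) hf.weaken hb).congr fun γ _ => by simp [mul_comm]

theorem mul_two_pow (hf : PolyTime A f) (hg : PolyTime A g)
    (hb : ∀ γ, A (wd γ) → g γ ≤ (wd γ).N) : PolyTime A fun γ => f γ * 2 ^ g γ := by
  refine (fold hf (step := fun p => p.2 + p.2) (snd.add snd) hg hb).congr fun γ _ => ?_
  induction g γ with
  | zero => simp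
  | succ m ih => rw [pow_succ, ← mul_assoc, ← ih, mul_two]

theorem two_pow (hg : PolyTime A g) (hb : ∀ γ, A (wd γ) → g γ ≤ (wd γ).N) :
    PolyTime A fun γ => 2 ^ g γ :=
  ((const 1).mul_two_pow hg hb).congr fun γ _ => by simp

theorem div_two_pow (hf : PolyTime A f) (hg : PolyTime A g)
    (hb : ∀ γ, A (wd γ) → g γ ≤ (wd γ).N) : PolyTime A fun γ => f γ / 2 ^ g γ := by
  refine (fold hf (step := fun p => p.2 / 2) snd.half hg hb).congr fun γ _ => ?_
  induction g γ with
  | zero => simp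
  | succ m ih => rw [pow_succ, ← Nat.div_div_eq_div_mul, ← ih]

theorem mod_two_pow (hf : PolyTime A f) (hg : PolyTime A g)
    (hb : ∀ γ, A (wd γ) → g γ ≤ (wd γ).N) : PolyTime A fun γ => f γ % 2 ^ g γ :=
  (hf.sub ((hf.div_two_pow hg hb).mul_two_pow hg hb)).congr fun γ _ => by
    have := Nat.div_add_mod' (f γ) (2 ^ g γ)
    omega

theorem mod_two (hf : PolyTime A f) : PolyTime A fun γ => f γ % 2 :=
  (hf.sub (hf.half.add hf.half)).congr fun γ _ => by omega

/-- Conditional subtraction, `N` times: as long as the result is not reduced, each round with a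
positive modulus lowers it by at least one, and it starts at most at `N`. A zero modulus subtracts
nothing, in accordance with `x % 0 = x`. -/
theorem mod (hf : PolyTime A f) (hg : PolyTime A g) (hb : ∀ γ, A (wd γ) → f γ ≤ (wd γ).N) :
    PolyTime A fun γ => f γ % g γ := by
  refine (foldN hf (step := fun p => if g p.1.1 ≤ p.2 then p.2 - g p.1.1 else p.2)
    ((PolyTimePred.le hg.weaken.weaken snd).ite (snd.sub hg.weaken.weaken) snd)).congr
    fun γ hA => ?_
  have key : ∀ (a b m : ℕ), ∃ c : ℕ, c = (Nat.rec a (fun _ acc => if b ≤ acc then acc - b else acc) m : ℕ) ∧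
      c % b = a % b ∧ (c < b ∨ b = 0 ∨ c + m ≤ a) := by
    intro a b m
    induction m with
    | zero => exact ⟨a, rfl, rfl, by omega⟩
    | succ m ih =>
      obtain ⟨c, hc, h1, h2⟩ := ih
      refine ⟨_, rfl, ?_⟩
      simp only [← hc]
      split_ifs with h
      · exact ⟨by rw [← h1, Nat.mod_eq_sub_mod h], by omega⟩
      · exact ⟨h1, by omega⟩
  obtain ⟨c, hc, h1, h2⟩ := key (f γ) (g γ) (wd γ).N
  have hle := hb γ hA
  refine hc.symm.trans ?_
  rw [← h1]
  rcases h2 with h | h | h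
  · exact (Nat.mod_eq_of_lt h).symm
  · simp [h]
  · obtain rfl : c = 0 := by omega
    simp

/-- The quotient is the number of `i < f γ` with `(i + 1) * g γ ≤ f γ`. -/
theorem div (hf : PolyTime A f) (hg : PolyTime A g) (hb : ∀ γ, A (wd γ) → f γ ≤ (wd γ).N)
    (hb' : ∀ γ, A (wd γ) → g γ ≤ (wd γ).N) (h0 : ∀ γ, A (wd γ) → 0 < g γ) :
    PolyTime A fun γ => f γ / g γ := by
  refine (sum_range hf (F := fun p => if (p.2 + 1) * g p.1 ≤ f p.1 then 1 else 0)
    ((PolyTimePred.le ((snd.add (.const 1)).mul hg.weaken fun γ hA => hb' γ.1 hA) hf.weaken).ite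
      (.const 1) (.const 0)) hb).congr fun γ hA => ?_
  have h1 : ∀ i ∈ Finset.range (f γ), ((i + 1) * g γ ≤ f γ ↔ i < f γ / g γ) := fun i _ => by
    rw [← Nat.le_div_iff_mul_le (h0 γ hA), Nat.succ_le_iff]
  have h2 : ∑ i ∈ Finset.range (f γ), (if (i + 1) * g γ ≤ f γ then 1 else 0) =
      ∑ i ∈ Finset.range (f γ), if i < f γ / g γ then 1 else 0 :=
    Finset.sum_congr rfl fun i hi => by simp only [h1 i hi]
  refine h2.trans ?_
  rw [← Finset.sum_filter, Finset.sum_const, smul_eq_mul, mul_one]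
  have : (Finset.range (f γ)).filter (fun i => i < f γ / g γ) = Finset.range (f γ / g γ) := by
    ext i
    have := Nat.div_le_self (f γ) (g γ)
    simp
    omega
  rw [this, Finset.card_range]

end PolyTime

/-! ### Logarithms, and sums whose body needs a bounded index -/

namespace PolyTime

variable {Γ : Type} [Ctx Γ] {A : World → Prop} {f g : Γ → ℕ}

theorem min (hf : PolyTime A f) (hg : PolyTime A g) : PolyTime A fun γ => min (f γ) (g γ) :=
  ((PolyTimePred.le hf hg).ite hf hg).congr fun _ _ => (min_def _ _).symm

/-- Exponents above `N` can be replaced by `N`, because the dividend is below `2 ^ N` and both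
quotients vanish. -/
theorem div_two_pow_of_le (hf : PolyTime A f) (hg : PolyTime A g)
    (hb : ∀ γ, A (wd γ) → f γ ≤ (wd γ).N) : PolyTime A fun γ => f γ / 2 ^ g γ := by
  refine (hf.div_two_pow (hg.min worldN) fun γ _ => min_le_right _ _).congr fun γ hA => ?_
  rcases le_total (g γ) (wd γ).N with h | h
  · rw [min_eq_left h]
  · have h1 : f γ < 2 ^ (wd γ).N := (hb γ hA).trans_lt Nat.lt_two_pow_self
    rw [min_eq_right h, Nat.div_eq_of_lt h1,
      Nat.div_eq_of_lt (h1.trans_le (Nat.pow_le_pow_right (by omega) h))]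

theorem size (hf : PolyTime A f) (hb : ∀ γ, A (wd γ) → f γ ≤ (wd γ).N) :
    PolyTime A fun γ => Nat.size (f γ) := by
  refine (sum_range hf (F := fun p => if f p.1 / 2 ^ p.2 ≠ 0 then 1 else 0)
    (ite_ne_zero (hf.weaken.div_two_pow_of_le snd fun γ hA => hb γ.1 hA) (.const 1) (.const 0))
    hb).congr fun γ _ => ?_
  simp only
  rw [← Finset.sum_filter, Finset.sum_const, smul_eq_mul, mul_one]
  have : (Finset.range (f γ)).filter (fun i => f γ / 2 ^ i ≠ 0) = Finset.range (f γ).size := by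
    ext i
    have h1 : (f γ).size ≤ f γ := Nat.size_le.2 Nat.lt_two_pow_self
    have h2 := Nat.lt_size (m := i) (n := f γ)
    have h3 : f γ / 2 ^ i ≠ 0 ↔ 2 ^ i ≤ f γ := by
      rw [Ne, Nat.div_eq_zero_iff]
      have := Nat.two_pow_pos i
      omega
    simp only [Finset.mem_filter, Finset.mem_range, h3]
    omega
  rw [this, Finset.card_range]

theorem log_two (hf : PolyTime A f) (hb : ∀ γ, A (wd γ) → f γ ≤ (wd γ).N) :
    PolyTime A fun γ => Nat.log 2 (f γ) := by
  refine ((hf.size hb).sub (.const 1)).congr fun γ _ => ?_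
  rcases Nat.eq_zero_or_pos (f γ) with h | h
  · simp [h]
  · have h1 : Nat.log 2 (f γ) < Nat.size (f γ) := Nat.lt_size.2 (Nat.pow_log_le_self 2 h.ne')
    have h2 : Nat.size (f γ) ≤ Nat.log 2 (f γ) + 1 :=
      Nat.size_le.2 (Nat.lt_pow_succ_log_self (by omega) _)
    omega

/-- A body has to be compiled for all values of its variable, also those never reached. Clamping the
index makes the size bounds required by `mul`, `div` or `mod` hold everywhere. -/
theorem sum_lt {F : Γ → ℕ → ℕ} (hg : PolyTime A g) (hb : ∀ γ, A (wd γ) → g γ ≤ (wd γ).N)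
    (hF : PolyTime A fun p : Γ × ℕ => F p.1 (Min.min p.2 (g p.1))) :
    PolyTime A fun γ => ∑ i ∈ Finset.range (g γ), F γ i :=
  (sum_range hg hF hb).congr fun γ _ => Finset.sum_congr rfl fun i hi => by
    simp only [min_eq_left (Finset.mem_range.1 hi).le]

end PolyTime

/-! ### Bounded quantifiers, with the same clamping of the index -/

namespace PolyTimePred

variable {Γ : Type} [Ctx Γ] {A : World → Prop} {g : Γ → ℕ}

theorem exists_lt {P : Γ → ℕ → Prop} (hg : PolyTime A g) (hb : ∀ γ, A (wd γ) → g γ ≤ (wd γ).N)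
    (hP : PolyTimePred A fun p : Γ × ℕ => P p.1 (min p.2 (g p.1))) :
    PolyTimePred A fun γ => ∃ i < g γ, P γ i := by
  obtain ⟨c, hc, hP⟩ := hP
  refine ⟨_, PolyTime.sum_range hg hc hb, fun γ hA => ?_⟩
  rw [Ne, Finset.sum_eq_zero_iff]
  push Not
  simp only [Finset.mem_range]
  refine exists_congr fun i => and_congr_right fun hi => ?_
  have := hP (γ, i) hA
  simp only [min_eq_left hi.le] at this
  exact this

theorem forall_lt {P : Γ → ℕ → Prop} (hg : PolyTime A g) (hb : ∀ γ, A (wd γ) → g γ ≤ (wd γ).N)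
    (hP : PolyTimePred A fun p : Γ × ℕ => P p.1 (min p.2 (g p.1))) :
    PolyTimePred A fun γ => ∀ i < g γ, P γ i :=
  (exists_lt (P := fun γ i => ¬ P γ i) hg hb hP.not).not.congr fun γ _ => by push Not; rfl

end PolyTimePred

/-! ### Hashing by remainders -/

theorem two_pow_le_centralBinom (n : ℕ) : 2 ^ n ≤ n.centralBinom := by
  induction n with
  | zero => simp
  | succ n ih =>
    have h := Nat.succ_mul_centralBinom_succ n
    have h1 : 2 * n.centralBinom ≤ (n + 1).centralBinom := by
      refine Nat.le_of_mul_le_mul_left (c := n + 1) ?_ (by omega)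
      rw [h]
      nlinarith
    rw [pow_succ]
    omega

/-- A modulus that fails divides the difference of two distinct elements of `S`, hence the product
`D` of all these differences. If all moduli up to `2 * M` failed, the central binomial coefficient
of `M`, whose prime power factors are at most `2 * M`, would divide `D`; but it is at least `2 ^ M`,
while `D < 2 ^ M`. -/
theorem exists_injOn_mod (S : Finset ℕ) {B M : ℕ} (hS : ∀ x ∈ S, x < 2 ^ B)
    (hM : B * S.card ^ 2 < M) : ∃ p, 0 < p ∧ p ≤ 2 * M ∧ Set.InjOn (fun x => x % p) S := by
  by_contra! hcon
  set D := ∏ q ∈ S.offDiag, Nat.dist q.1 q.2 with hD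
  have hD0 : D ≠ 0 := by
    refine Finset.prod_ne_zero_iff.2 fun q hq => ?_
    have := (Finset.mem_offDiag.1 hq).2.2
    unfold Nat.dist
    omega
  have hDlt : D < 2 ^ M := by
    have h1 : D ≤ (2 ^ B) ^ S.offDiag.card := by
      refine Finset.prod_le_pow_card _ _ _ fun q hq => ?_
      have h := Finset.mem_offDiag.1 hq
      have h1 := hS _ h.1
      have h2 := hS _ h.2.1
      unfold Nat.dist
      omega
    refine h1.trans_lt ?_
    rw [← pow_mul]
    refine Nat.pow_lt_pow_right (by omega) (lt_of_le_of_lt (Nat.mul_le_mul_left _ ?_) hM)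
    rw [Finset.offDiag_card, sq]
    exact Nat.sub_le _ _
  have hdvd : ∀ p, 0 < p → p ≤ 2 * M → p ∣ D := by
    intro p hp hpM
    have := hcon p hp hpM
    unfold Set.InjOn at this
    push Not at this
    obtain ⟨x, hx, y, hy, hxy, hne⟩ := this
    refine dvd_trans ?_ (Finset.dvd_prod_of_mem (fun q : ℕ × ℕ => Nat.dist q.1 q.2)
      (Finset.mem_offDiag.2 (show ((x, y) : ℕ × ℕ).1 ∈ S ∧ _ ∧ _ from ⟨hx, hy, hne⟩)))
    rcases le_total x y with h | h
    · rw [Nat.dist_eq_sub_of_le h]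
      exact (Nat.modEq_iff_dvd' h).1 hxy
    · rw [Nat.dist_eq_sub_of_le_right h]
      exact (Nat.modEq_iff_dvd' h).1 hxy.symm
  have hcb : M.centralBinom ∣ D := by
    rw [← Nat.factorization_prime_le_iff_dvd (Nat.centralBinom_ne_zero M) hD0]
    intro p hp
    rw [← hp.pow_dvd_iff_le_factorization hD0]
    by_cases hM0 : M = 0
    · simp [hM0]
    · exact hdvd _ (pow_pos hp.pos _) (Nat.pow_factorization_choose_le (by omega))
  have := Nat.le_of_dvd (Nat.pos_of_ne_zero hD0) hcb
  have := two_pow_le_centralBinom M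
  omega

/-! ### Digits in base `2 ^ w` -/

/-- Used for tables of constraints, for tuples of hash values and, with `w = 1`, for characteristic
vectors. -/
theorem exists_digits (w m : ℕ) (Z : ℕ → ℕ) :
    ∃ x < 2 ^ (w * m), ∀ a < m, x / 2 ^ (w * a) % 2 ^ w = Z a % 2 ^ w := by
  induction m generalizing Z with
  | zero => exact ⟨0, by simp, by simp⟩
  | succ m ih =>
    obtain ⟨y, hy, h⟩ := ih fun a => Z (a + 1)
    have hlt : Z 0 % 2 ^ w < 2 ^ w := Nat.mod_lt _ (by positivity)
    refine ⟨Z 0 % 2 ^ w + 2 ^ w * y, ?_, ?_⟩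
    · have h2 : 2 ^ w * (y + 1) ≤ 2 ^ w * 2 ^ (w * m) := Nat.mul_le_mul_left _ hy
      rw [mul_add, mul_one] at h2
      rw [mul_add, mul_one, pow_add, mul_comm (2 ^ (w * m))]
      omega
    · rintro (_ | a) ha
      · simp
      · rw [mul_add, mul_one, add_comm (w * a), pow_add, ← Nat.div_div_eq_div_mul,
          Nat.add_mul_div_left _ _ (by positivity), Nat.div_eq_of_lt hlt, zero_add]
        exact h a (by omega)

theorem eq_of_bits_eq {L u v : ℕ} (hu : u < 2 ^ L) (hv : v < 2 ^ L)
    (h : ∀ b < L, u / 2 ^ b % 2 = v / 2 ^ b % 2) : u = v := by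
  refine Nat.eq_of_testBit_eq fun b => ?_
  by_cases hb : b < L
  · rw [Nat.testBit_eq_decide_div_mod_eq, Nat.testBit_eq_decide_div_mod_eq, h b hb]
  · have := Nat.pow_le_pow_right (n := 2) (by omega) (not_lt.1 hb)
    rw [Nat.testBit_lt_two_pow (by omega), Nat.testBit_lt_two_pow (by omega)]

/-! ### The gap reduction

A `k`-clique is a family of `k * k` pairs of vertices, one for each slot `(i, i')`, with certain
equalities between their components. -/

namespace Gap

/-- The number of slots. -/
def slots (k : ℕ) : ℕ := k * k

/-- The exponent of the gap in the size of the instance. -/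
def expo (k : ℕ) : ℕ := 4 * slots k + 1

/-- The length of the binary representation of a vertex. -/
def bits (n : ℕ) : ℕ := Nat.size n

/-- The binary logarithm of the gap. -/
def gap (n k : ℕ) : ℕ := Nat.log 2 (bits n) / expo k

/-- The length of the binary representation of a position in the representation of a vertex. -/
def posLen (n k : ℕ) : ℕ := expo k * (gap n k + 1)

/-- The length of the binary representation of a constraint. -/
def conLen (n k : ℕ) : ℕ := 2 + posLen n k + slots k

/-- The length of the binary representation of the first modulus. -/
def modLen₁ (n k : ℕ) : ℕ := posLen n k + 2 * gap n k + 2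

/-- The length of the binary representation of the second modulus. -/
def modLen₂ (n k : ℕ) : ℕ := 4 * gap n k

/-- The number of vertices of the new graph. -/
def order (n k : ℕ) : ℕ := (slots k + 1) * 2 ^ (2 * bits n)

/-- The hash function given by two moduli. -/
def hash (n k p₁ p₂ σ : ℕ) : ℕ := σ % p₁ % p₂ % 2 ^ modLen₂ n k

def fst (n σ : ℕ) : ℕ := σ / 2 ^ bits n

def snd (n σ : ℕ) : ℕ := σ % 2 ^ bits n

/-- The pair `σ` of vertices may be put into slot `j`. -/
def Valid (n k : ℕ) (E : ℕ → ℕ → Prop) (j σ : ℕ) : Prop :=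
  fst n σ < n ∧ snd n σ < n ∧ (j / k = j % k ∨ E (fst n σ) (snd n σ))

/-- The slot of a constraint. -/
def conSlot (n k z : ℕ) : ℕ := z / 2 ^ (2 + posLen n k) % slots k

/-- The position of a constraint. -/
def conPos (n k z : ℕ) : ℕ := z / 4 % 2 ^ posLen n k

/-- The pair `σ` in slot `j` meets the constraint `z`. -/
def Meets (n k j σ z : ℕ) : Prop :=
  (z / 2 % 2 = 0 ∧
    ((j = conSlot n k z ∧ fst n σ / 2 ^ conPos n k z % 2 = z % 2) ∨
      (j = conSlot n k z / k * k ∧ ¬ fst n σ / 2 ^ conPos n k z % 2 = z % 2))) ∨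
  (z / 2 % 2 = 1 ∧
    ((j = conSlot n k z ∧ snd n σ / 2 ^ conPos n k z % 2 = z % 2) ∨
      (j = conSlot n k z % k * k ∧ ¬ fst n σ / 2 ^ conPos n k z % 2 = z % 2)))

/-- The hash function that belongs to the element `y`. -/
def elemHash (n k y σ : ℕ) : ℕ :=
  hash n k (y / 2 ^ bits n % 2 ^ modLen₁ n k)
    (y / 2 ^ (bits n + modLen₁ n k) % 2 ^ modLen₂ n k) σ

/-- The constraint that the element `y` assigns to the tuple `a` of hash values. -/
def elemCon (n k y a : ℕ) : ℕ := y % 2 ^ bits n / 2 ^ (conLen n k * a) % 2 ^ conLen n k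

/-- The set given by the pair `σ` in slot `j` contains the element `y`. -/
def Covers (n k : ℕ) (E : ℕ → ℕ → Prop) (j σ y : ℕ) : Prop :=
  Valid n k E j σ ∧ ∃ a < 2 ^ (modLen₂ n k * slots k),
    a / 2 ^ (modLen₂ n k * j) % 2 ^ modLen₂ n k = elemHash n k y σ ∧
      Meets n k j σ (elemCon n k y a)

/-- The vertex `u` of the new graph is a set, the vertex `v` is an element, and `v` is in `u`. -/
def Contain (n k : ℕ) (E : ℕ → ℕ → Prop) (u v : ℕ) : Prop :=
  u / 2 ^ (2 * bits n) < slots k ∧ ¬ v / 2 ^ (2 * bits n) < slots k ∧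
    Covers n k E (u / 2 ^ (2 * bits n)) (u % 2 ^ (2 * bits n)) (v % 2 ^ (2 * bits n))

/-- The adjacency relation of the new graph. -/
def Adj (n k : ℕ) (E : ℕ → ℕ → Prop) (u v : ℕ) : Prop :=
  (¬ u = v ∧ u / 2 ^ (2 * bits n) < slots k ∧ v / 2 ^ (2 * bits n) < slots k) ∨
    Contain n k E u v ∨ Contain n k E v u

/-- The new graph. -/
def graph (n k : ℕ) (E : ℕ → ℕ → Prop) : SimpleGraph (Fin (order n k)) where
  Adj u v := Adj n k E u v
  symm := ⟨fun u v h => by unfold Adj at *; tauto⟩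
  loopless := ⟨fun u h => by unfold Adj Contain at *; tauto⟩

/-! ### Size estimates, completeness and soundness of the reduction -/

variable {n k : ℕ} {E : ℕ → ℕ → Prop}

theorem lt_two_pow_bits (n : ℕ) : n < 2 ^ bits n := Nat.lt_size_self n

theorem two_pow_bits_le (hn : 0 < n) : 2 ^ bits n ≤ 2 * n := by
  have h : 0 < bits n := Nat.size_pos.2 hn
  have : 2 ^ (bits n - 1) ≤ n := Nat.lt_size.1 (show bits n - 1 < Nat.size n by
    unfold bits at *; omega)
  calc 2 ^ bits n = 2 ^ (bits n - 1 + 1) := by congr 1; omega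
    _ ≤ 2 * n := by rw [pow_succ]; omega

/-- The gap is a quotient rounded down, so `expo k * (gap n k + 1)` exceeds the logarithm of `bits
n`; bit positions therefore fit into `posLen n k` bits. -/
theorem bits_lt (n k : ℕ) : bits n < 2 ^ posLen n k := by
  have h1 : bits n < 2 ^ (Nat.log 2 (bits n) + 1) := Nat.lt_pow_succ_log_self (by omega) _
  refine h1.trans_le (Nat.pow_le_pow_right (by omega) ?_)
  unfold posLen gap
  exact Nat.lt_mul_div_succ _ (by unfold expo; omega)

theorem two_pow_le_bits (hn : 0 < n) : 2 ^ (expo k * gap n k) ≤ bits n := by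
  have h : bits n ≠ 0 := (Nat.size_pos.2 hn).ne'
  exact (Nat.pow_le_pow_right (by omega) (Nat.mul_div_le _ _)).trans (Nat.pow_log_le_self 2 h)

/-- A clique gives a small dominating set of the new graph. -/
theorem exists_isDominatingSet (hk : 0 < k) (x : ℕ → ℕ) (hx : ∀ i < k, x i < n)
    (hE : ∀ i < k, ∀ j < k, i ≠ j → E (x i) (x j)) :
    ∃ S : Finset (Fin (order n k)), IsDominatingSet (graph n k E) S ∧ S.card ≤ slots k := by
  set L := bits n with hL
  have hxL : ∀ i < k, x i < 2 ^ L := fun i hi => (hx i hi).trans (lt_two_pow_bits n)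
  -- Slot `j` stands for the index pair `(j / k, j % k)` and receives the corresponding pair of
  -- clique vertices.
  let σ : ℕ → ℕ := fun j => x (j % k) + 2 ^ L * x (j / k)
  have hdiv : ∀ j < slots k, j / k < k := fun j hj => Nat.div_lt_of_lt_mul hj
  have hmod : ∀ j, j % k < k := fun j => Nat.mod_lt _ hk
  have hfst : ∀ j, fst n (σ j) = x (j / k) := fun j => by
    simp only [fst, σ, ← hL]
    rw [Nat.add_mul_div_left _ _ (by positivity), Nat.div_eq_of_lt (hxL _ (hmod j)), zero_add]
  have hsnd : ∀ j, snd n (σ j) = x (j % k) := fun j => by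
    simp only [snd, σ, ← hL]
    rw [Nat.add_mul_mod_self_left, Nat.mod_eq_of_lt (hxL _ (hmod j))]
  have hσ : ∀ j < slots k, σ j < 2 ^ (2 * L) := fun j hj => by
    have h1 : 2 ^ L * (x (j / k) + 1) ≤ 2 ^ L * 2 ^ L := Nat.mul_le_mul_left _ (hxL _ (hdiv j hj))
    have h2 := hxL _ (hmod j)
    rw [two_mul, pow_add]
    simp only [σ]
    rw [mul_add, mul_one] at h1
    omega
  have hdec : ∀ j s, s < 2 ^ (2 * L) → (s + 2 ^ (2 * L) * j) / 2 ^ (2 * L) = j ∧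
      (s + 2 ^ (2 * L) * j) % 2 ^ (2 * L) = s := fun j s hs => by
    rw [Nat.add_mul_div_left _ _ (by positivity), Nat.div_eq_of_lt hs, zero_add,
      Nat.add_mul_mod_self_left, Nat.mod_eq_of_lt hs]
    exact ⟨rfl, rfl⟩
  have hvalid : ∀ j < slots k, Valid n k E j (σ j) := fun j hj => by
    refine ⟨by rw [hfst]; exact hx _ (hdiv j hj), by rw [hsnd]; exact hx _ (hmod j), ?_⟩
    rw [hfst, hsnd]
    by_cases h : j / k = j % k
    · exact .inl h
    · exact .inr (hE _ (hdiv j hj) _ (hmod j) h)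
  have hord : ∀ j < slots k, σ j + 2 ^ (2 * L) * j < order n k := fun j hj => by
    have h1 := hσ j hj
    have h2 : 2 ^ (2 * L) * (j + 1) ≤ 2 ^ (2 * L) * slots k := Nat.mul_le_mul_left _ hj
    unfold order
    rw [← hL, mul_comm (slots k + 1), mul_add]
    rw [mul_add] at h2
    omega
  have hslots : 0 < slots k := Nat.mul_pos hk hk
  let f : Fin (slots k) → Fin (order n k) := fun j => ⟨σ j + 2 ^ (2 * L) * j, hord j j.2⟩
  refine ⟨Finset.univ.image f, fun v hv => ?_, Finset.card_image_le.trans (by simp)⟩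
  -- Set vertices are pairwise adjacent, so a set vertex outside the family is dominated by any
  -- member of it, here the one in slot `0`.
  by_cases hset : (v : ℕ) / 2 ^ (2 * L) < slots k
  · refine ⟨f ⟨0, hslots⟩, by simp, .inl ⟨fun h => hv ?_, ?_, hset⟩⟩
    · rw [← Fin.ext h]; simp
    · simp only [f, ← hL]
      rw [(hdec 0 _ (hσ 0 hslots)).1]
      exact hslots
  set y := (v : ℕ) % 2 ^ (2 * L) with hy
  -- At the tuple of the actual hash values all chosen sets are eligible, so it remains to meet the
  -- single constraint listed there.
  obtain ⟨a, ha, hdig⟩ := exists_digits (modLen₂ n k) (slots k) fun j => elemHash n k y (σ j)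
  have key : ∃ j < slots k, Meets n k j (σ j) (elemCon n k y a) := by
    set z := elemCon n k y a
    have hs : conSlot n k z < slots k := Nat.mod_lt _ hslots
    have hmul : ∀ i < k, i * k < slots k := fun i hi => Nat.mul_lt_mul_of_pos_right hi hk
    have hk' : ∀ i, i * k / k = i := fun i => Nat.mul_div_cancel i hk
    -- The pairs come from one family `x`, so the two bits compared by a constraint are equal: if
    -- the slot does not have the named value, neither does the canonical slot, which then meets the
    -- constraint.
    rcases Nat.mod_two_eq_zero_or_one (z / 2) with ht | ht
    · by_cases hb : x (conSlot n k z / k) / 2 ^ conPos n k z % 2 = z % 2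
      · exact ⟨_, hs, .inl ⟨ht, .inl ⟨rfl, by rwa [hfst]⟩⟩⟩
      · exact ⟨_, hmul _ (hdiv _ hs), .inl ⟨ht, .inr ⟨rfl, by rwa [hfst, hk']⟩⟩⟩
    · by_cases hb : x (conSlot n k z % k) / 2 ^ conPos n k z % 2 = z % 2
      · exact ⟨_, hs, .inr ⟨ht, .inl ⟨rfl, by rwa [hsnd]⟩⟩⟩
      · exact ⟨_, hmul _ (hmod _), .inr ⟨ht, .inr ⟨rfl, by rwa [hfst, hk']⟩⟩⟩
  obtain ⟨j, hj, hmeets⟩ := key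
  refine ⟨f ⟨j, hj⟩, by simp, .inr (.inl ⟨?_, hset, ?_⟩)⟩
  · simp only [f, ← hL]
    rw [(hdec j _ (hσ j hj)).1]
    exact hj
  · simp only [f, ← hL]
    rw [(hdec j _ (hσ j hj)).1, (hdec j _ (hσ j hj)).2]
    refine ⟨hvalid j hj, a, ha, ?_, hmeets⟩
    rw [hdig j hj]
    simp only [elemHash, hash, Nat.mod_mod]
    rfl

/-- The gap is large enough for the reduction. -/
def Large (n k : ℕ) : Prop := expo k + slots k + 10 ≤ gap n k + 1

/-- The lengths to be estimated are linear in `gap n k + 1`, with coefficients at most `gap n k +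
1`; so they are quadratic at most and lie below `2 ^ gap n k`. -/
theorem Large.mul_le (hl : Large n k) {c : ℕ} (hc : c ≤ expo k + slots k + 10) :
    c * (gap n k + 1) ≤ 2 ^ gap n k := by
  have h : ∀ g, 9 ≤ g → (g + 1) * (g + 1) ≤ 2 ^ g := by
    intro g hg
    induction g, hg using Nat.le_induction with
    | base => norm_num
    | succ g hg ih => rw [pow_succ]; nlinarith
  unfold Large at hl
  exact (Nat.mul_le_mul_right _ (hc.trans hl)).trans (h _ (by omega))

/-- The constraint table fits into `bits n` bits: there are `2 ^ (4 * gap n k * slots k)` hash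
tuples, and an entry takes at most `2 ^ gap n k` bits. This dictates `expo k = 4 * slots k + 1`. -/
theorem conLen_mul_le (hn : 0 < n) (hl : Large n k) :
    conLen n k * 2 ^ (modLen₂ n k * slots k) ≤ bits n := by
  have h1 : conLen n k ≤ 2 ^ gap n k := by
    refine le_trans ?_ (hl.mul_le (c := expo k + slots k + 2) (by omega))
    unfold conLen posLen
    nlinarith
  refine (Nat.mul_le_mul_right _ h1).trans ?_
  rw [← pow_add]
  refine le_trans (Nat.pow_le_pow_right (by omega) ?_) (two_pow_le_bits (k := k) hn)
  unfold modLen₂ expo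
  exact le_of_eq (by ring)

/-- The left side is the bound of `exists_injOn_mod` for `2 ^ gap n k` numbers with `2 * bits n`
bits. -/
theorem lt_two_pow_modLen₁ : 2 * (2 * bits n * 2 ^ (2 * gap n k) + 1) < 2 ^ modLen₁ n k := by
  have h1 : (bits n + 1) * 2 ^ (2 * gap n k) ≤ 2 ^ posLen n k * 2 ^ (2 * gap n k) :=
    Nat.mul_le_mul_right _ (bits_lt n k)
  have h2 : 0 < 2 ^ (2 * gap n k) := by positivity
  unfold modLen₁
  rw [pow_add, pow_add]
  nlinarith

/-- After the first hashing the numbers have only `modLen₁ n k ≤ 2 ^ gap n k` bits, so the second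
modulus is of order `2 ^ (3 * gap n k)`; the remaining factor `2 ^ gap n k` absorbs the constants.
-/
theorem lt_two_pow_modLen₂ (hl : Large n k) :
    2 * (modLen₁ n k * 2 ^ (2 * gap n k) + 1) < 2 ^ modLen₂ n k := by
  have h1 : modLen₁ n k ≤ 2 ^ gap n k := by
    refine le_trans ?_ (hl.mul_le (c := expo k + 2) (by omega))
    unfold modLen₁ posLen
    nlinarith
  have h2 : (2 : ℕ) ^ 2 ≤ 2 ^ gap n k :=
    Nat.pow_le_pow_right (by omega) (by unfold Large at hl; omega)
  have h3 : 2 ^ modLen₂ n k = 2 ^ gap n k * 2 ^ gap n k * 2 ^ (2 * gap n k) := by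
    unfold modLen₂
    ring
  have h4 : (2 : ℕ) ^ (2 * gap n k) = 2 ^ gap n k * 2 ^ gap n k := by ring
  rw [h3, h4]
  set x := 2 ^ gap n k
  have h5 : modLen₁ n k * (x * x) ≤ x * (x * x) := Nat.mul_le_mul_right _ h1
  have h6 : 4 * (x * (x * x)) ≤ x * (x * (x * x)) := Nat.mul_le_mul_right _ h2
  have h7 : 1 ≤ x * (x * x) := Nat.one_le_iff_ne_zero.2 (by positivity)
  calc 2 * (modLen₁ n k * (x * x) + 1) ≤ 2 * (x * (x * x)) + 2 := by omega
    _ < x * (x * (x * x)) := by nlinarith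
    _ = x * x * (x * x) := by ring

/-- An element has `2 * bits n` bits. The half not used by the table holds both moduli and a copy
number of `gap n k + 1` bits. -/
theorem modLen_add_le (hn : 0 < n) (hl : Large n k) :
    modLen₁ n k + modLen₂ n k + (gap n k + 1) ≤ bits n := by
  refine le_trans ?_ (two_pow_le_bits (k := k) hn)
  refine le_trans ?_ (Nat.pow_le_pow_right (by omega)
    (Nat.le_mul_of_pos_left (gap n k) (by unfold expo; omega : 0 < expo k)))
  refine le_trans ?_ (hl.mul_le (c := expo k + 7) (by omega))
  unfold modLen₁ modLen₂ posLen
  nlinarith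

/-- From the lowest bit upwards, a constraint consists of the value `β`, the side `t`, the position
`b` and the slot `s`. -/
theorem exists_con {s t b β : ℕ} (hs : s < slots k) (ht : t < 2) (hβ : β < 2)
    (hb : b < 2 ^ posLen n k) : ∃ z < 2 ^ conLen n k,
      z % 2 = β ∧ z / 2 % 2 = t ∧ conPos n k z = b ∧ conSlot n k z = s := by
  have h1 : 2 * t + β < 4 := by omega
  have h2 : 4 * b + (2 * t + β) < 2 ^ (2 + posLen n k) := by rw [pow_add]; omega
  refine ⟨4 * b + (2 * t + β) + 2 ^ (2 + posLen n k) * s, ?_, ?_, ?_, ?_, ?_⟩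
  · have h3 : s + 1 ≤ 2 ^ slots k := hs.trans Nat.lt_two_pow_self
    have h4 : 2 ^ (2 + posLen n k) * (s + 1) ≤ 2 ^ (2 + posLen n k) * 2 ^ slots k :=
      Nat.mul_le_mul_left _ h3
    rw [mul_add, mul_one] at h4
    unfold conLen
    rw [pow_add _ (2 + posLen n k)]
    omega
  · rw [pow_add, mul_assoc]
    omega
  · rw [pow_add, mul_assoc]
    omega
  · have : (4 * b + (2 * t + β) + 2 ^ (2 + posLen n k) * s) / 4 = b + 2 ^ posLen n k * s := by
      rw [pow_add, mul_assoc]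
      omega
    rw [conPos, this, Nat.add_mul_mod_self_left, Nat.mod_eq_of_lt hb]
  · rw [conSlot, Nat.add_mul_div_left _ _ (by positivity), Nat.div_eq_of_lt h2, zero_add,
      Nat.mod_eq_of_lt hs]

/-- A set that meets every constraint by elements with a given tuple of hash values contains a
clique. -/
theorem exists_clique_of_meets (X : ℕ → ℕ → Prop)
    (hX : ∀ j σ, X j σ → σ < 2 ^ (2 * bits n) ∧ Valid n k E j σ)
    (huniq : ∀ j σ σ', X j σ → X j σ' → σ = σ')
    (hmeets : ∀ z < 2 ^ conLen n k, ∃ j σ, X j σ ∧ Meets n k j σ z) :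
    ∃ x : ℕ → ℕ, (∀ i < k, x i < n) ∧ ∀ i < k, ∀ j < k, i ≠ j → E (x i) (x j) := by
  -- If slot `s` were empty, the constraints at position `0` with values `0` and `1` would both be
  -- left to the canonical slot, whose unique pair would need a bit different from both.
  have hmem : ∀ s < slots k, ∃ σ, X s σ := by
    intro s hs
    by_contra! hno
    obtain ⟨z₀, hz₀, h1, h2, h3, h4⟩ := exists_con (n := n) (k := k) (t := 0) (β := 0) hs
      (by omega) (by omega) (b := 0) (by positivity)
    obtain ⟨z₁, hz₁, h5, h6, h7, h8⟩ := exists_con (n := n) (k := k) (t := 0) (β := 1) hs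
      (by omega) (by omega) (b := 0) (by positivity)
    obtain ⟨j, σ, hσ, hm⟩ := hmeets z₀ hz₀
    obtain ⟨j', σ', hσ', hm'⟩ := hmeets z₁ hz₁
    simp only [Meets, h1, h2, h3, h4, h5, h6, h7, h8] at hm hm'
    have h9 : ∀ σ, ¬ X s σ := hno
    have e1 : j ≠ s := fun h => h9 σ (h ▸ hσ)
    have e2 : j' ≠ s := fun h => h9 σ' (h ▸ hσ')
    simp [e1] at hm
    simp [e2] at hm'
    obtain ⟨rfl, hm⟩ := hm
    obtain ⟨rfl, hm'⟩ := hm'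
    rw [huniq _ _ _ hσ hσ'] at hm
    omega
  choose! σ hσ using hmem
  have hfst : ∀ s < slots k, fst n (σ s) < 2 ^ bits n := fun s hs =>
    (hX _ _ (hσ s hs)).2.1.trans (lt_two_pow_bits n)
  have hsnd : ∀ s < slots k, snd n (σ s) < 2 ^ bits n := fun s hs =>
    (hX _ _ (hσ s hs)).2.2.1.trans (lt_two_pow_bits n)
  have key : ∀ t < 2, ∀ s < slots k, (if t = 0 then s / k else s % k) * k < slots k →
      (if t = 0 then fst n (σ s) else snd n (σ s)) =
        fst n (σ ((if t = 0 then s / k else s % k) * k)) := by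
    intro t ht s hs hτ
    refine eq_of_bits_eq (L := bits n) (by split_ifs; exacts [hfst s hs, hsnd s hs])
      (hfst _ hτ) fun b hb => ?_
    set u := if t = 0 then fst n (σ s) else snd n (σ s) with hu
    set τ := (if t = 0 then s / k else s % k) * k with hτ'
    -- The constraint names the opposite of the bit of slot `s`. That slot cannot meet it, so the
    -- canonical slot does, which forces its bit to agree with that of slot `s`.
    obtain ⟨z, hz, h1, h2, h3, h4⟩ := exists_con (n := n) (k := k) (t := t)
      (β := 1 - u / 2 ^ b % 2) hs ht (by omega) (b := b) (hb.trans (bits_lt n k))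
    obtain ⟨j, σ', hσ', hm⟩ := hmeets z hz
    simp only [Meets, h1, h2, h3, h4] at hm
    have hb2 := Nat.mod_two_eq_zero_or_one (u / 2 ^ b)
    have hτσ : j = τ → fst n σ' / 2 ^ b % 2 = fst n (σ τ) / 2 ^ b % 2 := by
      rintro rfl
      rw [huniq _ _ _ hσ' (hσ _ hτ)]
    have hsσ : j = s → σ' = σ s := by
      rintro rfl
      exact huniq _ _ _ hσ' (hσ _ hs)
    rcases hm with ⟨rfl, hm⟩ | ⟨rfl, hm⟩
    · simp only [if_true] at hu hτ'
      rw [← hτ'] at hm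
      rcases hm with ⟨hj, hm⟩ | ⟨hj, hm⟩
      · rw [hsσ hj, ← hu] at hm
        omega
      · rw [hτσ hj] at hm
        omega
    · simp only [one_ne_zero, if_false] at hu hτ'
      rw [← hτ'] at hm
      rcases hm with ⟨hj, hm⟩ | ⟨hj, hm⟩
      · rw [hsσ hj, ← hu] at hm
        omega
      · rw [hτσ hj] at hm
        omega
  have hmul : ∀ i < k, i * k < slots k := fun i hi => Nat.mul_lt_mul_of_pos_right hi (by omega)
  -- Vertex `i` is read off the canonical slot `(i, 0)`. Its edge to vertex `j` comes from the
  -- validity of the pair in slot `(i, j)`, with number `j + k * i`.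
  refine ⟨fun i => fst n (σ (i * k)), fun i hi => (hX _ _ (hσ _ (hmul i hi))).2.1,
    fun i hi j hj hij => ?_⟩
  have hs : j + k * i < slots k := by
    have : k * (i + 1) ≤ k * k := Nat.mul_le_mul_left _ hi
    rw [mul_add] at this
    unfold slots
    omega
  have hd : (j + k * i) / k = i := by
    rw [Nat.add_mul_div_left _ _ (by omega), Nat.div_eq_of_lt hj, zero_add]
  have hm : (j + k * i) % k = j := by
    rw [Nat.add_mul_mod_self_left, Nat.mod_eq_of_lt hj]
  have h0 := key 0 (by omega) _ hs (by simpa [hd] using hmul i hi)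
  have h1 := key 1 (by omega) _ hs (by simpa [hm] using hmul j hj)
  simp only [if_true, hd] at h0
  simp only [one_ne_zero, if_false, hm] at h1
  have hv := (hX _ _ (hσ _ hs)).2.2.2
  rw [hd, hm, h0, h1] at hv
  exact hv.resolve_left hij

/-- A small dominating set of the new graph gives a clique. -/
theorem exists_clique (hn : 0 < n) (hl : Large n k) (S : Finset (Fin (order n k)))
    (hS : IsDominatingSet (graph n k E) S) (hcard : S.card ≤ 2 ^ gap n k) :
    ∃ x : ℕ → ℕ, (∀ i < k, x i < n) ∧ ∀ i < k, ∀ j < k, i ≠ j → E (x i) (x j) := by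
  have hg : 9 ≤ gap n k := by unfold Large at hl; omega
  set g := gap n k with hgdef
  set L := bits n with hL
  set K := slots k with hK
  set l := posLen n k with hl_def
  set w := conLen n k with hw
  set r₁ := modLen₁ n k with hr₁
  set r₂ := modLen₂ n k with hr₂
  obtain ⟨hLl, hw2, hM₁, hM₂, hlen⟩ :
      bits n < 2 ^ l ∧ w * 2 ^ (r₂ * K) ≤ L ∧ 2 * (2 * L * 2 ^ (2 * g) + 1) < 2 ^ r₁ ∧
        2 * (r₁ * 2 ^ (2 * g) + 1) < 2 ^ r₂ ∧ L + r₁ + r₂ + (g + 1) ≤ 2 * L :=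
    ⟨bits_lt n k, by rw [hw, hr₂]; exact conLen_mul_le hn hl, by
      rw [hr₁]; exact lt_two_pow_modLen₁, by rw [hr₂]; exact lt_two_pow_modLen₂ hl, by
      have := modLen_add_le hn hl
      omega⟩
  -- Element vertices in `S` contribute to `V` as well, which is harmless since only the cardinality
  -- matters.
  set V : Finset ℕ := S.image fun v : Fin (order n k) => (v : ℕ) % 2 ^ (2 * L) with hV
  have hVcard : V.card ^ 2 ≤ 2 ^ (2 * g) := by
    rw [mul_comm, pow_mul]
    exact Nat.pow_le_pow_left (Finset.card_image_le.trans hcard) 2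
  obtain ⟨p₁, hp₁, hp₁', hinj₁⟩ := exists_injOn_mod V (B := 2 * L) (M := 2 * L * 2 ^ (2 * g) + 1)
    (fun x hx => by
      obtain ⟨v, -, rfl⟩ := Finset.mem_image.1 hx
      exact Nat.mod_lt _ (by positivity)) (Nat.lt_succ_of_le (Nat.mul_le_mul_left _ hVcard))
  have hp₁r : p₁ < 2 ^ r₁ := by omega
  obtain ⟨p₂, hp₂, hp₂', hinj₂⟩ := exists_injOn_mod (V.image fun x => x % p₁) (B := r₁)
    (M := r₁ * 2 ^ (2 * g) + 1)
    (fun x hx => by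
      obtain ⟨v, -, rfl⟩ := Finset.mem_image.1 hx
      exact (Nat.mod_lt _ hp₁).trans hp₁r) (Nat.lt_succ_of_le (Nat.mul_le_mul_left _
        ((Nat.pow_le_pow_left Finset.card_image_le 2).trans hVcard)))
  have hp₂r : p₂ < 2 ^ r₂ := by omega
  have hinj : ∀ σ ∈ V, ∀ σ' ∈ V, hash n k p₁ p₂ σ = hash n k p₁ p₂ σ' → σ = σ' := by
    intro σ hσ σ' hσ' h
    unfold hash at h
    rw [← hr₂, Nat.mod_eq_of_lt ((Nat.mod_lt _ hp₂).trans hp₂r),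
      Nat.mod_eq_of_lt ((Nat.mod_lt _ hp₂).trans hp₂r)] at h
    exact hinj₁ hσ hσ' (hinj₂ (by simpa using ⟨σ, hσ, rfl⟩) (by simpa using ⟨σ', hσ', rfl⟩) h)
  by_contra hno
  -- Otherwise the sets of `S` whose hash values are prescribed by `a` would meet all constraints.
  -- Injectivity of the hash leaves at most one pair per slot, so there would be a clique.
  have hZ : ∀ a, ∃ z < 2 ^ w, ∀ v ∈ S, Valid n k E ((v : ℕ) / 2 ^ (2 * L)) (v % 2 ^ (2 * L)) →
      a / 2 ^ (r₂ * (v / 2 ^ (2 * L))) % 2 ^ r₂ = hash n k p₁ p₂ (v % 2 ^ (2 * L)) →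
        ¬ Meets n k (v / 2 ^ (2 * L)) (v % 2 ^ (2 * L)) z := by
    intro a
    by_contra! hcon
    refine hno (exists_clique_of_meets (fun j σ => ∃ v ∈ S, (v : ℕ) / 2 ^ (2 * L) = j ∧
      (v : ℕ) % 2 ^ (2 * L) = σ ∧ Valid n k E j σ ∧
        a / 2 ^ (r₂ * j) % 2 ^ r₂ = hash n k p₁ p₂ σ) ?_ ?_ ?_)
    · rintro j σ ⟨v, -, -, rfl, h, -⟩
      exact ⟨Nat.mod_lt _ (by positivity), h⟩
    · rintro j σ σ' ⟨v, hv, -, rfl, -, h⟩ ⟨v', hv', -, rfl, -, h'⟩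
      exact hinj _ (Finset.mem_image_of_mem _ hv) _ (Finset.mem_image_of_mem _ hv') (h.symm.trans h')
    · intro z hz
      obtain ⟨v, hv, h1, h2, h3⟩ := hcon z hz
      exact ⟨_, _, ⟨v, hv, rfl, rfl, h1, h2⟩, h3⟩
  choose Z hZ hZS using hZ
  obtain ⟨x, hx, hdig⟩ := exists_digits w (2 ^ (r₂ * K)) Z
  replace hx : x < 2 ^ L := hx.trans_le (Nat.pow_le_pow_right (by omega) hw2)
  -- The adversarial element: the table of unmet constraints, the two moduli that are good for `S`,
  -- and the copy number `c`.
  let y : ℕ → ℕ := fun c => x + 2 ^ L * (p₁ + 2 ^ r₁ * (p₂ + 2 ^ r₂ * c))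
  have hylt : ∀ c < 2 ^ (g + 1), y c < 2 ^ (2 * L) := by
    intro c hc
    refine lt_of_lt_of_le ?_ (Nat.pow_le_pow_right (by omega) hlen)
    have step : ∀ a b u v, u < 2 ^ a → v < 2 ^ b → u + 2 ^ a * v < 2 ^ (a + b) := by
      intro a b u v hu hv
      have : 2 ^ a * (v + 1) ≤ 2 ^ a * 2 ^ b := Nat.mul_le_mul_left _ hv
      rw [mul_add, mul_one] at this
      rw [pow_add]
      omega
    rw [add_assoc, add_assoc]
    exact step _ _ _ _ hx (step _ _ _ _ hp₁r (step _ _ _ _ hp₂r hc))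
  have hp : 2 ^ g < 2 ^ (g + 1) := Nat.pow_lt_pow_right (by omega) (by omega)
  -- One copy more than `S` can contain. Elements occupy the last block, with number `K`.
  let e : Fin (2 ^ g + 1) → Fin (order n k) := fun c => ⟨y c + 2 ^ (2 * L) * K, by
    have := hylt c (by omega)
    unfold order
    rw [← hL, ← hK, add_mul, one_mul, mul_comm K]
    omega⟩
  have he : Function.Injective e := by
    intro c c' h
    have h1 : y c + 2 ^ (2 * L) * K = y c' + 2 ^ (2 * L) * K := congrArg Fin.val h
    have h2 : y c = y c' := by omega
    have h3 := Nat.eq_of_mul_eq_mul_left (by positivity) (Nat.add_left_cancel h2)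
    have h4 := Nat.eq_of_mul_eq_mul_left (by positivity) (Nat.add_left_cancel h3)
    have h5 := Nat.eq_of_mul_eq_mul_left (by positivity) (Nat.add_left_cancel h4)
    exact Fin.ext h5
  obtain ⟨c, hc⟩ : ∃ c, e c ∉ S := by
    by_contra! hall
    have h1 : (Finset.univ.image e).card ≤ S.card := Finset.card_le_card fun v hv => by
      obtain ⟨c, -, rfl⟩ := Finset.mem_image.1 hv
      exact hall c
    rw [Finset.card_image_of_injective _ he, Finset.card_univ, Fintype.card_fin] at h1
    omega
  obtain ⟨v, hv, hadj⟩ := hS _ hc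
  have hyc : y c < 2 ^ (2 * L) := hylt c (by omega)
  have hdiv : (e c : ℕ) / 2 ^ (2 * L) = K := by
    simp only [e]
    rw [Nat.add_mul_div_left _ _ (by positivity), Nat.div_eq_of_lt hyc, zero_add]
  have hmod : (e c : ℕ) % 2 ^ (2 * L) = y c := by
    simp only [e]
    rw [Nat.add_mul_mod_self_left, Nat.mod_eq_of_lt hyc]
  -- An element is adjacent only to the sets that contain it.
  have hcov : Contain n k E v (e c) := by
    rcases hadj with h | h | h
    · exact absurd h.2.2 (by rw [← hL, hdiv]; exact lt_irrefl _)
    · exact h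
    · exact absurd h.1 (by rw [← hL, hdiv]; exact lt_irrefl _)
  obtain ⟨-, -, hval, a, ha, hhash, hmeets⟩ := hcov
  rw [← hL] at hval hhash hmeets
  have hyd : ∀ a b u v, u < 2 ^ a → (u + 2 ^ a * v) / 2 ^ (a + b) = v / 2 ^ b := by
    intro a b u v hu
    rw [pow_add, ← Nat.div_div_eq_div_mul, Nat.add_mul_div_left _ _ (by positivity),
      Nat.div_eq_of_lt hu, zero_add]
  have hyd' : ∀ a u v, u < 2 ^ a → (u + 2 ^ a * v) / 2 ^ a = v := by
    intro a u v hu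
    simpa using hyd a 0 u v hu
  have hym : ∀ a u v, u < 2 ^ a → (u + 2 ^ a * v) % 2 ^ a = u := by
    intro a u v hu
    rw [Nat.add_mul_mod_self_left, Nat.mod_eq_of_lt hu]
  refine hZS a v hv hval ?_ ?_
  · rw [hhash, hmod, elemHash, ← hL, ← hr₁, ← hr₂, hyd' _ _ _ hx, hym _ _ _ hp₁r, hyd _ _ _ _ hx,
      hyd' _ _ _ hp₁r, hym _ _ _ hp₂r]
  · rw [hmod, elemCon, ← hL, ← hw, hym _ _ _ hx, hdig a ha, Nat.mod_eq_of_lt (hZ a)] at hmeets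
    exact hmeets

end Gap

/-! ### The reduction runs in polynomial time -/

namespace World

/-- The adjacency relation of the given graph. -/
def edge (W : World) (u v : ℕ) : Prop := ∃ (hu : u < W.n) (hv : v < W.n), W.G.Adj ⟨u, hu⟩ ⟨v, hv⟩

/-- The memory contains the instance, in the cells below `N`. -/
structure Good (W : World) : Prop where
  sq_le : W.n * W.n + 2 ≤ W.N
  k_le : W.k ≤ W.N
  mem : ∀ a < W.N, W.mem a = (graphInput W.n W.k W.G).mem a

/-- The bound `N` and the gap are large enough for the reduction. -/
structure Reducible (W : World) : Prop extends Good W where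
  n_pos : 0 < W.n
  k_pos : 0 < W.k
  large : Gap.Large W.n W.k
  order_le : Gap.order W.n W.k * Gap.order W.n W.k + 2 ≤ W.N

end World

theorem graphInput_mem_iff {n k : ℕ} (G : SimpleGraph (Fin n)) (u v : Fin n) :
    (graphInput n k G).mem (u * n + v + 2) = 1 ↔ G.Adj u v := by
  simp only [graphInput]
  constructor
  · intro h
    split_ifs at h with h'
    · obtain ⟨u', v', h1, h2⟩ := h'
      have hn : 0 < n := u.pos
      have e1 : (u : ℕ) = u' := by
        have := congrArg (· / n) h1
        simpa [Nat.add_div_of_dvd_right, Nat.mul_div_cancel _ hn, Nat.div_eq_of_lt v.2,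
          Nat.div_eq_of_lt v'.2] using this
      have e2 : (v : ℕ) = v' := by rw [e1] at h1; omega
      rwa [Fin.ext e1, Fin.ext e2]
  · exact fun h => if_pos ⟨u, v, rfl, h⟩

namespace World.Good

variable {W : World}

theorem n_le (h : W.Good) : W.n ≤ W.N := by nlinarith [h.sq_le]

theorem edge_iff (h : W.Good) (u v : ℕ) :
    W.edge u v ↔ u < W.n ∧ v < W.n ∧ W.mem (u * W.n + v + 2) = 1 := by
  constructor
  · rintro ⟨hu, hv, h'⟩
    refine ⟨hu, hv, ?_⟩
    rw [h.mem _ (by nlinarith [h.sq_le])]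
    exact (graphInput_mem_iff W.G ⟨u, hu⟩ ⟨v, hv⟩).2 h'
  · rintro ⟨hu, hv, h'⟩
    rw [h.mem _ (by nlinarith [h.sq_le])] at h'
    exact ⟨hu, hv, (graphInput_mem_iff W.G ⟨u, hu⟩ ⟨v, hv⟩).1 h'⟩

end World.Good

theorem polyTimePred_edge {Γ : Type} [Ctx Γ] {A : World → Prop} (hA : ∀ W, A W → W.Good)
    {u v : Γ → ℕ} (hu : PolyTime A u) (hv : PolyTime A v) :
    PolyTimePred A fun γ => (wd γ).edge (u γ) (v γ) :=
  ((PolyTimePred.lt hu .worldn).and ((PolyTimePred.lt hv .worldn).and (PolyTimePred.eq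
    (((hu.mul .worldn fun _ h => (hA _ h).n_le).add hv).add (.const 2)).load (.const 1)))).congr
    fun _ h => ((hA _ h).edge_iff _ _).symm

/-! ### Whatever the reduction counts up to is at most `N` -/

namespace World.Reducible

open Gap

variable {W : World}

theorem order_le_N (h : W.Reducible) : order W.n W.k ≤ W.N := by nlinarith [h.order_le]

theorem slots_pos (h : W.Reducible) : 0 < slots W.k := Nat.mul_pos h.k_pos h.k_pos

theorem two_pow_le (h : W.Reducible) : 2 ^ (2 * bits W.n) ≤ W.N :=
  (Nat.le_mul_of_pos_left _ (Nat.succ_pos _)).trans h.order_le_N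

theorem slots_le (h : W.Reducible) : slots W.k + 1 ≤ W.N :=
  (Nat.le_mul_of_pos_right _ (by positivity)).trans h.order_le_N

theorem bits_le (h : W.Reducible) : 2 * bits W.n ≤ W.N :=
  Nat.lt_two_pow_self.le.trans h.two_pow_le

theorem modLen_le (h : W.Reducible) : bits W.n + modLen₁ W.n W.k + modLen₂ W.n W.k ≤ W.N := by
  have := modLen_add_le h.n_pos h.large
  have := h.bits_le
  omega

theorem conLen_le (h : W.Reducible) : conLen W.n W.k ≤ W.N := by
  have h1 := conLen_mul_le h.n_pos h.large
  have h2 : conLen W.n W.k ≤ conLen W.n W.k * 2 ^ (modLen₂ W.n W.k * slots W.k) :=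
    Nat.le_mul_of_pos_right _ (by positivity)
  have := h.bits_le
  omega

theorem posLen_le (h : W.Reducible) : 2 + posLen W.n W.k ≤ W.N := by
  have := h.conLen_le
  unfold conLen at this
  omega

theorem expo_le (h : W.Reducible) : expo W.k ≤ W.N := by
  have h1 := h.posLen_le
  have h2 : expo W.k ≤ posLen W.n W.k := Nat.le_mul_of_pos_right _ (Nat.succ_pos _)
  omega

theorem gap_le (h : W.Reducible) : gap W.n W.k + 1 ≤ W.N := by
  have h1 := h.posLen_le
  have h2 : gap W.n W.k + 1 ≤ posLen W.n W.k := Nat.le_mul_of_pos_left _ (Nat.succ_pos _)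
  omega

theorem two_pow_modLen_le (h : W.Reducible) : 2 ^ (modLen₂ W.n W.k * slots W.k) ≤ W.N := by
  have h1 := conLen_mul_le h.n_pos h.large
  have h2 : 2 ^ (modLen₂ W.n W.k * slots W.k) ≤
      conLen W.n W.k * 2 ^ (modLen₂ W.n W.k * slots W.k) :=
    Nat.le_mul_of_pos_left _ (by unfold conLen; omega)
  have := h.bits_le
  omega

end World.Reducible

namespace Gap

open World.Reducible

variable {Γ : Type} [Ctx Γ] {j σ z y a u v : Γ → ℕ}

local notation "PT" => PolyTime World.Reducible
local notation "PTP" => PolyTimePred World.Reducible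

theorem polyTime_bits : PT fun γ : Γ => bits (wd γ).n :=
  PolyTime.size .worldn fun _ h => h.n_le

theorem polyTime_slots : PT fun γ : Γ => slots (wd γ).k :=
  .mul .worldk .worldk fun _ h => h.k_le

theorem polyTime_expo : PT fun γ : Γ => expo (wd γ).k :=
  .add (.mul (.const 4) polyTime_slots fun _ h => Nat.le_of_succ_le h.slots_le) (.const 1)

theorem polyTime_gap : PT fun γ : Γ => gap (wd γ).n (wd γ).k :=
  .div (.log_two polyTime_bits fun _ h => by have := h.bits_le; omega) polyTime_expo
    (fun γ h => by
      have := h.bits_le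
      have := Nat.log_le_self 2 (bits (wd γ).n)
      omega) (fun _ h => h.expo_le) fun _ _ => Nat.succ_pos _

theorem polyTime_posLen : PT fun γ : Γ => posLen (wd γ).n (wd γ).k :=
  .mul polyTime_expo (polyTime_gap.add (.const 1)) fun _ h => h.gap_le

theorem polyTime_conLen : PT fun γ : Γ => conLen (wd γ).n (wd γ).k :=
  ((PolyTime.const 2).add polyTime_posLen).add polyTime_slots

theorem polyTime_modLen₁ : PT fun γ : Γ => modLen₁ (wd γ).n (wd γ).k :=
  (polyTime_posLen.add ((PolyTime.const 2).mul polyTime_gap fun _ h =>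
    Nat.le_of_succ_le h.gap_le)).add (.const 2)

theorem polyTime_modLen₂ : PT fun γ : Γ => modLen₂ (wd γ).n (wd γ).k :=
  (PolyTime.const 4).mul polyTime_gap fun _ h => Nat.le_of_succ_le h.gap_le

theorem polyTime_two_mul_bits : PT fun γ : Γ => 2 * bits (wd γ).n :=
  (PolyTime.const 2).mul polyTime_bits fun _ h => by have := h.bits_le; omega

theorem polyTime_order : PT fun γ : Γ => order (wd γ).n (wd γ).k :=
  .mul_two_pow (polyTime_slots.add (.const 1)) polyTime_two_mul_bits fun _ h => h.bits_le

theorem polyTime_fst (hσ : PT σ) : PT fun γ => fst (wd γ).n (σ γ) :=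
  hσ.div_two_pow polyTime_bits fun _ h => by have := h.bits_le; omega

theorem polyTime_snd (hσ : PT σ) : PT fun γ => snd (wd γ).n (σ γ) :=
  hσ.mod_two_pow polyTime_bits fun _ h => by have := h.bits_le; omega

theorem polyTime_div_k (hj : PT j) (hjN : ∀ γ, (wd γ).Reducible → j γ ≤ (wd γ).N) :
    PT fun γ => j γ / (wd γ).k :=
  hj.div .worldk hjN (fun _ h => h.k_le) fun _ h => h.k_pos

theorem polyTime_mod_k (hj : PT j) (hjN : ∀ γ, (wd γ).Reducible → j γ ≤ (wd γ).N) :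
    PT fun γ => j γ % (wd γ).k :=
  hj.mod .worldk hjN

theorem polyTimePred_valid (hj : PT j) (hjN : ∀ γ, (wd γ).Reducible → j γ ≤ (wd γ).N)
    (hσ : PT σ) : PTP fun γ => Valid (wd γ).n (wd γ).k (wd γ).edge (j γ) (σ γ) :=
  (PolyTimePred.lt (polyTime_fst hσ) .worldn).and <| (PolyTimePred.lt (polyTime_snd hσ) .worldn).and
    <| (PolyTimePred.eq (polyTime_div_k hj hjN) (polyTime_mod_k hj hjN)).or <|
      polyTimePred_edge (fun _ h => h.toGood) (polyTime_fst hσ) (polyTime_snd hσ)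

theorem polyTime_conSlot (hz : PT z) (hzN : ∀ γ, (wd γ).Reducible → z γ ≤ (wd γ).N) :
    PT fun γ => conSlot (wd γ).n (wd γ).k (z γ) :=
  (hz.div_two_pow ((PolyTime.const 2).add polyTime_posLen) fun _ h => h.posLen_le).mod
    polyTime_slots fun γ h => (Nat.div_le_self _ _).trans (hzN γ h)

theorem polyTime_conPos (hz : PT z) : PT fun γ => conPos (wd γ).n (wd γ).k (z γ) :=
  (hz.half.half.congr (g := fun γ => z γ / 4) fun _ _ => by omega).mod_two_pow polyTime_posLen
    fun _ h => by have := h.posLen_le; omega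

theorem conSlot_le {W : World} (h : W.Reducible) (z : ℕ) : conSlot W.n W.k z ≤ W.N :=
  (Nat.mod_lt _ h.slots_pos).le.trans (by have := h.slots_le; omega)

theorem polyTimePred_meets (hj : PT j) (hσ : PT σ)
    (hσN : ∀ γ, (wd γ).Reducible → σ γ ≤ (wd γ).N) (hz : PT z)
    (hzN : ∀ γ, (wd γ).Reducible → z γ ≤ (wd γ).N) :
    PTP fun γ => Meets (wd γ).n (wd γ).k (j γ) (σ γ) (z γ) := by
  have hslot := polyTime_conSlot hz hzN
  have hk : ∀ γ : Γ, (wd γ).Reducible → (wd γ).k ≤ (wd γ).N := fun _ h => h.k_le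
  have hfst : PTP fun γ =>
      fst (wd γ).n (σ γ) / 2 ^ conPos (wd γ).n (wd γ).k (z γ) % 2 = z γ % 2 :=
    .eq ((polyTime_fst hσ).div_two_pow_of_le (polyTime_conPos hz) fun γ h =>
      (Nat.div_le_self _ _).trans (hσN γ h)).mod_two hz.mod_two
  have hsnd : PTP fun γ =>
      snd (wd γ).n (σ γ) / 2 ^ conPos (wd γ).n (wd γ).k (z γ) % 2 = z γ % 2 :=
    .eq ((polyTime_snd hσ).div_two_pow_of_le (polyTime_conPos hz) fun γ h =>
      (Nat.mod_le _ _).trans (hσN γ h)).mod_two hz.mod_two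
  refine ((PolyTimePred.eq hz.half.mod_two (.const 0)).and
    (((PolyTimePred.eq hj hslot).and hfst).or ((PolyTimePred.eq hj ?_).and hfst.not))).or
    ((PolyTimePred.eq hz.half.mod_two (.const 1)).and
    (((PolyTimePred.eq hj hslot).and hsnd).or ((PolyTimePred.eq hj ?_).and hfst.not)))
  · exact (polyTime_div_k hslot fun γ h => conSlot_le h _).mul .worldk hk
  · exact (polyTime_mod_k hslot fun γ h => conSlot_le h _).mul .worldk hk

theorem polyTime_elemHash (hy : PT y) (hσ : PT σ)
    (hσN : ∀ γ, (wd γ).Reducible → σ γ ≤ (wd γ).N) :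
    PT fun γ => elemHash (wd γ).n (wd γ).k (y γ) (σ γ) := by
  have h1 : PT fun γ => y γ / 2 ^ bits (wd γ).n % 2 ^ modLen₁ (wd γ).n (wd γ).k :=
    (hy.div_two_pow polyTime_bits fun _ h => by have := h.bits_le; omega).mod_two_pow
      polyTime_modLen₁ fun _ h => by have := h.modLen_le; omega
  have h2 : PT fun γ => y γ / 2 ^ (bits (wd γ).n + modLen₁ (wd γ).n (wd γ).k) %
      2 ^ modLen₂ (wd γ).n (wd γ).k :=
    (hy.div_two_pow (polyTime_bits.add polyTime_modLen₁) fun _ h => by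
      have := h.modLen_le; omega).mod_two_pow
      polyTime_modLen₂ fun _ h => by have := h.modLen_le; omega
  exact ((hσ.mod h1 hσN).mod h2 fun γ h => (Nat.mod_le _ _).trans (hσN γ h)).mod_two_pow
    polyTime_modLen₂ fun _ h => by have := h.modLen_le; omega

theorem polyTime_elemCon (hy : PT y) (hyN : ∀ γ, (wd γ).Reducible → y γ ≤ (wd γ).N)
    (ha : PT a) : PT fun γ => elemCon (wd γ).n (wd γ).k (y γ) (a γ) :=
  ((hy.mod_two_pow polyTime_bits fun _ h => by have := h.bits_le; omega).div_two_pow_of_le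
    ((ha.mul polyTime_conLen fun _ h => h.conLen_le).congr fun _ _ => mul_comm _ _)
    fun γ h => (Nat.mod_le _ _).trans (hyN γ h)).mod_two_pow polyTime_conLen
    fun _ h => h.conLen_le

theorem elemCon_le (n k y a : ℕ) : elemCon n k y a ≤ y :=
  (Nat.mod_le _ _).trans ((Nat.div_le_self _ _).trans (Nat.mod_le _ _))

theorem polyTimePred_covers (hj : PT j) (hjN : ∀ γ, (wd γ).Reducible → j γ ≤ (wd γ).N)
    (hσ : PT σ) (hσN : ∀ γ, (wd γ).Reducible → σ γ ≤ (wd γ).N)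
    (hy : PT y) (hyN : ∀ γ, (wd γ).Reducible → y γ ≤ (wd γ).N) :
    PTP fun γ => Covers (wd γ).n (wd γ).k (wd γ).edge (j γ) (σ γ) (y γ) := by
  have hb : PT fun γ : Γ => 2 ^ (modLen₂ (wd γ).n (wd γ).k * slots (wd γ).k) :=
    .two_pow (polyTime_modLen₂.mul polyTime_slots fun _ h => by have := h.slots_le; omega)
      fun _ h => Nat.lt_two_pow_self.le.trans h.two_pow_modLen_le
  refine (polyTimePred_valid hj hjN hσ).and (.exists_lt hb (fun _ h => h.two_pow_modLen_le) ?_)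
  have ha := PolyTime.min PolyTime.snd hb.weaken
  refine (PolyTimePred.eq (((ha.div_two_pow_of_le ?_ ?_).mod_two_pow polyTime_modLen₂ ?_))
    (polyTime_elemHash hy.weaken hσ.weaken fun γ h => hσN γ.1 h)).and
    (polyTimePred_meets hj.weaken hσ.weaken (fun γ h => hσN γ.1 h)
      (polyTime_elemCon hy.weaken (fun γ h => hyN γ.1 h) ha) fun γ h =>
        (elemCon_le _ _ _ _).trans (hyN γ.1 h))
  · exact polyTime_modLen₂.mul hj.weaken fun γ h => hjN γ.1 h
  · exact fun _ h => (min_le_right _ _).trans h.two_pow_modLen_le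
  · exact fun _ h => by have := h.modLen_le; omega

theorem polyTimePred_contain (hu : PT u) (huN : ∀ γ, (wd γ).Reducible → u γ ≤ (wd γ).N)
    (hv : PT v) (hvN : ∀ γ, (wd γ).Reducible → v γ ≤ (wd γ).N) :
    PTP fun γ => Contain (wd γ).n (wd γ).k (wd γ).edge (u γ) (v γ) := by
  have hdu := hu.div_two_pow polyTime_two_mul_bits fun _ h => h.bits_le
  have hdv := hv.div_two_pow polyTime_two_mul_bits fun _ h => h.bits_le
  have hmu := hu.mod_two_pow polyTime_two_mul_bits fun _ h => h.bits_le
  have hmv := hv.mod_two_pow polyTime_two_mul_bits fun _ h => h.bits_le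
  exact (PolyTimePred.lt hdu polyTime_slots).and <| (PolyTimePred.lt hdv polyTime_slots).not.and <|
    polyTimePred_covers hdu (fun γ h => (Nat.div_le_self _ _).trans (huN γ h))
      hmu (fun γ h => (Nat.mod_le _ _).trans (huN γ h))
      hmv (fun γ h => (Nat.mod_le _ _).trans (hvN γ h))

theorem polyTimePred_adj (hu : PT u) (huN : ∀ γ, (wd γ).Reducible → u γ ≤ (wd γ).N)
    (hv : PT v) (hvN : ∀ γ, (wd γ).Reducible → v γ ≤ (wd γ).N) :
    PTP fun γ => Adj (wd γ).n (wd γ).k (wd γ).edge (u γ) (v γ) := by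
  have hdu := hu.div_two_pow polyTime_two_mul_bits fun _ h => h.bits_le
  have hdv := hv.div_two_pow polyTime_two_mul_bits fun _ h => h.bits_le
  exact ((PolyTimePred.eq hu hv).not.and ((PolyTimePred.lt hdu polyTime_slots).and
    (PolyTimePred.lt hdv polyTime_slots))).or <|
    (polyTimePred_contain hu huN hv hvN).or (polyTimePred_contain hv hvN hu huN)

/-- The instance that the reduction produces. -/
noncomputable def cell (W : World) (i : ℕ) : ℕ :=
  (graphInput (order W.n W.k) (slots W.k) (graph W.n W.k W.edge)).mem i

open Classical in
-- Row and column of a matrix entry are recovered by division with remainder. The clamped index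
-- keeps these operations within `N` for every `i`.
theorem cell_eq (W : World) (i : ℕ) : cell W i = if i = 0 then order W.n W.k else
    if i = 1 then slots W.k else
    if i - 2 < order W.n W.k * order W.n W.k ∧ Adj W.n W.k W.edge
      (min (i - 2) (order W.n W.k * order W.n W.k) / order W.n W.k)
      (min (i - 2) (order W.n W.k * order W.n W.k) % order W.n W.k) then 1 else 0 := by
  have ho : 0 < order W.n W.k := Nat.mul_pos (Nat.succ_pos _) (by positivity)
  obtain _ | _ | i := i
  · simp [cell, graphInput]
  · simp [cell, graphInput]
  · simp only [cell, graphInput, if_false, show ¬ i + 1 + 1 = 1 by omega, show i + 1 + 1 - 2 = i by omega,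
      show ¬ i + 1 + 1 = 0 by omega]
    refine if_congr ?_ rfl rfl
    constructor
    · rintro ⟨u, v, rfl, h⟩
      have hlt : (u : ℕ) * order W.n W.k + v < order W.n W.k * order W.n W.k := by
        have := u.2
        have := v.2
        nlinarith
      refine ⟨hlt, ?_⟩
      rw [min_eq_left hlt.le, mul_comm, Nat.mul_add_div ho, Nat.div_eq_of_lt v.2, add_zero,
        Nat.mul_add_mod, Nat.mod_eq_of_lt v.2]
      exact h
    · rintro ⟨hlt, h⟩
      rw [min_eq_left hlt.le] at h
      exact ⟨⟨i / order W.n W.k, Nat.div_lt_of_lt_mul hlt⟩, ⟨i % order W.n W.k, Nat.mod_lt _ ho⟩,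
        (Nat.div_add_mod' _ _).symm, h⟩

theorem polyTime_cell : PT fun γ : World × ℕ => cell γ.1 γ.2 := by
  classical
  have ho2 : PT fun γ : World × ℕ => order (wd γ).n (wd γ).k * order (wd γ).n (wd γ).k :=
    polyTime_order.mul polyTime_order fun _ h => h.order_le_N
  have hi : PT fun γ : World × ℕ => γ.2 - 2 := PolyTime.snd.sub (.const 2)
  have hm := hi.min ho2
  have hmN : ∀ γ : World × ℕ, (wd γ).Reducible → min (γ.2 - 2)
      (order (wd γ).n (wd γ).k * order (wd γ).n (wd γ).k) ≤ (wd γ).N := fun _ h =>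
    (min_le_right _ _).trans (by have := h.order_le; omega)
  refine (PolyTimePred.ite (PolyTimePred.eq .snd (.const 0)) polyTime_order <|
    PolyTimePred.ite (PolyTimePred.eq .snd (.const 1)) polyTime_slots <|
    PolyTimePred.ite ((PolyTimePred.lt hi ho2).and (polyTimePred_adj
      (hm.div polyTime_order hmN (fun _ h => h.order_le_N)
        fun _ _ => Nat.mul_pos (Nat.succ_pos _) (by positivity)) ?_
      (hm.mod polyTime_order hmN) ?_)) (.const 1) (.const 0)).congr
    fun γ _ => (cell_eq γ.1 γ.2).symm
  · exact fun γ h => (Nat.div_le_self _ _).trans (hmN γ h)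
  · exact fun γ h => (Nat.mod_le _ _).trans (hmN γ h)

/-- The cells `N, N + 1, …` contain the characteristic vector of a small dominating set. -/
def Accepts (W : World) : Prop :=
  (∀ v < order W.n W.k, W.mem (W.N + v) = 1 ∨
    ∃ u < order W.n W.k, W.mem (W.N + u) = 1 ∧ Adj W.n W.k W.edge u v) ∧
  ∑ v ∈ Finset.range (order W.n W.k), (if W.mem (W.N + v) = 1 then 1 else 0) ≤ 2 ^ gap W.n W.k

theorem polyTimePred_accepts : PTP Accepts := by
  have hN : ∀ {Γ : Type} [Ctx Γ] (γ : Γ), (wd γ).Reducible → order (wd γ).n (wd γ).k ≤ (wd γ).N :=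
    fun _ h => h.order_le_N
  have hmem : ∀ {Γ : Type} [Ctx Γ] {v : Γ → ℕ}, PT v → PTP fun γ => (wd γ).mem ((wd γ).N + v γ) = 1 :=
    fun hv => .eq (PolyTime.worldN.add hv).load (.const 1)
  have hv : PT fun γ : World × ℕ => min γ.2 (order (wd γ).n (wd γ).k) :=
    PolyTime.snd.min polyTime_order
  have hu : PT fun γ : (World × ℕ) × ℕ => min γ.2 (order (wd γ).n (wd γ).k) :=
    PolyTime.snd.min polyTime_order
  refine (PolyTimePred.forall_lt polyTime_order hN ((hmem hv).or
    (PolyTimePred.exists_lt polyTime_order hN ((hmem hu).and (polyTimePred_adj hu ?_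
      hv.weaken ?_))))).and (PolyTimePred.le (PolyTime.sum_lt polyTime_order hN
        (PolyTimePred.ite (hmem hv) (.const 1) (.const 0))) (polyTime_gap.two_pow fun _ h => ?_))
  · exact fun γ h => (min_le_right _ _).trans (hN γ h)
  · exact fun γ h => (min_le_right _ _).trans (hN γ h)
  · have := h.gap_le; omega

end Gap

/-! ### Exhaustive search -/

/-- The binary representation of some number below `2 ^ n` is the characteristic vector of a
clique with `k` vertices. -/
def World.SearchClique (W : World) : Prop :=
  ∃ x < 2 ^ W.n, ∑ u ∈ Finset.range W.n, x / 2 ^ u % 2 = W.k ∧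
    ∀ u < W.n, ∀ v < W.n, x / 2 ^ u % 2 = 1 → x / 2 ^ v % 2 = 1 → ¬ u = v → W.edge u v

/-- The bound `N` is large enough for exhaustive search. -/
structure World.Small (W : World) : Prop extends W.Good where
  two_pow_le : 2 ^ W.n ≤ W.N

theorem polyTimePred_searchClique : PolyTimePred World.Small World.SearchClique := by
  have hN : ∀ {Γ : Type} [Ctx Γ] (γ : Γ), (wd γ).Small → (wd γ).n ≤ (wd γ).N :=
    fun _ h => h.n_le
  have h2 : PolyTime World.Small fun γ : World => 2 ^ γ.n :=
    PolyTime.two_pow .worldn fun _ h => h.n_le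
  have hbit : ∀ {Γ : Type} [Ctx Γ] {x u : Γ → ℕ}, PolyTime World.Small x → PolyTime World.Small u →
      (∀ γ, (wd γ).Small → u γ ≤ (wd γ).N) →
      PolyTime World.Small fun γ => x γ / 2 ^ u γ % 2 :=
    fun hx hu h => (hx.div_two_pow hu h).mod_two
  have hx := PolyTime.min (PolyTime.snd (A := World.Small) (Γ := World)) h2.weaken
  have hu := PolyTime.min (PolyTime.snd (A := World.Small) (Γ := World × ℕ)) .worldn
  have hv := PolyTime.min (PolyTime.snd (A := World.Small) (Γ := (World × ℕ) × ℕ)) .worldn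
  refine .exists_lt h2 (fun _ h => h.two_pow_le) ((PolyTimePred.eq (.sum_lt .worldn hN
    (hbit hx.weaken hu fun _ h => ?_)) .worldk).and (.forall_lt .worldn hN <| .forall_lt .worldn hN <|
    (PolyTimePred.eq (hbit hx.weaken.weaken hu.weaken fun _ h => ?_) (.const 1)).imply <|
    (PolyTimePred.eq (hbit hx.weaken.weaken hv fun _ h => ?_) (.const 1)).imply <|
    (PolyTimePred.eq hu.weaken hv).not.imply <|
      polyTimePred_edge (fun _ h => h.toGood) hu.weaken hv))
  · exact (min_le_right _ _).trans (hN _ h)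
  · exact (min_le_right _ _).trans (hN _ h)
  · exact (min_le_right _ _).trans (hN _ h)

/-! ### Correctness of the reduction -/

namespace World

variable {W : World}

/-- A family with adjacent values at distinct indices is injective because adjacency is irreflexive.
-/
theorem exists_isClique_iff (W : World) :
    (∃ S : Finset (Fin W.n), W.G.IsClique (S : Set (Fin W.n)) ∧ S.card = W.k) ↔
      ∃ x : ℕ → ℕ, (∀ i < W.k, x i < W.n) ∧
        ∀ i < W.k, ∀ j < W.k, i ≠ j → W.edge (x i) (x j) := by
  constructor
  · rintro ⟨S, hS, hc⟩
    let e := S.orderEmbOfFin hc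
    refine ⟨fun i => if h : i < W.k then e ⟨i, h⟩ else 0, fun i hi => ?_, fun i hi j hj hij => ?_⟩
    · simp [hi]
    · simp only [hi, hj, dif_pos]
      refine ⟨(e ⟨i, hi⟩).2, (e ⟨j, hj⟩).2, hS (Finset.orderEmbOfFin_mem S hc _)
        (Finset.orderEmbOfFin_mem S hc _) fun h => hij ?_⟩
      simpa using e.injective h
  · rintro ⟨x, hx, hE⟩
    let f : Fin W.k → Fin W.n := fun i => ⟨x i, hx i i.2⟩
    have hadj : ∀ i j, i ≠ j → W.G.Adj (f i) (f j) := fun i j hij =>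
      (hE i i.2 j j.2 fun h => hij (Fin.ext h)).2.2
    have hf : Function.Injective f := fun i j h => by
      by_contra hij
      exact (hadj i j hij).ne h
    refine ⟨Finset.univ.image f, ?_, by rw [Finset.card_image_of_injective _ hf]; simp⟩
    intro u hu v hv huv
    obtain ⟨i, -, rfl⟩ := Finset.mem_image.1 hu
    obtain ⟨j, -, rfl⟩ := Finset.mem_image.1 hv
    exact hadj i j fun h => huv (by rw [h])

theorem searchClique_iff (W : World) : W.SearchClique ↔
    ∃ S : Finset (Fin W.n), W.G.IsClique (S : Set (Fin W.n)) ∧ S.card = W.k := by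
  constructor
  · rintro ⟨x, -, hc, hE⟩
    refine ⟨Finset.univ.filter fun u : Fin W.n => x / 2 ^ (u : ℕ) % 2 = 1, ?_, ?_⟩
    · intro u hu v hv huv
      obtain ⟨_, _, h⟩ := hE u u.2 v v.2 (by simpa using hu) (by simpa using hv)
        fun h => huv (Fin.ext h)
      exact h
    · rw [← hc, Finset.sum_range, Finset.card_filter]
      exact Finset.sum_congr rfl fun u _ => by split_ifs <;> omega
  · classical
    rintro ⟨S, hS, hc⟩
    obtain ⟨x, hx, hd⟩ := exists_digits 1 W.n fun u => if ∃ h : u < W.n, ⟨u, h⟩ ∈ S then 1 else 0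
    simp only [one_mul, pow_one] at hx hd
    have hb : ∀ u : Fin W.n, x / 2 ^ (u : ℕ) % 2 = if u ∈ S then 1 else 0 := fun u => by
      rw [hd u u.2]
      by_cases h : u ∈ S <;> simp [h]
    refine ⟨x, hx, ?_, fun u hu v hv h1 h2 huv => ⟨hu, hv, ?_⟩⟩
    · rw [Finset.sum_range, ← hc, Finset.sum_congr rfl fun u _ => hb u]
      simp
    · rw [hb ⟨u, hu⟩] at h1
      rw [hb ⟨v, hv⟩] at h2
      exact hS (by_contra fun h => by simp [show ⟨u, hu⟩ ∉ S from h] at h1)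
        (by_contra fun h => by simp [show ⟨v, hv⟩ ∉ S from h] at h2) fun h => huv (by simpa using h)

end World

namespace Gap

variable {W : World}

theorem accepts_iff {s : RamState} (hs : ∀ a, W.mem (W.N + a) = s.mem a) : Accepts W ↔
    IsDominatingSet (graph W.n W.k W.edge) (outputSet (order W.n W.k) s) ∧
      (outputSet (order W.n W.k) s).card ≤ 2 ^ gap W.n W.k := by
  have hmem : ∀ v : Fin (order W.n W.k), v ∈ outputSet (order W.n W.k) s ↔ s.mem v = 1 := by
    simp [outputSet]
  refine and_congr ⟨fun h v hv => ?_, fun h v hv => ?_⟩ ?_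
  · obtain ⟨u, hu, h1, h2⟩ := (h v v.2).resolve_left fun h' => hv ((hmem v).2 (by rwa [← hs]))
    exact ⟨⟨u, hu⟩, (hmem _).2 (by rwa [← hs]), h2⟩
  · by_cases hv' : ⟨v, hv⟩ ∈ outputSet (order W.n W.k) s
    · exact .inl (by rw [hs]; exact (hmem _).1 hv')
    · obtain ⟨u, hu, h2⟩ := h _ hv'
      exact .inr ⟨u, u.2, by rw [hs]; exact (hmem _).1 hu, h2⟩
  · rw [outputSet, Finset.card_filter, Finset.sum_range]
    simp only [hs]

end Gap

/-! ### Bounds for the running time -/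

/-- The functions of the form `T k * poly n`, with `T` computable, and the functions below them. -/
def FPTBdd (t : ℕ → ℕ → ℕ) : Prop :=
  ∃ (T : ℕ → ℕ) (c : ℕ), Computable T ∧ ∀ k n, t k n ≤ T k * (n + 1) ^ c

namespace FPTBdd

variable {t t' : ℕ → ℕ → ℕ}

theorem of_computable {T : ℕ → ℕ} (hT : Computable T) : FPTBdd fun k _ => T k :=
  ⟨T, 0, hT, fun k n => by simp⟩

theorem const (c : ℕ) : FPTBdd fun _ _ => c := of_computable (Computable.const c)

theorem size : FPTBdd fun _ n => n := ⟨fun _ => 1, 1, Computable.const 1, fun k n => by simp⟩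

theorem mul (h : FPTBdd t) (h' : FPTBdd t') : FPTBdd fun k n => t k n * t' k n := by
  obtain ⟨T, c, hT, h⟩ := h
  obtain ⟨T', c', hT', h'⟩ := h'
  refine ⟨_, c + c', hT.nat_mul hT', fun k n => (Nat.mul_le_mul (h k n) (h' k n)).trans ?_⟩
  rw [pow_add]
  exact le_of_eq (by ring)

theorem add (h : FPTBdd t) (h' : FPTBdd t') : FPTBdd fun k n => t k n + t' k n := by
  obtain ⟨T, c, hT, h⟩ := h
  obtain ⟨T', c', hT', h'⟩ := h'
  refine ⟨_, c + c', hT.nat_add hT', fun k n => (Nat.add_le_add (h k n) (h' k n)).trans ?_⟩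
  rw [add_mul]
  exact Nat.add_le_add
    (Nat.mul_le_mul_left _ (Nat.pow_le_pow_right (by omega) (by omega)))
    (Nat.mul_le_mul_left _ (Nat.pow_le_pow_right (by omega) (by omega)))

theorem pow (h : FPTBdd t) (c : ℕ) : FPTBdd fun k n => t k n ^ c := by
  induction c with
  | zero => simpa using const 1
  | succ c ih => simpa only [pow_succ] using ih.mul h

theorem mono (h : FPTBdd t) (hle : ∀ k n, t' k n ≤ t k n) : FPTBdd t' := by
  obtain ⟨T, c, hT, h⟩ := h
  exact ⟨T, c, hT, fun k n => (hle k n).trans (h k n)⟩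

/-- Applied to `N = H k * (n + 1) ^ 4`: programs that are polynomial in `N` run in FPT time. -/
theorem comp_polyBdd {B : ℕ → ℕ} (hB : PolyBdd B) (h : FPTBdd t) : FPTBdd fun k n => B (t k n) := by
  obtain ⟨C, hB⟩ := hB
  exact ((h.add (const 2)).pow C).mono fun k n => hB _

end FPTBdd

theorem RunsTo.and_regBound {p : RamProg} {s : RamState} {b : ℕ} {Q : RamState → Prop}
    (h : RunsTo p s b Q) :
    RunsTo p s b fun s' => Q s' ∧ ∀ i, p.regBound ≤ i → s'.reg i = s.reg i := by
  obtain ⟨t, s', h, ht, hQ⟩ := h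
  exact ⟨t, s', h, ht, hQ, fun i hi => h.reg_eq_of_regBound_le hi⟩

/-! ### The parts of the algorithm -/

theorem represents_world {W : World} {s : RamState} (hN : s.reg 0 = W.N) (hn : s.reg 1 = W.n)
    (hk : s.reg 2 = W.k) (hH : s.reg 3 = W.H) (hm : s.mem = W.mem) :
    Represents (fun _ => 0) 4 W s :=
  ⟨le_rfl, hN, hn, hk, hH, hm, by rintro i ⟨⟩, by rintro i ⟨⟩⟩

/-- Programs can fill the memory cells `N, …, 2 N - 1` by polynomial time computable numbers. -/
theorem PolyTime.exists_fill {A : World → Prop} {f : World × ℕ → ℕ} (hf : PolyTime A f)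
    (hA : ∀ (W : World) m, A W → (∀ a < W.N, m a = W.mem a) →
      A { W with mem := m } ∧ ∀ i, f ({ W with mem := m }, i) = f (W, i)) :
    ∃ B, PolyBdd B ∧ ∃ p : RamProg, ∀ W s, A W → Represents (fun _ => 0) 4 W s →
      RunsTo p s (B W.N) fun s' => Represents (fun _ => 0) 4
        { W with mem := fun a => if W.N ≤ a ∧ a < 2 * W.N then f (W, a - W.N) else W.mem a } s' := by
  obtain ⟨B, hB, p, hp⟩ := hf
  refine ⟨fun N => 2 + (N * (1 + (1 + (B N + (1 + 1))) + 1) + 1), ?_,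
    .seq (.mov 4 0) <| .loop 4 <| .seq (.const 5 1) <| .seq (.sub 4 4 5) <|
    .seq (p (pushVar 4 fun _ => 0) 6) <| .seq (.add 5 0 4) (.store 5 6), fun W s hW hs => ?_⟩
  · exact (PolyBdd.const 2).add ((PolyBdd.id.mul (((PolyBdd.const 1).add ((PolyBdd.const 1).add
      (hB.add (.const 2)))).add (.const 1))).add (.const 1))
  -- The memory once the cells from `N + m` on are filled. Filling goes downwards, so the loop
  -- counter doubles as the offset of the next cell.
  let M : ℕ → ℕ → ℕ := fun m a => if W.N + m ≤ a ∧ a < 2 * W.N then f (W, a - W.N) else W.mem a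
  refine RunsTo.seq (.mov (Q := fun s' => s' = s.setReg 4 W.N) (by rw [hs.N]; rfl)) ?_
  rintro _ rfl
  refine (RunsTo.loop_const (fun m s' => m ≤ W.N ∧ s'.reg 4 = m ∧
    Represents (fun _ => 0) 4 { W with mem := M m } s') (fun s' h => h.2.1)
    (fun m s' h => by rw [h.2.1]; omega) ?_ W.N _ ?_).mono le_rfl ?_
  · rintro m s₁ ⟨h1, h2, h3⟩
    refine RunsTo.seq (.const (Q := fun s' => s' = s₁.setReg 5 1) rfl) ?_
    rintro _ rfl
    refine RunsTo.seq (.sub (Q := fun s' => s' = (s₁.setReg 5 1).setReg 4 m) (by simp [h2])) ?_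
    rintro _ rfl
    -- The cells below `N` are untouched, so the partly filled memory still yields the same values
    -- of `f`.
    obtain ⟨hA', hf'⟩ := hA W (M (m + 1)) hW fun a ha => if_neg (by omega)
    have h4 : Represents (fun _ => 0) 4 { W with mem := M (m + 1) } ((s₁.setReg 5 1).setReg 4 m) :=
      h3.of_sameBelow (((SameBelow.refl 4 s₁).setReg (by omega)).setReg le_rfl)
    have h5 := h4.push (e := 4) (x := m) (d' := 6) (by simp) (by omega) (by omega)
    refine (hp _ _ _ _ hA' h5).seq fun s₂ h6 => ?_
    have h7 : Represents (fun _ => 0) 4 { W with mem := M (m + 1) } s₂ :=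
      h4.of_sameBelow (h6.2.mono (by omega))
    refine RunsTo.seq (.add (Q := fun s' => s' = s₂.setReg 5 (W.N + m)) ?_) ?_
    · rw [h7.N, h6.2.reg 4 (by omega)]
      simp [Ctx.wd]
    rintro _ rfl
    have h8 : s₂.reg 6 = f (W, m) := h6.1.trans (hf' m)
    refine .store ⟨by omega, ?_, ?_⟩
    · simp [h6.2.reg 4 (by omega)]
    · refine represents_world h7.N h7.n h7.k h7.H ?_
      ext a
      have h9 : s₂.mem = M (m + 1) := h7.mem
      simp only [RamState.mem_setMem, RamState.mem_setReg, RamState.reg_setReg, h8, h9, M,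
        if_true, show ¬ (6 : ℕ) = 5 by omega, if_false]
      by_cases ha : a = W.N + m
      · rw [if_pos ha, if_pos (by omega), ha, Nat.add_sub_cancel_left]
      · rw [if_neg ha]
        exact if_congr (by omega) rfl rfl
  · refine ⟨le_rfl, by simp, ?_⟩
    have : ({ W with mem := M W.N } : World) = W := by
      have : M W.N = W.mem := by
        ext a
        exact if_neg (by omega)
      rw [this]
    rw [this]
    exact hs.of_sameBelow ((SameBelow.refl 4 s).setReg le_rfl)
  · rintro s' ⟨-, -, h⟩
    exact h

/-- A polynomial time test as a program with result `1` or `0` in register `4`. -/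
theorem PolyTimePred.exists_test {A P : World → Prop} (hP : PolyTimePred A P) :
    ∃ B, PolyBdd B ∧ ∃ p : RamProg, ∀ W s, A W → Represents (fun _ => 0) 4 W s →
      RunsTo p s (B W.N) fun s' => (s'.reg 4 = 1 ↔ P W) ∧ (s'.reg 4 = 0 ↔ ¬ P W) ∧
        Represents (fun _ => 0) 4 W s' := by
  classical
  obtain ⟨B, hB, p, hp⟩ := hP.ite (.const 1) (.const 0)
  refine ⟨B, hB, p (fun _ => 0) 4, fun W s hW hs => (hp _ 4 W s hW hs).mono le_rfl ?_⟩
  rintro s' ⟨h1, h2⟩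
  refine ⟨?_, ?_, hs.of_sameBelow h2⟩ <;> by_cases h : P W <;> simp [h1, h]

/-- A program that reads the instance and computes a bound `N`. -/
theorem exists_prelude {H : ℕ → ℕ} (hH : Computable H) :
    ∃ t, FPTBdd t ∧ ∃ p : RamProg, ∀ (n k : ℕ) (G : SimpleGraph (Fin n)),
      RunsTo p (graphInput n k G) (t k n) fun s => Represents (fun _ => 0) 4
        (⟨H k * (n + 1) * (n + 1) * (n + 1) * (n + 1), n, k, H k,
          (graphInput n k G).mem, G⟩ : World) s := by
  obtain ⟨p, b, hb, hp⟩ := hH.regComputable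
  have hN : PolyTime (fun W => W.n + 1 ≤ W.N)
      fun W : World => W.H * (W.n + 1) * (W.n + 1) * (W.n + 1) * (W.n + 1) := by
    have h := PolyTime.add (PolyTime.worldn (A := fun W => W.n + 1 ≤ W.N) (Γ := World)) (.const 1)
    exact (((PolyTime.worldH.mul h fun _ h => h).mul h fun _ h => h).mul h fun _ h => h).mul h
      fun _ h => h
  obtain ⟨B, hB, q, hq⟩ := hN
  refine ⟨fun k n => 1 + (1 + (1 + (1 + (2 + (b k + (2 + (1 + (1 + (1 + (B (1 + n + H k) + 2)))))))))),
    ?_, .seq (.const 4 0) <| .seq (.load 1 4) <| .seq (.const 4 1) <| .seq (.load 2 4) <|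
      .seq (.mov 4 2) <| .seq (p 4) <| .seq (.mov 3 4) <| .seq (.const 0 1) <| .seq (.add 0 0 1) <|
      .seq (.add 0 0 3) <| .seq (q (fun _ => 0) 4) (.mov 0 4), fun n k G => ?_⟩
  · have := (FPTBdd.const 1).add FPTBdd.size |>.add (.of_computable hH)
    have h1 := FPTBdd.const 1
    have h2 := FPTBdd.const 2
    exact h1.add <| h1.add <| h1.add <| h1.add <| h2.add <| (FPTBdd.of_computable hb).add <| h2.add <|
      h1.add <| h1.add <| h1.add <| (this.comp_polyBdd hB).add h2
  set s := graphInput n k G with hs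
  refine RunsTo.seq (.const (Q := fun s' => s' = s.setReg 4 0) rfl) ?_
  rintro _ rfl
  refine RunsTo.seq (.load (Q := fun s' => s' = (s.setReg 4 0).setReg 1 n)
    (by simp [hs, graphInput])) ?_
  rintro _ rfl
  refine RunsTo.seq (.const (Q := fun s' => s' = ((s.setReg 4 0).setReg 1 n).setReg 4 1) rfl) ?_
  rintro _ rfl
  refine RunsTo.seq (.load (Q := fun s' => s'.reg 1 = n ∧ s'.reg 2 = k ∧ s'.mem = s.mem)
    (by simp [hs, graphInput])) ?_
  rintro s₁ ⟨h1, h2, h3⟩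
  refine RunsTo.seq (.mov (Q := fun s' => s' = s₁.setReg 4 k) (by rw [h2])) ?_
  rintro _ rfl
  refine RunsTo.seq (Q := fun s' => s'.reg 1 = n ∧ s'.reg 2 = k ∧ s'.reg 4 = H k ∧ s'.mem = s.mem)
    ((hp 4 _).mono (by simp) ?_) ?_
  · rintro s₂ ⟨h4, h5⟩
    exact ⟨by simp [h5.reg, h1], by simp [h5.reg, h2], by simp [h4], by simp [h5.mem, h3]⟩
  clear h1 h2 h3 s₁
  rintro s₁ ⟨h1, h2, h3, h4⟩
  refine RunsTo.seq (.mov (Q := fun s' => s' = s₁.setReg 3 (H k)) (by rw [h3])) ?_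
  rintro _ rfl
  refine RunsTo.seq (.const (Q := fun s' => s' = (s₁.setReg 3 (H k)).setReg 0 1) rfl) ?_
  rintro _ rfl
  refine RunsTo.seq (.add (Q := fun s' => s' = ((s₁.setReg 3 (H k)).setReg 0 1).setReg 0 (1 + n))
    (by simp [h1])) ?_
  rintro _ rfl
  -- The provisional bound `1 + n + H k` needs additions only. It permits the multiplications by `n
  -- + 1` that produce the final bound.
  refine RunsTo.seq (.add (Q := fun s' => Represents (fun _ => 0) 4
    (⟨1 + n + H k, n, k, H k, s.mem, G⟩ : World) s') ?_) ?_
  · exact represents_world (by simp) (by simp [h1]) (by simp [h2]) (by simp) (by simp [h4])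
  intro s₂ h5
  have hA : n + 1 ≤ 1 + n + H k := by omega
  refine (hq _ _ (⟨1 + n + H k, n, k, H k, s.mem, G⟩ : World) _ hA h5).seq fun s₃ h6 => .mov ?_
  have h7 := h5.of_sameBelow h6.2
  exact represents_world (by simp [h6.1]) h7.n h7.k h7.H h7.mem

/-- The cells beyond the copied instance already have the value that the relocated program expects.
-/
theorem graphInput_mem_eq_zero {n k a : ℕ} (G : SimpleGraph (Fin n)) (ha : n * n + 2 ≤ a) :
    (graphInput n k G).mem a = 0 := by
  obtain ⟨a, rfl⟩ : ∃ b, a = b + 2 := ⟨a - 2, by omega⟩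
  refine if_neg ?_
  rintro ⟨u, v, h, -⟩
  have := u.2
  have := v.2
  nlinarith

namespace Gap

theorem order_le {n k : ℕ} (hn : 0 < n) : order n k ≤ (slots k + 1) * (4 * (n * n)) := by
  refine Nat.mul_le_mul_left _ ?_
  rw [two_mul, pow_add]
  exact (Nat.mul_le_mul (two_pow_bits_le hn) (two_pow_bits_le hn)).trans (le_of_eq (by ring))

/-- An approximation algorithm for `k`-DomSet, applied to the new graph, decides whether the given
graph has a clique. -/
theorem exists_decide {ρ : ℕ → ℕ → ℝ} {P : RamProg} (hP : ApproximatesDomSetInFPTTime ρ P)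
    (d : ℕ) : ∃ (T B : ℕ → ℕ) (c : ℕ), Computable T ∧ PolyBdd B ∧ ∃ p : RamProg, ∀ (W : World) s,
      W.Reducible → W.mem = (graphInput W.n W.k W.G).mem →
      ρ (order W.n W.k) (slots W.k) * slots W.k ≤ 2 ^ gap W.n W.k →
      (∀ i, d ≤ i → s.reg i = 0) → Represents (fun _ => 0) 4 W s →
      RunsTo p s (B W.N + T W.k * (W.N + 1) ^ c) fun s' => s'.reg 4 = 1 ↔
        ∃ S : Finset (Fin W.n), W.G.IsClique (S : Set (Fin W.n)) ∧ S.card = W.k := by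
  obtain ⟨T, c, hT, hP⟩ := hP
  obtain ⟨B₁, hB₁, p₁, hp₁⟩ := polyTime_cell.exists_fill fun W m hW hm =>
    ⟨⟨⟨hW.sq_le, hW.k_le, fun a ha => (hm a ha).trans (hW.mem a ha)⟩, hW.n_pos, hW.k_pos, hW.large,
      hW.order_le⟩, fun i => rfl⟩
  obtain ⟨B₂, hB₂, p₂, hp₂⟩ := polyTimePred_accepts.exists_test
  -- Above `D` all registers are still `0`, and registers `0` to `3`, which describe the world, lie
  -- below `D`.
  set D := d + p₁.regBound + 5 with hD
  refine ⟨fun k => 2 * T (slots k), fun N => B₁ N + B₂ N, c,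
    (Computable.const 2).nat_mul (hT.comp (Computable.id.nat_mul Computable.id)), hB₁.add hB₂,
    .seq p₁ (.seq (P.relocate D) p₂), fun W s hW hmem hρ hs hrep => ?_⟩
  refine RunsTo.of_le (b := B₁ W.N + (2 * (T (slots W.k) * (W.N + 1) ^ c) + B₂ W.N)) ?_
    (by simp only [mul_assoc]; omega)
  refine (hp₁ W s hW hrep).and_regBound.seq fun s₁ ⟨h1, h2⟩ => ?_
  obtain ⟨t, s', hrun, ht, hQ⟩ := hP (order W.n W.k) (slots W.k) (graph W.n W.k W.edge)
  have hcont : Contains D W.N (graphInput (order W.n W.k) (slots W.k) (graph W.n W.k W.edge)) s₁ := by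
    refine ⟨h1.N, fun i => ?_, fun a => ?_⟩
    · rw [h2 _ (by omega), hs _ (by omega)]
      rfl
    · rw [h1.mem]
      simp only [wd, id]
      -- Beyond `N` both the original memory and the input for the new graph are `0`.
      by_cases ha : a < W.N
      · rw [if_pos (by omega), Nat.add_sub_cancel_left]
        rfl
      · rw [if_neg (by omega), hmem, graphInput_mem_eq_zero _ (by have := hW.sq_le; omega),
          graphInput_mem_eq_zero _ (by have := hW.order_le; omega)]
  refine RunsTo.seq ((hrun.relocate (by omega) s₁ hcont).of_le (Nat.mul_le_mul_left 2 (ht.trans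
    (Nat.mul_le_mul_left _ (Nat.pow_le_pow_left (Nat.succ_le_succ hW.order_le_N) c))))) ?_
  rintro s₂ ⟨h3, h4⟩
  have h5 : Represents (fun _ => 0) 4 ({ W with mem := s₂.mem } : World) s₂ :=
    represents_world h3.base ((h4.reg 1 (by omega)).trans h1.n) ((h4.reg 2 (by omega)).trans h1.k)
      ((h4.reg 3 (by omega)).trans h1.H) rfl
  -- The relocated run respects the cells below `N`, so the original instance is still available for
  -- the check of the output.
  have h6 : World.Reducible { W with mem := s₂.mem } := by
    refine ⟨⟨hW.sq_le, hW.k_le, fun a ha => ?_⟩, hW.n_pos, hW.k_pos, hW.large, hW.order_le⟩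
    refine (h4.mem a ha).trans ?_
    rw [h1.mem]
    simp only [wd, id]
    rw [if_neg (by simp only at ha; omega), hmem]
  refine (hp₂ _ s₂ h6 h5).mono le_rfl fun s₃ ⟨h7, _, _⟩ => h7.trans ?_
  rw [accepts_iff (s := s') h3.mem, W.exists_isClique_iff]
  -- Since the output is verified, acceptance yields a clique whatever `P` does; the guarantee of
  -- `P` is needed only when there is a clique.
  constructor
  · rintro ⟨hdom, hcard⟩
    exact exists_clique hW.n_pos hW.large _ hdom hcard
  · rintro ⟨x, hx, hE⟩
    obtain ⟨hdom, hcard⟩ := hQ (exists_isDominatingSet hW.k_pos x hx hE)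
    exact ⟨hdom, by exact_mod_cast hcard.trans hρ⟩

/-- The matrix of the new graph has `order n k * order n k` entries, at most `16 * (slots k + 1) ^ 2
* n ^ 4`; this explains the lower bound on `H` and the fourth power of `n + 1` in `N`. -/
theorem reducible_or_small {n k H : ℕ} (G : SimpleGraph (Fin n))
    (hH : 16 * ((slots k + 1) * (slots k + 1)) + 2 ≤ H)
    (hlarge : 0 < k → H < 2 ^ n → 0 < n ∧ Large n k) (W : World)
    (hW : W = ⟨H * (n + 1) * (n + 1) * (n + 1) * (n + 1), n, k, H, (graphInput n k G).mem, G⟩) :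
    W.Good ∧ (2 ^ n ≤ H → W.Small) ∧ (0 < k → H < 2 ^ n → W.Reducible) := by
  subst hW
  set N := H * (n + 1) * (n + 1) * (n + 1) * (n + 1) with hN
  have hN' : N = H * ((n + 1) ^ 4) := by rw [hN]; ring
  have h0 : 1 ≤ (n + 1) ^ 4 := Nat.one_le_pow _ _ (by omega)
  have h1 : H ≤ N := by rw [hN']; exact Nat.le_mul_of_pos_right _ (by positivity)
  have h2 : n * n * (n * n) + n * n + 1 ≤ (n + 1) ^ 4 := by nlinarith [sq_nonneg n]
  have h3 : (16 * ((slots k + 1) * (slots k + 1)) + 2) * (n + 1) ^ 4 ≤ N := by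
    rw [hN']
    exact Nat.mul_le_mul_right _ hH
  have hgood : World.Good ⟨N, n, k, H, (graphInput n k G).mem, G⟩ := by
    refine ⟨?_, ?_, fun _ _ => rfl⟩
    · simp only
      nlinarith [Nat.zero_le (16 * ((slots k + 1) * (slots k + 1)) * (n + 1) ^ 4)]
    · have : k ≤ slots k := Nat.le_mul_self k
      simp only
      nlinarith
  refine ⟨hgood, fun h => ⟨hgood, h.trans h1⟩, fun hk h => ?_⟩
  obtain ⟨hn, hl⟩ := hlarge hk h
  refine ⟨hgood, hn, hk, hl, ?_⟩
  simp only
  have h4 := Nat.mul_le_mul (order_le (k := k) hn) (order_le (k := k) hn)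
  have h5 : 16 * ((slots k + 1) * (slots k + 1)) * (n * n * (n * n)) ≤
      16 * ((slots k + 1) * (slots k + 1)) * (n + 1) ^ 4 := Nat.mul_le_mul_left _ (by omega)
  have h6 : (slots k + 1) * (4 * (n * n)) * ((slots k + 1) * (4 * (n * n))) =
    16 * ((slots k + 1) * (slots k + 1)) * (n * n * (n * n)) := by ring
  rw [add_mul] at h3
  omega

/-- If the approximation ratio is below the gap for all large graphs, then `k`-Clique can be solved
in FPT time. -/
theorem exists_solvesClique {ρ : ℕ → ℕ → ℝ} {P : RamProg} (hP : ApproximatesDomSetInFPTTime ρ P)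
    {H : ℕ → ℕ} (hHc : Computable H)
    (hH : ∀ k, 16 * ((slots k + 1) * (slots k + 1)) + 2 ≤ H k)
    (hlarge : ∀ k n, 0 < k → H k < 2 ^ n → 0 < n ∧ Large n k)
    (hρ : ∀ k n, 0 < k → H k < 2 ^ n → ρ (order n k) (slots k) * slots k ≤ 2 ^ gap n k) :
    ∃ P', SolvesCliqueInFPTTime P' := by
  obtain ⟨t₀, ht₀, p₀, hp₀⟩ := exists_prelude hHc
  have htest : PolyTimePred World.Good fun W : World => 2 ^ W.n ≤ W.H :=
    .le (PolyTime.worldn.two_pow fun _ h => h.n_le) .worldH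
  obtain ⟨B₁, hB₁, p₁, hp₁⟩ := htest.exists_test
  obtain ⟨B₂, hB₂, p₂, hp₂⟩ := polyTimePred_searchClique.exists_test
  obtain ⟨T, B₃, c, hT, hB₃, p₃, hp₃⟩ := exists_decide hP (p₀.regBound + p₁.regBound)
  let N : ℕ → ℕ → ℕ := fun k n => H k * (n + 1) * (n + 1) * (n + 1) * (n + 1)
  have hN : FPTBdd N := by
    have h := FPTBdd.size.add (.const 1)
    exact ((((FPTBdd.of_computable hHc).mul h).mul h).mul h).mul h
  let t : ℕ → ℕ → ℕ := fun k n => t₀ k n + ((B₁ (N k n) +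
    (B₂ (N k n) + (B₃ (N k n) + T k * (N k n + 1) ^ c) + 1) + 1) + (1 + 1))
  have ht : FPTBdd t :=
    ht₀.add ((((hN.comp_polyBdd hB₁).add (((hN.comp_polyBdd hB₂).add ((hN.comp_polyBdd hB₃).add
      ((FPTBdd.of_computable hT).mul ((hN.add (.const 1)).pow c)))).add (.const 1))).add
      (.const 1)).add (.const 2))
  obtain ⟨T', c', hT', ht'⟩ := ht
  refine ⟨.seq p₀ <| .seq (.cond 2 (.seq p₁ (.cond 4 p₂ p₃)) (.const 4 1)) <|
    .seq (.const 5 0) (.store 5 4), T', c', hT', fun n k G => ?_⟩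
  suffices h : RunsTo _ (graphInput n k G) (t k n) fun s => s.mem 0 = 1 ↔
      ∃ S : Finset (Fin n), G.IsClique (S : Set (Fin n)) ∧ S.card = k by
    obtain ⟨τ, s, h1, h2, h3⟩ := h
    exact ⟨τ, s, h1, h2.trans (ht' k n), h3⟩
  refine (hp₀ n k G).and_regBound.seq fun s₁ ⟨h1, h2⟩ => ?_
  obtain ⟨W, hW⟩ : ∃ W : World, W = ⟨N k n, n, k, H k, (graphInput n k G).mem, G⟩ := ⟨_, rfl⟩
  obtain ⟨hgood, hsmall, hred⟩ := reducible_or_small G (hH k) (hlarge k n) W hW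
  replace h1 : Represents (fun _ => 0) 4 W s₁ := by rw [hW]; exact h1
  have hWN : W.N = N k n := by rw [hW]
  refine RunsTo.seq (Q := fun s => s.reg 4 = 1 ↔
      ∃ S : Finset (Fin n), G.IsClique (S : Set (Fin n)) ∧ S.card = k) ?_ fun s hs => ?_
  · refine RunsTo.cond (fun hk => ?_) fun hk => ?_
    · have hk' : 0 < k := by
        rw [h1.k, hW] at hk
        exact Nat.pos_of_ne_zero hk
      rw [← hWN]
      refine (hp₁ W s₁ hgood h1).and_regBound.seq fun s₂ ⟨⟨_, h3, h4⟩, h5⟩ => ?_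
      refine RunsTo.cond (fun h6 => ?_) fun h6 => ?_
      · have h7 : 2 ^ W.n ≤ W.H := by rwa [Ne, h3, not_not] at h6
        refine (hp₂ W s₂ (hsmall (by subst hW; exact h7)) h4).mono (by omega) fun s₃ h8 =>
          h8.1.trans ?_
        rw [W.searchClique_iff]
        subst hW
        rfl
      · have h7 : ¬ 2 ^ W.n ≤ W.H := h3.1 h6
        have h8 : H k < 2 ^ n := by subst hW; exact not_le.1 h7
        refine (hp₃ W s₂ (hred hk' h8) (by subst hW; rfl) (by subst hW; exact hρ k n hk' h8)
          (fun i hi => ?_) h4).mono ?_ fun s₃ h9 => ?_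
        · rw [h5 i (by omega), h2 i (by omega)]
          rfl
        · have : W.k = k := by subst hW; rfl
          rw [this]
          omega
        · subst hW
          exact h9
    -- The reduction needs a slot, so `k = 0` is answered directly by the empty clique.
    · have hk' : k = 0 := by
        rw [h1.k, hW] at hk
        exact hk
      subst hk'
      refine RunsTo.of_le (b := 1) (.const ?_) (by omega)
      simp only [RamState.reg_setReg, if_true, true_iff]
      exact ⟨∅, by simp, rfl⟩
  · refine RunsTo.seq (.const (Q := fun s' => s' = s.setReg 5 0) rfl) ?_
    rintro _ rfl
    exact .store (by simpa using hs)

theorem _root_.Computable.two_pow {α : Type*} [Primcodable α] {f : α → ℕ} (hf : Computable f) :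
    Computable fun x => 2 ^ f x := by
  refine (Computable.nat_rec hf (Computable.const 1) (h := fun _ p => p.2 + p.2) ?_).of_eq ?_
  · exact (Computable.snd.comp Computable.snd).nat_add (Computable.snd.comp Computable.snd)
  · intro x
    induction f x with
    | zero => rfl
    | succ m ih =>
      simp only at ih ⊢
      rw [ih, pow_succ, mul_two]

theorem computable_slots : Computable slots := Computable.id.nat_mul Computable.id

theorem computable_expo : Computable expo :=
  ((Computable.const 4).nat_mul computable_slots).nat_add (Computable.const 1)

theorem le_gap_of_lt {n k g : ℕ} (h : 2 ^ 2 ^ (expo k * g) ≤ n) : g ≤ gap n k := by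
  have h1 : 2 ^ (expo k * g) < bits n := Nat.lt_size.2 h
  rw [gap, Nat.le_div_iff_mul_le (show 0 < expo k from Nat.succ_pos _), mul_comm]
  exact Nat.le_log_of_pow_le (by omega) h1.le

/-- If the approximation ratio is below the gap whenever the gap is large, then `W[1] = FPT`. -/
theorem not_w1NeFPT {ρ : ℕ → ℕ → ℝ} {P : RamProg} (hP : ApproximatesDomSetInFPTTime ρ P)
    {g : ℕ → ℕ} (hg : Computable g) (hlarge : ∀ k, expo k + slots k + 10 ≤ g k + 1)
    (hρ : ∀ k n, 0 < k → 0 < n → g k ≤ gap n k →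
      ρ (order n k) (slots k) * slots k ≤ 2 ^ gap n k) : ¬ W1NeFPT := by
  -- Two exponentials come from the gap being a fraction of `log log n`, the third from comparing
  -- the threshold with `2 ^ n`.
  have key : ∀ k n, 2 ^ 2 ^ 2 ^ (expo k * g k) + (16 * ((slots k + 1) * (slots k + 1)) + 2) <
      2 ^ n → 0 < n ∧ g k ≤ gap n k := by
    intro k n h
    have h1 : 2 ^ 2 ^ (expo k * g k) < n :=
      (Nat.pow_lt_pow_iff_right (by omega)).1 ((Nat.le_add_right _ _).trans_lt h)
    exact ⟨(Nat.zero_le _).trans_lt h1, le_gap_of_lt h1.le⟩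
  refine not_not.2 (exists_solvesClique hP
    (H := fun k => 2 ^ 2 ^ 2 ^ (expo k * g k) + (16 * ((slots k + 1) * (slots k + 1)) + 2)) ?_
    (fun k => Nat.le_add_left _ _) (fun k n _ h => ⟨(key k n h).1, ?_⟩)
    fun k n hk h => hρ k n hk (key k n h).1 (key k n h).2)
  · have := computable_slots.nat_add (Computable.const 1)
    exact (computable_expo.nat_mul hg).two_pow.two_pow.two_pow.nat_add
      (((Computable.const 16).nat_mul (this.nat_mul this)).nat_add (Computable.const 2))
  · exact (hlarge k).trans (Nat.succ_le_succ (key k n h).2)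

end Gap

/-! ### The inapproximability of `k`-DomSet -/

namespace Gap

/-- The logarithm of the order is at most `slots k + 2 * bits n`, and both summands are controlled
by `2 ^ posLen n k`. -/
theorem logb_order_le {n k g : ℕ} (hg : gap n k = g) :
    Real.logb 2 (order n k) ≤ 2 ^ (expo k * (g + 1) + 2) := by
  have h1 : order n k ≤ 2 ^ (slots k + 2 * bits n) := by
    rw [order, pow_add]
    exact Nat.mul_le_mul_right _ Nat.lt_two_pow_self
  have h2 : slots k ≤ 2 ^ posLen n k :=
    Nat.lt_two_pow_self.le.trans (Nat.pow_le_pow_right (by omega) (by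
      refine le_trans ?_ (Nat.le_mul_of_pos_right _ (Nat.succ_pos _))
      unfold expo
      omega))
  have h3 := bits_lt n k
  have h4 : slots k + 2 * bits n ≤ 2 ^ (posLen n k + 2) := by rw [pow_add]; omega
  have h5 : (0 : ℝ) < order n k := by
    have : 0 < order n k := Nat.mul_pos (Nat.succ_pos _) (by positivity)
    exact_mod_cast this
  have h6 : Real.logb 2 (order n k) ≤ (slots k + 2 * bits n : ℕ) := by
    rw [Real.logb_le_iff_le_rpow (by norm_num) h5, Real.rpow_natCast]
    exact_mod_cast h1
  refine h6.trans ?_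
  rw [← hg]
  exact_mod_cast h4

/-- Split `2 ^ gap n k` as `2 ^ q * 2 ^ slots k`: the second factor absorbs the factor `slots k`,
the first bounds the root. The root exponent is `4 * expo k`, which leaves room for rounding and for
having `q` in place of the gap. -/
theorem max_rpow_mul_le {n k : ℕ} (hg : 5 * slots k + 10 ≤ gap n k) :
    max 1 (Real.logb 2 (order n k) ^ (1 / ((16 * slots k + 4 : ℕ) : ℝ))) * slots k ≤
      2 ^ gap n k := by
  obtain ⟨q, hq⟩ : ∃ q, gap n k = q + slots k := ⟨gap n k - slots k, by omega⟩
  have h0 : 0 ≤ Real.logb 2 (order n k) := by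
    refine Real.logb_nonneg (by norm_num) ?_
    have : 1 ≤ order n k := Nat.mul_pos (Nat.succ_pos _) (by positivity)
    exact_mod_cast this
  have h1 : Real.logb 2 (order n k) ≤ ((2 : ℝ) ^ q) ^ (16 * slots k + 4) := by
    refine (logb_order_le rfl).trans ?_
    rw [← pow_mul]
    refine pow_le_pow_right₀ (by norm_num) ?_
    unfold expo
    rw [hq]
    nlinarith
  have h2 : Real.logb 2 (order n k) ^ (1 / ((16 * slots k + 4 : ℕ) : ℝ)) ≤ 2 ^ q := by
    refine (Real.rpow_le_rpow h0 h1 (by positivity)).trans (le_of_eq ?_)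
    rw [one_div, Real.pow_rpow_inv_natCast (by positivity) (by omega)]
  have h3 : (slots k : ℝ) ≤ 2 ^ slots k := by
    exact_mod_cast Nat.lt_two_pow_self.le
  rw [hq, pow_add]
  exact mul_le_mul (max_le (one_le_pow₀ (by norm_num)) h2) h3 (by positivity) (by positivity)

end Gap

theorem theorem1 (hW : W1NeFPT) :
    (∃ p : Polynomial ℕ, (∀ k : ℕ, 0 < p.eval k) ∧
      ¬ ∃ P : RamProg, ApproximatesDomSetInFPTTime
        (fun n k => max 1 (Real.logb 2 (n : ℝ) ^ (1 / ((p.eval k : ℕ) : ℝ)))) P) ∧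
    (∀ F : ℕ → ℕ, Computable F →
      ¬ ∃ P : RamProg, ApproximatesDomSetInFPTTime (fun _ k => (F k : ℝ)) P) := by
  -- The polynomial is evaluated at the new parameter `slots k`, where it equals `4 * expo k`.
  refine ⟨⟨16 * Polynomial.X + 4, fun k => by simp, ?_⟩, fun F hF => ?_⟩
  · rintro ⟨P, hP⟩
    refine Gap.not_w1NeFPT hP (g := fun k => Gap.expo k + Gap.slots k + 10)
      ((Gap.computable_expo.nat_add Gap.computable_slots).nat_add (Computable.const 10))
      (fun k => Nat.le_succ _) (fun k n _ _ hg => ?_) hW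
    have h := Gap.max_rpow_mul_le (n := n) (k := k) (by unfold Gap.expo at hg; omega)
    simpa using h
  · rintro ⟨P, hP⟩
    -- With `F (slots k) + slots k` below the gap, `2 ^ gap` exceeds the product `F (slots k) *
    -- slots k`. Computability of `F` makes the threshold computable.
    refine Gap.not_w1NeFPT hP (g := fun k => F (Gap.slots k) + (Gap.expo k + Gap.slots k + 10))
      ((hF.comp Gap.computable_slots).nat_add
        ((Gap.computable_expo.nat_add Gap.computable_slots).nat_add (Computable.const 10)))
      (fun k => by omega) (fun k n _ _ hg => ?_) hW
    have h : F (Gap.slots k) * Gap.slots k ≤ 2 ^ Gap.gap n k := by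
      calc F (Gap.slots k) * Gap.slots k ≤ 2 ^ F (Gap.slots k) * 2 ^ Gap.slots k :=
            Nat.mul_le_mul Nat.lt_two_pow_self.le Nat.lt_two_pow_self.le
        _ = 2 ^ (F (Gap.slots k) + Gap.slots k) := (pow_add _ _ _).symm
        _ ≤ 2 ^ Gap.gap n k := Nat.pow_le_pow_right (by omega) (by omega)
    exact_mod_cast h
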